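/- Let $x$ be a monochromatic finite rooted full binary tree with $n\ge 2$ leaves, let $\rho$ be the right vine with $n$ leaves, and let $\mathcal F=\mathrm{FS}\langle a,b\mid x(a)=\rho(b)\rangle$ be the category of $\{a,b\}$-coloured binary forests modulo the smallest equivalence relation that contains the pair $(x(a),\rho(b))$ and is closed under vertical composition and juxtaposition of forests. It is an Ore category (left-cancellative, with common right-multiples), and so are its versions $\mathcal F^F=\mathcal F$, $\mathcal F^T$, $\mathcal F^V$, in which the leaves of a forest carry a trivial, cyclic, or arbitrary permutation. For $X=F,T,V$ let $G^X$ be the isotropy group at the object $1$ of the fraction groupoid of $\mathcal F^X$; its elements are the classes $[t,s]$ of pairs of trees of $\mathcal F^X$ with the same number of leaves modulo $(t,s)\sim(tf,sf)$. Let $\mathfrak C=\varprojlim_t \mathrm{Leaf}(t)$ be the inverse limit of the leaf sets of the trees of $\mathcal F$ so that $\xi\in\mathfrak C$ selects a leaf $\xi(t)$ of every tree $t$ compatibly. Let $G^X$ act on $\mathfrak C$ by $([t\pi,s]\cdot\xi)(t)=\pi(\xi(s))$ for trees $t,s$ of $\mathcal F$ with the same number of leaves and permutations $\pi$ of the leaves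 (trivial for $X=F$, cyclic for $X=T$). Identify $\mathfrak C$ with $\{0,1\}^{\mathbf N}$ by means of the complete binary trees coloured by $a$, and let $j:\mathfrak C\to\mathbf R/\mathbf Z$, $j(p)=\sum_{k\ge1}p_k2^{-k}$. A bijection $h$ of $\mathbf R/\mathbf Z$ is induced by $g\in G^X$ if $h(j(\xi))=j(g\cdot\xi)$ for all $\xi\in\mathfrak C$ when $X=F,T$, and for all $\xi\in\mathfrak C$ whose binary sequence is not eventually $1$ when $X=V$. Let $\mathcal IV$ be the set of all right-continuous bijections $h$ of $\mathbf R/\mathbf Z$ such that, $BP(h)$ being the set of points where $h$ is not differentiable: $h$ has finitely many discontinuities; $BP(h)$ has finitely many accumulation points; for every accumulation point $p$ of $BP(h)$ some nontrivial open arc $(p,q)$ starting at $p$ contains no point of $BP(h)$; $BP(h)\subset\mathbf Z[1/2]/\mathbf Z$; $h(\mathbf Z[1/2]/\mathbf Z)\subset\mathbf Z[1/2]/\mathbf Z$; and wherever $h$ is differentiable, its derivative is an integer power of $2$. Let $\mathcal IT\subset\mathcal IV$ consist of the continuous elements and $\mathcal IF\subset\mathcal IT$ of those that moreover fix $0$.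 Then, for $X=F,T,V$, the set $\mathcal IX$ is a group under composition, every $g\in G^X$ induces exactly one bijection $\gamma^X(g)$ of $\mathbf R/\mathbf Z$, the map $\gamma^X$ is a group homomorphism, and its image $\gamma^X(G^X)$ is a subgroup of $\mathcal IX$. -/

import Mathlib

open CategoryTheory

namespace ForestSkein

/-! ### Coloured trees -/

/-- Finite rooted full binary trees whose interior vertices are coloured by `S` and whose leaves
carry labels in `α`. -/
inductive CTree (S α : Type) : Type
  | leaf : α → CTree S α
  | node : S → CTree S α → CTree S α → CTree S α

namespace CTree

variable {S α β γ : Type}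

/-- Gluing: `t.bind g` is `t` with the tree `g i` glued on top of every leaf labelled `i`. -/
def bind : CTree S α → (α → CTree S β) → CTree S β
  | leaf i, g => g i
  | node c l r, g => node c (l.bind g) (r.bind g)

/-- The labels of the leaves, read from left to right. -/
def leaves : CTree S α → List α
  | leaf i => [i]
  | node _ l r => l.leaves ++ r.leaves

/-- Colour every interior vertex of a monochromatic tree by `c`. -/
def paint (c : S) : CTree Unit α → CTree S α
  | leaf i => leaf i
  | node _ l r => node c (l.paint c) (r.paint c)

theorem bind_leaf (t : CTree S α) : t.bind leaf = t := by
  induction t with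
  | leaf i => rfl
  | node c l r hl hr => simp [bind, hl, hr]

theorem bind_bind (t : CTree S α) (g : α → CTree S β) (h : β → CTree S γ) :
    (t.bind g).bind h = t.bind fun i => (g i).bind h := by
  induction t with
  | leaf i => rfl
  | node c l r hl hr => simp [bind, hl, hr]

theorem leaves_bind (t : CTree S α) (g : α → CTree S β) :
    (t.bind g).leaves = t.leaves.flatMap fun i => (g i).leaves := by
  induction t with
  | leaf i => simp [bind, leaves]
  | node c l r hl hr => simp [bind, leaves, hl, hr]

theorem leaves_paint (c : S) (t : CTree Unit α) : (t.paint c).leaves = t.leaves := by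
  induction t with
  | leaf i => rfl
  | node _ l r hl hr => simp [paint, leaves, hl, hr]

theorem leaves_ne_nil (t : CTree S α) : t.leaves ≠ [] := by
  induction t with
  | leaf i => simp [leaves]
  | node c l r hl hr => simp [leaves, hl]

theorem bind_congr (t : CTree S α) {g h : α → CTree S β} (H : ∀ i ∈ t.leaves, g i = h i) :
    t.bind g = t.bind h := by
  induction t with
  | leaf i => exact H i (by simp [leaves])
  | node c l r hl hr =>
    simp only [leaves, List.mem_append] at H
    simp [bind, hl fun i hi => H i (Or.inl hi), hr fun i hi => H i (Or.inr hi)]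

end CTree

/-- A planar tree with `n` leaves: its leaves are numbered `0, 1, …, n - 1` from left to right.
For `S = Unit` this is a monochromatic tree. -/
structure PlanarTree (S : Type) (n : ℕ) where
  tree : CTree S (Fin n)
  planar : tree.leaves = List.finRange n

/-- The monochromatic tree `t` with every interior vertex coloured by `c`. -/
def PlanarTree.paint {S : Type} {n : ℕ} (c : S) (t : PlanarTree Unit n) : PlanarTree S n :=
  ⟨t.tree.paint c, by rw [CTree.leaves_paint, t.planar]⟩

/-- The right vine with `n` carets (hence `n + 1` leaves): the trivial tree if `n = 0`, and
otherwise a caret with the right vine with `n - 1` carets glued on its right leaf. -/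
def rightVine : (n : ℕ) → PlanarTree Unit (n + 1)
  | 0 => ⟨.leaf 0, rfl⟩
  | n + 1 => ⟨.node () (.leaf 0) ((rightVine n).tree.bind fun i => .leaf i.succ), by
      simp only [CTree.leaves, CTree.leaves_bind, (rightVine n).planar]
      rw [List.finRange_succ (n := n + 1), ← List.map_eq_flatMap]
      rfl⟩

/-! ### Forest-skein categories -/

/-- A skein relation over `S`: a pair of coloured trees with the same number of leaves. -/
structure SkeinRelation (S : Type) where
  n : ℕ
  lhs : PlanarTree S n
  rhs : PlanarTree S n

/-- The skein equivalence of trees: the smallest equivalence relation that contains `R` and is closed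
under composition (gluing equivalent trees on the corresponding leaves of equivalent trees). -/
inductive SkeinEq {S : Type} (R : Set (SkeinRelation S)) :
    {α : Type} → CTree S α → CTree S α → Prop
  | rel (r : SkeinRelation S) (h : r ∈ R) : SkeinEq R r.lhs.tree r.rhs.tree
  | refl {α : Type} (t : CTree S α) : SkeinEq R t t
  | symm {α : Type} {t u : CTree S α} : SkeinEq R t u → SkeinEq R u t
  | trans {α : Type} {t u v : CTree S α} : SkeinEq R t u → SkeinEq R u v → SkeinEq R t v
  | comp {α β : Type} {t u : CTree S α} {g h : α → CTree S β} :
      SkeinEq R t u → (∀ i, SkeinEq R (g i) (h i)) → SkeinEq R (t.bind g) (u.bind h)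

theorem SkeinEq.leaves_eq {S : Type} {R : Set (SkeinRelation S)} {α : Type} {t u : CTree S α}
    (h : SkeinEq R t u) : t.leaves = u.leaves := by
  induction h with
  | rel r h => rw [r.lhs.planar, r.rhs.planar]
  | refl t => rfl
  | symm _ ih => exact ih.symm
  | trans _ _ ih1 ih2 => exact ih1.trans ih2
  | comp _ _ ih1 ih2 => simp [CTree.leaves_bind, ih1, ih2]

/-- The three types of forest-skein categories and groups. -/
inductive FTV : Type
  | F
  | T
  | V

/-- A forest of type `V` with `l` leaves is a forest together with a permutation of its leaves. The
pair `(f, π)` is encoded by labelling the `π i`-th leaf of `f` by `i`. The list `L` of labels, read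
from left to right, is then an arbitrary rearrangement of `0, …, l - 1`; the permutation is cyclic if
and only if `L` is a rotation of `0, …, l - 1`, and trivial if and only if `L = [0, …, l - 1]`. -/
def FTV.Admits : FTV → {l : ℕ} → List (Fin l) → Prop
  | .F, l, L => L = List.finRange l
  | .T, l, L => L ~r List.finRange l
  | .V, l, L => L.Perm (List.finRange l)

theorem FTV.Admits.perm {X : FTV} {l : ℕ} {L : List (Fin l)} (h : X.Admits L) :
    L.Perm (List.finRange l) := by
  cases X with
  | F => exact List.Perm.of_eq h
  | T => exact List.IsRotated.perm h
  | V => exact h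

theorem FTV.admits_finRange (X : FTV) (l : ℕ) : X.Admits (List.finRange l) := by
  cases X with
  | F => exact rfl
  | T => exact List.IsRotated.refl _
  | V => exact List.Perm.refl _

theorem isRotated_flatMap {α β : Type} {L M : List α} (h : L ~r M) (g : α → List β) :
    L.flatMap g ~r M.flatMap g := by
  obtain ⟨k, hk, rfl⟩ := List.isRotated_iff_mod.1 h
  rw [List.rotate_eq_drop_append_take hk, List.flatMap_append]
  conv_lhs => rw [← List.take_append_drop k L, List.flatMap_append]
  exact List.isRotated_append

theorem FTV.Admits.comp {X : FTV} {l m : ℕ} {L : List (Fin l)} (h : X.Admits L)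
    {g : Fin l → List (Fin m)} (hg : X.Admits ((List.finRange l).flatMap g)) :
    X.Admits (L.flatMap g) := by
  cases X with
  | F => obtain rfl : L = _ := h; exact hg
  | T => exact (isRotated_flatMap h g).trans hg
  | V => exact (List.Perm.flatMap_right g h).trans hg

theorem FTV.Admits.cancel {X : FTV} {l m : ℕ} {L : List (Fin l)} (h : X.Admits L)
    {g : Fin l → List (Fin m)} (hg : X.Admits (L.flatMap g)) :
    X.Admits ((List.finRange l).flatMap g) := by
  cases X with
  | F => obtain rfl : L = _ := h; exact hg
  | T => exact (isRotated_flatMap h.symm g).trans hg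
  | V => exact (List.Perm.flatMap_right g h.symm).trans hg

/-- Free coloured forests of type `X` with `r` roots and `l` leaves: `r`-tuples of trees with a
labelling of all the leaves. -/
structure FreeForest (S : Type) (X : FTV) (r l : ℕ) where
  tree : Fin r → CTree S (Fin l)
  admits : X.Admits ((List.finRange r).flatMap fun i => (tree i).leaves)

section FreeForest

variable {S : Type} {X : FTV}

/-- The forest of `n` trivial trees. -/
def FreeForest.id (S : Type) (X : FTV) (n : ℕ) : FreeForest S X n n :=
  ⟨CTree.leaf, by simpa [CTree.leaves] using X.admits_finRange n⟩

/-- Vertical concatenation: the `i`-th tree of `g` is glued on the leaf of `f` labelled `i`. -/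
def FreeForest.comp {r l m : ℕ} (f : FreeForest S X r l) (g : FreeForest S X l m) :
    FreeForest S X r m :=
  ⟨fun i => (f.tree i).bind g.tree, by
    have := f.admits.comp g.admits
    simpa [CTree.leaves_bind, List.flatMap_assoc] using this⟩

/-- Two forests are skein equivalent if they are so tree by tree (closure under horizontal
concatenation). -/
def forestSetoid (R : Set (SkeinRelation S)) (X : FTV) (r l : ℕ) :
    Setoid (FreeForest S X r l) where
  r f g := ∀ i, SkeinEq R (f.tree i) (g.tree i)
  iseqv := ⟨fun _ _ => .refl _, fun h i => (h i).symm, fun h h' i => (h i).trans (h' i)⟩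

end FreeForest

/-- The objects of the forest-skein category of type `X` with presentation `⟨S | R⟩` are the natural
numbers. -/
structure FSCat {S : Type} (R : Set (SkeinRelation S)) (X : FTV) where
  size : ℕ

/-- The forest-skein category of type `X` with presentation `⟨S | R⟩`. A morphism `r ⟶ l` is a forest
of type `X` with `r` roots and `l` leaves up to the skein relations, and `f ≫ g` is the forest `f ∘ g`
with `f` at the bottom and `g` on top. -/
instance {S : Type} (R : Set (SkeinRelation S)) (X : FTV) : Category (FSCat R X) where
  Hom A B := Quotient (forestSetoid R X A.size B.size)
  id A := Quotient.mk _ (FreeForest.id S X A.size)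
  comp f g := Quotient.map₂ FreeForest.comp (fun _ _ h _ _ h' i => (h i).comp h') f g
  id_comp f := by
    induction f using Quotient.inductionOn with
    | h f => rfl
  comp_id f := by
    induction f using Quotient.inductionOn with
    | h f =>
      refine Quotient.sound fun i => ?_
      exact (CTree.bind_leaf (f.tree i)) ▸ SkeinEq.refl _
  assoc f g h := by
    induction f using Quotient.inductionOn with
    | h f =>
    induction g using Quotient.inductionOn with
    | h g =>
    induction h using Quotient.inductionOn with
    | h h =>
      refine Quotient.sound fun i => ?_
      show SkeinEq R (((f.tree i).bind g.tree).bind h.tree) _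
      rw [CTree.bind_bind]
      exact SkeinEq.refl _

/-- The morphism given by a free forest. -/
def FreeForest.hom {S : Type} (R : Set (SkeinRelation S)) {X : FTV} {r l : ℕ}
    (f : FreeForest S X r l) : (⟨r⟩ : FSCat R X) ⟶ ⟨l⟩ :=
  Quotient.mk (forestSetoid R X r l) f

/-! ### Ore categories and groups of fractions -/

/-- A category is Ore if it is left-cancellative and has common right-multiples. -/
class OreCategory (D : Type) [Category.{0} D] : Prop where
  left_cancel : ∀ {c d e : D} (f : c ⟶ d) (p q : d ⟶ e), f ≫ p = f ≫ q → p = q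
  common_multiple : ∀ {c d e : D} (g : c ⟶ d) (h : c ⟶ e),
    ∃ (z : D) (k : d ⟶ z) (l : e ⟶ z), g ≫ k = h ≫ l

section Frac

variable (D : Type) [Category.{0} D] (d : D)

/-- The pairs `(f, g)` of morphisms `d ⟶ c` with the same target. -/
def FracPair : Type := Σ c : D, (d ⟶ c) × (d ⟶ c)

/-- The relation `(f, g) ∼ (f ∘ p, g ∘ p)`. -/
def FracRel (u v : FracPair D d) : Prop :=
  ∃ p : u.1 ⟶ v.1, v.2.1 = u.2.1 ≫ p ∧ v.2.2 = u.2.2 ≫ p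

/-- The isotropy group at `d` of the fraction groupoid: the quotient of the set of pairs `(f, g)` by the
equivalence relation generated by `(f, g) ∼ (f ∘ p, g ∘ p)`. -/
def Frac : Type := Quot (FracRel D d)

variable {D d}

/-- The class `[f, g]`. -/
def Frac.mk {c : D} (f g : d ⟶ c) : Frac D d := Quot.mk _ ⟨c, f, g⟩

theorem Frac.mk_comp {c e : D} (f g : d ⟶ c) (p : c ⟶ e) :
    Frac.mk (f ≫ p) (g ≫ p) = Frac.mk f g :=
  (Quot.sound ⟨p, rfl, rfl⟩).symm

theorem Frac.ind {motive : Frac D d → Prop} (h : ∀ {c : D} (f g : d ⟶ c), motive (Frac.mk f g))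
    (x : Frac D d) : motive x := by
  induction x using Quot.ind with
  | mk u => exact h u.2.1 u.2.2

variable [OreCategory D]

/-- The product of two fractions: bring them to the form `[f, g]`, `[g, h]` and take `[f, h]`. -/
noncomputable def Frac.mulPair (u v : FracPair D d) : Frac D d :=
  let H := OreCategory.common_multiple u.2.2 v.2.1
  Frac.mk (u.2.1 ≫ H.choose_spec.choose) (v.2.2 ≫ H.choose_spec.choose_spec.choose)

theorem Frac.mulPair_eq {c c' e : D} (f g : d ⟶ c) (f' g' : d ⟶ c') (p : c ⟶ e) (q : c' ⟶ e)
    (h : g ≫ p = f' ≫ q) :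
    Frac.mulPair ⟨c, f, g⟩ ⟨c', f', g'⟩ = Frac.mk (f ≫ p) (g' ≫ q) := by
  let H := OreCategory.common_multiple g f'
  obtain ⟨p', hp'⟩ : ∃ p', p' = H.choose_spec.choose := ⟨_, rfl⟩
  obtain ⟨q', hq'⟩ : ∃ q', q' = H.choose_spec.choose_spec.choose := ⟨_, rfl⟩
  have h' : g ≫ p' = f' ≫ q' := by
    rw [hp', hq']; exact H.choose_spec.choose_spec.choose_spec
  have key : Frac.mulPair ⟨c, f, g⟩ ⟨c', f', g'⟩ = Frac.mk (f ≫ p') (g' ≫ q') := by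
    rw [hp', hq']; rfl
  rw [key]
  obtain ⟨z, k, l, hkl⟩ := OreCategory.common_multiple (g ≫ p') (g ≫ p)
  have h1 : p' ≫ k = p ≫ l := OreCategory.left_cancel g _ _ (by simpa using hkl)
  have h2 : q' ≫ k = q ≫ l := OreCategory.left_cancel f' _ _ (by
    rw [← Category.assoc, ← h', hkl, h, Category.assoc])
  rw [← Frac.mk_comp (f ≫ p') (g' ≫ q') k, ← Frac.mk_comp (f ≫ p) (g' ≫ q) l]
  simp only [Category.assoc, h1, h2]

noncomputable instance : Mul (Frac D d) where
  mul := Quot.lift (fun u => Quot.lift (fun v => Frac.mulPair u v) (by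
      rintro ⟨c, f, g⟩ ⟨c', f', g'⟩ ⟨p, hf, hg⟩
      obtain ⟨z, k, l, hkl⟩ := OreCategory.common_multiple u.2.2 f'
      obtain ⟨cu, fu, gu⟩ := u
      dsimp only at p hf hg hkl ⊢
      rw [Frac.mulPair_eq fu gu f' g' k l hkl,
        Frac.mulPair_eq fu gu f g k (p ≫ l) (by rw [hkl, hf, Category.assoc]), hg,
        Category.assoc])) (by
      rintro ⟨c, f, g⟩ ⟨c', f', g'⟩ ⟨p, hf, hg⟩
      funext v
      induction v using Quot.ind with
      | mk v =>
      obtain ⟨cv, fv, gv⟩ := v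
      dsimp only at p hf hg ⊢
      obtain ⟨z, k, l, hkl⟩ := OreCategory.common_multiple g' fv
      rw [Frac.mulPair_eq f' g' fv gv k l hkl,
        Frac.mulPair_eq f g fv gv (p ≫ k) l (by rw [← hkl, hg, Category.assoc]), hf,
        Category.assoc])

theorem Frac.mk_mul_mk {c c' e : D} (f g : d ⟶ c) (f' g' : d ⟶ c') (p : c ⟶ e) (q : c' ⟶ e)
    (h : g ≫ p = f' ≫ q) : Frac.mk f g * Frac.mk f' g' = Frac.mk (f ≫ p) (g' ≫ q) :=
  Frac.mulPair_eq f g f' g' p q h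

theorem Frac.mk_mul_mk_self {c : D} (f g h : d ⟶ c) :
    Frac.mk f g * Frac.mk g h = Frac.mk f h := by
  simpa using Frac.mk_mul_mk f g g h (𝟙 c) (𝟙 c) rfl

/-- The group of fractions at `d`, with `[f, g] * [g, h] = [f, h]` and `[f, g]⁻¹ = [g, f]`. -/
noncomputable instance : Group (Frac D d) where
  one := Frac.mk (𝟙 d) (𝟙 d)
  inv := Quot.lift (fun u => Frac.mk u.2.2 u.2.1) (by
    rintro ⟨c, f, g⟩ ⟨c', f', g'⟩ ⟨p, hf, hg⟩
    dsimp only at p hf hg ⊢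
    rw [hf, hg, Frac.mk_comp])
  mul_assoc x y z := by
    induction x using Frac.ind with
    | h f g =>
    induction y using Frac.ind with
    | h f' g' =>
    induction z using Frac.ind with
    | h f'' g'' =>
    obtain ⟨_, p, q, h⟩ := OreCategory.common_multiple g f'
    obtain ⟨_, p', q', h'⟩ := OreCategory.common_multiple (g' ≫ q) f''
    rw [Frac.mk_mul_mk f g f' g' p q h, Frac.mk_mul_mk _ _ _ _ p' q' h',
      Frac.mk_mul_mk f' g' f'' g'' (q ≫ p') q' (by rw [← h', Category.assoc]),
      Frac.mk_mul_mk f g _ _ (p ≫ p') (𝟙 _) (by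
        rw [Category.comp_id, ← Category.assoc, h, Category.assoc])]
    simp
  one_mul x := by
    induction x using Frac.ind with
    | h f g => exact (Frac.mk_mul_mk (𝟙 d) (𝟙 d) f g f (𝟙 _) (by simp)).trans (by simp)
  mul_one x := by
    induction x using Frac.ind with
    | h f g => exact (Frac.mk_mul_mk f g (𝟙 d) (𝟙 d) (𝟙 _) g (by simp)).trans (by simp)
  inv_mul_cancel x := by
    induction x using Frac.ind with
    | @h c f g =>
      refine (Frac.mk_mul_mk_self g f g).trans ?_
      have := Frac.mk_comp (𝟙 d) (𝟙 d) g
      rwa [Category.id_comp] at this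

end Frac

/-! ### Two colours and one relation -/

/-- The colours `a` and `b`. -/
inductive Colour : Type
  | a
  | b

/-- The skein presentation `⟨a, b | x(a) = y(b)⟩`, where `x` and `y` are monochromatic trees with the
same number of leaves. -/
def twoColour {n : ℕ} (x y : PlanarTree Unit (n + 2)) : Set (SkeinRelation Colour) :=
  {⟨n + 2, x.paint .a, y.paint .b⟩}

section Ore

variable {n : ℕ} (x y : PlanarTree Unit (n + 2))

/-- The side of colour `c` of the skein relation. -/
def side : Colour → PlanarTree Colour (n + 2)
  | .a => x.paint .a
  | .b => y.paint .b

theorem side_equiv (c c' : Colour) :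
    SkeinEq (twoColour x y) (side x y c).tree (side x y c').tree := by
  have h : SkeinEq (twoColour x y) (side x y .a).tree (side x y .b).tree :=
    SkeinEq.rel _ (Set.mem_singleton _)
  cases c <;> cases c'
  · exact .refl _
  · exact h
  · exact h.symm
  · exact .refl _

theorem side_eq_node (c : Colour) : ∃ p q, (side x y c).tree = .node c p q := by
  have key : ∀ t : PlanarTree Unit (n + 2), ∃ p q, (t.paint c).tree = .node c p q := by
    rintro ⟨t, ht⟩
    cases t with
    | leaf i => simpa [CTree.leaves] using congrArg List.length ht
    | node _ l r => exact ⟨_, _, rfl⟩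
  cases c
  · exact key x
  · exact key y

/-- What a skein equivalence says about the two sides of the root. -/
inductive RootEq {α : Type} : CTree Colour α → CTree Colour α → Prop
  | leaf (i : α) : RootEq (.leaf i) (.leaf i)
  | same (c : Colour) {l l' r r' : CTree Colour α} (hl : SkeinEq (twoColour x y) l l')
      (hr : SkeinEq (twoColour x y) r r') : RootEq (.node c l r) (.node c l' r')
  | diff (c c' : Colour) {l l' r r' : CTree Colour α} {p q p' q' : CTree Colour (Fin (n + 2))}
      (z : Fin (n + 2) → CTree Colour α)
      (h : (side x y c).tree = .node c p q) (h' : (side x y c').tree = .node c' p' q')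
      (hl : SkeinEq (twoColour x y) l (p.bind z)) (hr : SkeinEq (twoColour x y) r (q.bind z))
      (hl' : SkeinEq (twoColour x y) l' (p'.bind z))
      (hr' : SkeinEq (twoColour x y) r' (q'.bind z)) : RootEq (.node c l r) (.node c' l' r')

variable {x y}

theorem SkeinEq.bind_left {S : Type} {R : Set (SkeinRelation S)} {α β : Type} {t u : CTree S α}
    (h : SkeinEq R t u) (g : α → CTree S β) : SkeinEq R (t.bind g) (u.bind g) :=
  h.comp fun _ => .refl _

theorem SkeinEq.bind_right {S : Type} {R : Set (SkeinRelation S)} {α β : Type} (t : CTree S α)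
    {g h : α → CTree S β} (H : ∀ i, SkeinEq R (g i) (h i)) : SkeinEq R (t.bind g) (t.bind h) :=
  (SkeinEq.refl t).comp H

theorem SkeinEq.bind_right_mem {S : Type} {R : Set (SkeinRelation S)} {α β : Type} (t : CTree S α)
    {g h : α → CTree S β} (H : ∀ i ∈ t.leaves, SkeinEq R (g i) (h i)) :
    SkeinEq R (t.bind g) (t.bind h) := by
  classical
  have : t.bind g = t.bind fun i => if i ∈ t.leaves then g i else h i :=
    CTree.bind_congr t fun i hi => by simp [hi]
  rw [this]
  refine SkeinEq.bind_right t fun i => ?_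
  by_cases hi : i ∈ t.leaves
  · simpa [hi] using H i hi
  · simpa [hi] using SkeinEq.refl _

theorem SkeinEq.node {S : Type} {R : Set (SkeinRelation S)} {α : Type} (c : S)
    {l l' r r' : CTree S α} (hl : SkeinEq R l l') (hr : SkeinEq R r r') :
    SkeinEq R (.node c l r) (.node c l' r') :=
  SkeinEq.bind_right (.node c (.leaf true) (.leaf false))
    (g := fun i => cond i l r) (h := fun i => cond i l' r') (by rintro (_ | _) <;> assumption)

theorem RootEq.symm {α : Type} {t u : CTree Colour α} (h : RootEq x y t u) : RootEq x y u t := by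
  cases h with
  | leaf i => exact .leaf i
  | same c hl hr => exact .same c hl.symm hr.symm
  | diff c c' z h h' hl hr hl' hr' => exact .diff c' c z h' h hl' hr' hl hr

theorem bind_cancel_aux {s : ℕ} {α β : Type}
    (H : ∀ t u : CTree Colour α, t.leaves.length < s → SkeinEq (twoColour x y) t u → RootEq x y t u)
    (p : CTree Colour β) (z w : β → CTree Colour α) (hs : (p.bind z).leaves.length < s)
    (h : SkeinEq (twoColour x y) (p.bind z) (p.bind w)) :
    ∀ i ∈ p.leaves, SkeinEq (twoColour x y) (z i) (w i) := by
  induction p with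
  | leaf i =>
    intro j hj
    obtain rfl : j = i := by simpa [CTree.leaves] using hj
    exact h
  | node c l r ihl ihr =>
    have hs' : (l.bind z).leaves.length + (r.bind z).leaves.length < s := by
      simpa [CTree.bind, CTree.leaves] using hs
    have key : SkeinEq (twoColour x y) (l.bind z) (l.bind w) ∧
        SkeinEq (twoColour x y) (r.bind z) (r.bind w) := by
      generalize hL : l.bind z = L at *
      generalize hR : r.bind z = M at *
      generalize hL' : l.bind w = L' at *
      generalize hR' : r.bind w = M' at *
      have h1 : RootEq x y (.node c L M) (.node c L' M') := by
        have := H _ _ hs h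
        simpa [CTree.bind, hL, hR, hL', hR'] using this
      cases h1 with
      | same _ hl hr => exact ⟨hl, hr⟩
      | diff _ _ ζ h h' hl hr hl' hr' =>
        rw [h] at h'
        injection h' with _ e1 e2
        subst e1 e2
        exact ⟨hl.trans hl'.symm, hr.trans hr'.symm⟩
    intro i hi
    rcases List.mem_append.1 hi with hi | hi
    · exact ihl (by omega) key.1 i hi
    · exact ihr (by omega) key.2 i hi

theorem side_mem_leaves (c : Colour) {p q : CTree Colour (Fin (n + 2))}
    (h : (side x y c).tree = .node c p q) (i : Fin (n + 2)) : i ∈ p.leaves ∨ i ∈ q.leaves := by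
  have := (side x y c).planar
  rw [h] at this
  have hi := List.mem_finRange i
  rw [← this] at hi
  exact List.mem_append.1 hi

theorem RootEq.trans_aux {s : ℕ} {α : Type}
    (H : ∀ t u : CTree Colour α, t.leaves.length < s → SkeinEq (twoColour x y) t u → RootEq x y t u)
    {t u v : CTree Colour α} (hs : u.leaves.length ≤ s) (h1 : RootEq x y t u)
    (h2 : RootEq x y u v) : RootEq x y t v := by
  cases h1 with
  | leaf i => exact h2
  | same c hl hr =>
    cases h2 with
    | same _ hl' hr' => exact .same c (hl.trans hl') (hr.trans hr')
    | diff _ c' z h h' hl1 hr1 hl' hr' =>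
      exact .diff c c' z h h' (hl.trans hl1) (hr.trans hr1) hl' hr'
  | @diff c c' l l' r r' p q p' q' z h h' hl hr hl' hr' =>
    cases h2 with
    | same _ hl2 hr2 =>
      exact .diff c c' z h h' hl hr (hl2.symm.trans hl') (hr2.symm.trans hr')
    | diff _ c'' w k k' ml mr ml' mr' =>
      rw [h'] at k
      injection k with _ e1 e2
      subst e1 e2
      have hs' : l'.leaves.length + r'.leaves.length ≤ s := by simpa [CTree.leaves] using hs
      have := List.length_pos_iff.2 l'.leaves_ne_nil
      have := List.length_pos_iff.2 r'.leaves_ne_nil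
      have c1 := bind_cancel_aux H p' z w (by rw [← hl'.leaves_eq]; omega) (hl'.symm.trans ml)
      have c2 := bind_cancel_aux H q' z w (by rw [← hr'.leaves_eq]; omega) (hr'.symm.trans mr)
      have hzw : ∀ i, SkeinEq (twoColour x y) (w i) (z i) := fun i =>
        ((side_mem_leaves c' h' i).elim (c1 i) (c2 i)).symm
      exact .diff c c'' z h k' hl hr (ml'.trans (.bind_right _ hzw)) (mr'.trans (.bind_right _ hzw))

theorem length_leaves_le_bind {S α β : Type} (t : CTree S α) (g : α → CTree S β) :
    t.leaves.length ≤ (t.bind g).leaves.length := by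
  induction t with
  | leaf i => exact List.length_pos_iff.2 (g i).leaves_ne_nil
  | node c l r hl hr => simp only [CTree.bind, CTree.leaves, List.length_append]; omega

theorem SkeinEq.rootEq_aux {s : ℕ}
    (H : ∀ (α : Type) (t u : CTree Colour α), t.leaves.length < s →
      SkeinEq (twoColour x y) t u → RootEq x y t u)
    {α : Type} {t u : CTree Colour α} (h : SkeinEq (twoColour x y) t u) :
    t.leaves.length ≤ s → RootEq x y t u := by
  have refl' : ∀ {α : Type} (t : CTree Colour α), RootEq x y t t := by
    intro α t
    cases t with
    | leaf i => exact .leaf i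
    | node c l r => exact .same c (.refl _) (.refl _)
  induction h with
  | rel r h =>
    intro _
    obtain rfl : r = _ := h
    obtain ⟨p, q, h1⟩ := side_eq_node x y .a
    obtain ⟨p', q', h2⟩ := side_eq_node x y .b
    have h1' : (x.paint Colour.a).tree = .node .a p q := h1
    have h2' : (y.paint Colour.b).tree = .node .b p' q' := h2
    show RootEq x y (x.paint Colour.a).tree (y.paint Colour.b).tree
    rw [h1', h2']
    refine .diff .a .b CTree.leaf h1 h2 ?_ ?_ ?_ ?_ <;> rw [CTree.bind_leaf] <;> exact .refl _
  | refl t => exact fun _ => refl' t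
  | symm h ih => exact fun hs => (ih (h.leaves_eq ▸ hs)).symm
  | trans h1 h2 ih1 ih2 =>
    intro hs
    have hs' := h1.leaves_eq ▸ hs
    exact RootEq.trans_aux (H _) hs' (ih1 hs) (ih2 hs')
  | comp h hg ih ihg =>
    rename_i t u g k
    intro hs
    have h0 := ih ((length_leaves_le_bind t g).trans hs)
    cases h0 with
    | leaf i => exact ihg i hs
    | same c hl hr => exact .same c (hl.comp hg) (hr.comp hg)
    | @diff c c' l l' r r' p q p' q' z e e' hl hr hl' hr' =>
      refine .diff c c' (fun i => (z i).bind g) e e' ?_ ?_ ?_ ?_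
      · rw [← CTree.bind_bind]; exact hl.bind_left g
      · rw [← CTree.bind_bind]; exact hr.bind_left g
      · rw [← CTree.bind_bind]; exact hl'.comp fun i => (hg i).symm
      · rw [← CTree.bind_bind]; exact hr'.comp fun i => (hg i).symm

theorem SkeinEq.rootEq {α : Type} {t u : CTree Colour α} (h : SkeinEq (twoColour x y) t u) :
    RootEq x y t u := by
  have main : ∀ s : ℕ, ∀ (α : Type) (t u : CTree Colour α), t.leaves.length < s →
      SkeinEq (twoColour x y) t u → RootEq x y t u := by
    intro s
    induction s with
    | zero => intro α t u hs; omega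
    | succ s ih => exact fun α t u hs h => h.rootEq_aux ih (by omega)
  exact main _ α t u (Nat.lt_succ_self _) h

/-- Left-cancellation for trees. -/
theorem bind_cancel {α β : Type} (p : CTree Colour β) (z w : β → CTree Colour α)
    (h : SkeinEq (twoColour x y) (p.bind z) (p.bind w)) :
    ∀ i ∈ p.leaves, SkeinEq (twoColour x y) (z i) (w i) :=
  bind_cancel_aux (fun _ _ _ h => h.rootEq) p z w (Nat.lt_succ_self _) h

/-! Common right-multiples. -/

/-- The tree `t` has an extension that is skein equivalent to `w`. -/
def Divides (x y : PlanarTree Unit (n + 2)) {α β : Type} (t : CTree Colour α)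
    (w : CTree Colour β) : Prop :=
  ∃ k : α → CTree Colour β, SkeinEq (twoColour x y) (t.bind k) w

theorem Divides.bind {α β γ : Type} {t : CTree Colour α} {w : CTree Colour β}
    (h : Divides x y t w) (g : β → CTree Colour γ) : Divides x y t (w.bind g) := by
  obtain ⟨k, hk⟩ := h
  exact ⟨fun i => (k i).bind g, by rw [← CTree.bind_bind]; exact hk.bind_left g⟩

theorem Divides.node {α β : Type} (c : Colour) {l r : CTree Colour α} {l' r' : CTree Colour β}
    (hn : (CTree.node c l r).leaves.Nodup) (hl : Divides x y l l') (hr : Divides x y r r') :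
    Divides x y (.node c l r) (.node c l' r') := by
  classical
  obtain ⟨k, hk⟩ := hl
  obtain ⟨m, hm⟩ := hr
  refine ⟨fun i => if i ∈ l.leaves then k i else m i, SkeinEq.node c ?_ ?_⟩
  · rw [CTree.bind_congr l (h := k) fun i hi => by simp [hi]]
    exact hk
  · have hd := (List.nodup_append'.1 hn).2.2
    rw [CTree.bind_congr r (h := m) fun i hi => if_neg fun h => hd h hi]
    exact hm

/-- `FullTo c m w`: the first `m` levels of `w` are complete and coloured by `c`. -/
def FullTo (c : Colour) {α : Type} : ℕ → CTree Colour α → Prop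
  | 0, _ => True
  | _ + 1, .leaf _ => False
  | m + 1, .node c' l r => c' = c ∧ FullTo c m l ∧ FullTo c m r

/-- The complete quasi-tree with `m` levels of cells `side x y c`. -/
def quasi (x y : PlanarTree Unit (n + 2)) (c : Colour) :
    ℕ → CTree Colour (List (Fin (n + 2)))
  | 0 => .leaf []
  | m + 1 => (side x y c).tree.bind fun i => (quasi x y c m).bind fun w => .leaf (i :: w)

theorem quasi_equiv (c c' : Colour) (m : ℕ) :
    SkeinEq (twoColour x y) (quasi x y c m) (quasi x y c' m) := by
  induction m with
  | zero => exact .refl _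
  | succ m ih => exact (side_equiv x y c c').comp fun i => ih.bind_left _

theorem quasi_nodup (c : Colour) (m : ℕ) : (quasi x y c m).leaves.Nodup := by
  induction m with
  | zero => simp [quasi, CTree.leaves]
  | succ m ih =>
    simp only [quasi, CTree.leaves_bind, CTree.leaves, (side x y c).planar,
      ← List.map_eq_flatMap]
    rw [List.nodup_flatMap]
    refine ⟨fun i _ => ih.map (List.cons_injective), ?_⟩
    refine (List.nodup_finRange (n + 2)).imp fun {i j} hij => ?_
    simp only [Function.onFun, List.Disjoint, List.mem_map]
    rintro _ ⟨u, _, rfl⟩ ⟨v, _, h⟩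
    exact hij (List.cons.inj h).1.symm

theorem FullTo.mono {c : Colour} {α : Type} {m m' : ℕ} (hm : m ≤ m') {t : CTree Colour α}
    (h : FullTo c m' t) : FullTo c m t := by
  induction m' generalizing m t with
  | zero => obtain rfl : m = 0 := by omega
            exact h
  | succ m' ih =>
    cases m with
    | zero => trivial
    | succ m =>
      cases t with
      | leaf i => exact h.elim
      | node c' l r => exact ⟨h.1, ih (by omega) h.2.1, ih (by omega) h.2.2⟩

theorem FullTo.bind {c : Colour} {α β : Type} {m : ℕ} (c₀ : Colour) (p : CTree Unit α) (hc : c₀ = c) {g : α → CTree Colour β} (h : ∀ i, FullTo c m (g i)) :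
    FullTo c m ((p.paint c₀).bind g) := by
  induction p with
  | leaf i => exact h i
  | node u l r hl hr =>
    cases m with
    | zero => trivial
    | succ m => exact ⟨hc, hl.mono (Nat.le_succ m), hr.mono (Nat.le_succ m)⟩

theorem quasi_full (c : Colour) (m : ℕ) {β : Type} (g : List (Fin (n + 2)) → CTree Colour β) :
    FullTo c m ((quasi x y c m).bind g) := by
  induction m generalizing g with
  | zero => trivial
  | succ m ih =>
    have key : ∀ t : PlanarTree Unit (n + 2), FullTo c (m + 1)
        (((t.paint c).tree.bind fun i => (quasi x y c m).bind fun w => .leaf (i :: w)).bind g) := by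
      rintro ⟨t, ht⟩
      rw [CTree.bind_bind]
      have h : ∀ i, FullTo c m (((quasi x y c m).bind fun w => CTree.leaf (i :: w)).bind g) := by
        intro i
        rw [CTree.bind_bind]
        exact ih _
      cases t with
      | leaf i => simpa [CTree.leaves] using congrArg List.length ht
      | node _ l r => exact ⟨rfl, FullTo.bind c l rfl h, FullTo.bind c r rfl h⟩
    cases c
    · exact key x
    · exact key y

/-- A tree all of whose vertices have colour `c` and that has depth at most `m`. -/
def MonoDepth (c : Colour) {α : Type} : ℕ → CTree Colour α → Prop
  | _, .leaf _ => True
  | 0, .node _ _ _ => False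
  | m + 1, .node c' l r => c' = c ∧ MonoDepth c m l ∧ MonoDepth c m r

theorem MonoDepth.mono {c : Colour} {α : Type} {m m' : ℕ} (hm : m ≤ m') {t : CTree Colour α}
    (h : MonoDepth c m t) : MonoDepth c m' t := by
  induction t generalizing m m' with
  | leaf i => cases m' <;> trivial
  | node c' l r hl hr =>
    cases m with
    | zero => exact h.elim
    | succ m =>
      cases m' with
      | zero => omega
      | succ m' => exact ⟨h.1, hl (by omega) h.2.1, hr (by omega) h.2.2⟩

theorem MonoDepth.exists_paint {c : Colour} {α β : Type} (p : CTree Unit α)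
    {g : α → CTree Colour β} (h : ∀ i, ∃ m, MonoDepth c m (g i)) :
    ∃ m, MonoDepth c m ((p.paint c).bind g) := by
  induction p with
  | leaf i => exact h i
  | node u l r hl hr =>
    obtain ⟨m, hm⟩ := hl
    obtain ⟨m', hm'⟩ := hr
    exact ⟨max m m' + 1, rfl, hm.mono (le_max_left _ _), hm'.mono (le_max_right _ _)⟩

theorem quasi_mono (c : Colour) (m : ℕ) {β : Type} (g : List (Fin (n + 2)) → β) :
    ∃ d, MonoDepth c d ((quasi x y c m).bind fun w => .leaf (g w)) := by
  induction m generalizing g with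
  | zero => exact ⟨0, trivial⟩
  | succ m ih =>
    have key : ∀ t : PlanarTree Unit (n + 2), ∃ d, MonoDepth c d
        (((t.paint c).tree.bind fun i => (quasi x y c m).bind fun w => .leaf (i :: w)).bind
          fun w => .leaf (g w)) := by
      intro t
      rw [CTree.bind_bind]
      refine MonoDepth.exists_paint t.tree fun i => ?_
      rw [CTree.bind_bind]
      exact ih fun w => g (i :: w)
    cases c
    · exact key x
    · exact key y

theorem MonoDepth.exists_bind {c : Colour} {α β : Type} {m : ℕ} {t : CTree Colour α}
    {w : CTree Colour β} (ht : MonoDepth c m t) (hw : FullTo c m w) (hn : t.leaves.Nodup) :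
    ∃ k : α → CTree Colour β, t.bind k = w := by
  classical
  induction t generalizing m w with
  | leaf i => exact ⟨fun _ => w, rfl⟩
  | node c' l r hl hr =>
    cases m with
    | zero => exact ht.elim
    | succ m =>
      cases w with
      | leaf j => exact hw.elim
      | node d l' r' =>
        have hn' := List.nodup_append'.1 hn
        obtain ⟨k, hk⟩ := hl ht.2.1 hw.2.1 hn'.1
        obtain ⟨k', hk'⟩ := hr ht.2.2 hw.2.2 hn'.2.1
        refine ⟨fun i => if i ∈ l.leaves then k i else k' i, ?_⟩
        have e1 := CTree.bind_congr l (g := fun i => if i ∈ l.leaves then k i else k' i) (h := k)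
          fun i hi => by simp [hi]
        have e2 := CTree.bind_congr r (g := fun i => if i ∈ l.leaves then k i else k' i) (h := k')
          fun i hi => if_neg fun h => hn'.2.2 h hi
        simp only [CTree.bind, e1, e2, hk, hk', ht.1, hw.1]

/-- Every tree with distinct labels divides all large complete quasi-trees. -/
theorem exists_divides_quasi {α : Type} (t : CTree Colour α) (hn : t.leaves.Nodup) :
    ∃ M, ∀ m ≥ M, Divides x y t (quasi x y .a m) := by
  induction t with
  | leaf i => exact ⟨0, fun m _ => ⟨fun _ => quasi x y .a m, .refl _⟩⟩
  | node c l r hl hr =>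
    have hn' := List.nodup_append'.1 hn
    obtain ⟨M, hM⟩ := hl hn'.1
    obtain ⟨M', hM'⟩ := hr hn'.2.1
    have hL := hM _ (le_max_left M M')
    have hR := hM' _ (le_max_right M M')
    generalize max M M' = K at hL hR
    let g : Bool → CTree Colour (Bool × List (Fin (n + 2))) := fun i =>
      (quasi x y c K).bind fun w => .leaf (i, w)
    have hg : ∀ i, Divides x y (if i then l else r) (g i) := by
      intro i
      have h0 : Divides x y (if i then l else r) (quasi x y .a K) := by
        cases i
        · simpa using hR
        · simpa using hL
      obtain ⟨k, hk⟩ := h0.bind fun w => CTree.leaf (i, w)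
      exact ⟨k, hk.trans ((quasi_equiv .a c K).bind_left _)⟩
    obtain ⟨d, hd⟩ := quasi_mono (x := x) (y := y) c K fun w => (true, w)
    obtain ⟨d', hd'⟩ := quasi_mono (x := x) (y := y) c K fun w => (false, w)
    have hmono : MonoDepth c (max d d' + 1) (.node c (g true) (g false)) :=
      ⟨rfl, hd.mono (le_max_left _ _), hd'.mono (le_max_right _ _)⟩
    have hnd : (CTree.node c (g true) (g false)).leaves.Nodup := by
      simp only [CTree.leaves, g, CTree.leaves_bind, ← List.map_eq_flatMap]
      refine List.nodup_append'.2 ⟨(quasi_nodup c K).map (Prod.mk_right_injective _),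
        (quasi_nodup c K).map (Prod.mk_right_injective _), ?_⟩
      intro u hu hv
      simp only [List.mem_map] at hu hv
      obtain ⟨_, _, rfl⟩ := hu
      obtain ⟨_, _, h⟩ := hv
      exact absurd (congrArg Prod.fst h) (by simp)
    refine ⟨max d d' + 1, fun m hm => ?_⟩
    have hfull : FullTo c (max d d' + 1) (quasi x y c m) := by
      have := quasi_full (x := x) (y := y) c m CTree.leaf
      rw [CTree.bind_leaf] at this
      exact this.mono hm
    obtain ⟨k, hk⟩ := hmono.exists_bind hfull hnd
    have h1 : Divides x y (.node c l r) ((CTree.node c (g true) (g false)).bind k) :=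
      Divides.node c hn ((hg true).bind k) ((hg false).bind k)
    rw [hk] at h1
    obtain ⟨k', hk'⟩ := h1
    exact ⟨k', hk'.trans (quasi_equiv c .a m)⟩

theorem FreeForest.nodup {S : Type} {X : FTV} {r l : ℕ} (f : FreeForest S X r l) :
    ((List.finRange r).flatMap fun i => (f.tree i).leaves).Nodup :=
  f.admits.perm.nodup_iff.2 (List.nodup_finRange l)

theorem FreeForest.exists_mem {S : Type} {X : FTV} {r l : ℕ} (f : FreeForest S X r l) (j : Fin l) :
    ∃ i, j ∈ (f.tree i).leaves := by
  have := f.admits.perm.mem_iff.2 (List.mem_finRange j)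
  simpa using this

theorem FreeForest.root_unique {S : Type} {X : FTV} {r l : ℕ} (f : FreeForest S X r l) {j : Fin l}
    {i i' : Fin r} (h : j ∈ (f.tree i).leaves) (h' : j ∈ (f.tree i').leaves) : i = i' := by
  by_contra hne
  have := (List.nodup_flatMap.1 f.nodup).2
  have hp : (List.finRange r).Pairwise fun i i' =>
      Function.onFun List.Disjoint (fun i => (f.tree i).leaves) i i' := this
  have : Std.Symm fun i i' =>
      Function.onFun List.Disjoint (fun i => (f.tree i).leaves) i i' :=
    ⟨fun _ _ h => List.Disjoint.symm h⟩
  have := hp.forall (List.mem_finRange i)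
    (List.mem_finRange i') hne
  exact this h h'

/-- If every tree of `f` divides the corresponding tree of a planar forest `w`, then `f` extends to
`w`. -/
theorem FreeForest.exists_extension {X : FTV} {r l e : ℕ} (f : FreeForest Colour X r l)
    (w : FreeForest Colour .F r e) (h : ∀ i, Divides x y (f.tree i) (w.tree i)) :
    ∃ k : FreeForest Colour X l e,
      ∀ i, SkeinEq (twoColour x y) ((f.comp k).tree i) (w.tree i) := by
  choose k hk using h
  choose ρ hρ using f.exists_mem
  have hk' : ∀ i, (f.tree i).bind (fun j => k (ρ j) j) = (f.tree i).bind (k i) := fun i =>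
    CTree.bind_congr _ fun j hj => by rw [f.root_unique (hρ j) hj]
  refine ⟨⟨fun j => k (ρ j) j, f.admits.cancel ?_⟩, fun i => ?_⟩
  · rw [List.flatMap_assoc]
    have : ∀ i, ((f.tree i).leaves.flatMap fun j => (k (ρ j) j).leaves) = (w.tree i).leaves := by
      intro i
      rw [← CTree.leaves_bind, hk', (hk i).leaves_eq]
    simp only [this]
    rw [show _ = List.finRange e from w.admits]
    exact X.admits_finRange e
  · show SkeinEq _ ((f.tree i).bind fun j => k (ρ j) j) _
    rw [hk']
    exact hk i

theorem exists_planar (r m : ℕ) : ∃ (e : ℕ) (w : FreeForest Colour .F r e),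
    ∀ i, ∃ g : List (Fin (n + 2)) → CTree Colour (Fin e), w.tree i = (quasi x y .a m).bind g := by
  classical
  let L : List (Fin r × List (Fin (n + 2))) :=
    (List.finRange r).flatMap fun i => (quasi x y .a m).leaves.map fun w => (i, w)
  have hL : L.Nodup := by
    refine List.nodup_flatMap.2
      ⟨fun i _ => (quasi_nodup .a m).map (Prod.mk_right_injective _), ?_⟩
    refine (List.nodup_finRange r).imp fun {i j} hij => ?_
    simp only [Function.onFun, List.Disjoint, List.mem_map]
    rintro _ ⟨u, _, rfl⟩ ⟨v, _, h⟩
    exact hij (congrArg Prod.fst h).symm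
  by_cases he : L.length = 0
  · have hr : r = 0 := by
      by_contra hr
      obtain ⟨w, hw⟩ := List.exists_mem_of_ne_nil _ (quasi x y .a m).leaves_ne_nil
      have : ((⟨0, by omega⟩ : Fin r), w) ∈ L := by
        simp only [L, List.mem_flatMap, List.mem_map]
        exact ⟨_, List.mem_finRange _, w, hw, rfl⟩
      rw [List.length_eq_zero_iff.1 he] at this
      simp at this
    subst hr
    exact ⟨0, ⟨fun i => i.elim0, rfl⟩, fun i => i.elim0⟩
  · let idx : Fin r × List (Fin (n + 2)) → Fin L.length := fun u =>
      if h : L.idxOf u < L.length then ⟨L.idxOf u, h⟩ else ⟨0, by omega⟩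
    refine ⟨L.length, ⟨fun i => (quasi x y .a m).bind fun w => .leaf (idx (i, w)), ?_⟩,
      fun i => ⟨_, rfl⟩⟩
    have h1 : ((List.finRange r).flatMap fun i =>
        ((quasi x y .a m).bind fun w => CTree.leaf (S := Colour) (idx (i, w))).leaves)
        = L.map idx := by
      simp only [CTree.leaves_bind, CTree.leaves, ← List.map_eq_flatMap, L, List.map_flatMap,
        List.map_map]
      rfl
    show _ = _
    rw [h1]
    refine List.ext_getElem (by simp) fun i hi hi' => ?_
    have hi'' : i < L.length := by simpa using hi
    simp [idx, hL.idxOf_getElem i hi'', hi'']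

/-- The forest-skein categories of `⟨a, b | x(a) = y(b)⟩` are Ore categories. -/
instance (X : FTV) : OreCategory (FSCat (twoColour x y) X) where
  left_cancel f p q h := by
    induction f using Quotient.inductionOn with
    | h f =>
    induction p using Quotient.inductionOn with
    | h p =>
    induction q using Quotient.inductionOn with
    | h q =>
    refine Quotient.sound fun j => ?_
    obtain ⟨i, hi⟩ := f.exists_mem j
    exact bind_cancel (f.tree i) _ _ (Quotient.exact h i) j hi
  common_multiple {c d e} g h := by
    induction g using Quotient.inductionOn with
    | h g =>
    induction h using Quotient.inductionOn with
    | h h =>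
    have hg : ∀ i, ∃ M, ∀ m ≥ M, Divides x y (g.tree i) (quasi x y .a m) := fun i =>
      exists_divides_quasi _ ((List.nodup_flatMap.1 g.nodup).1 i (List.mem_finRange i))
    have hh : ∀ i, ∃ M, ∀ m ≥ M, Divides x y (h.tree i) (quasi x y .a m) := fun i =>
      exists_divides_quasi _ ((List.nodup_flatMap.1 h.nodup).1 i (List.mem_finRange i))
    choose M hM using hg
    choose M' hM' using hh
    let m := (Finset.univ.sup M) ⊔ (Finset.univ.sup M')
    obtain ⟨z, w, hw⟩ := exists_planar (x := x) (y := y) c.size m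
    have d1 : ∀ i, Divides x y (g.tree i) (w.tree i) := by
      intro i
      obtain ⟨u, hu⟩ := hw i
      rw [hu]
      exact (hM i m (le_sup_of_le_left (Finset.le_sup (Finset.mem_univ i)))).bind u
    have d2 : ∀ i, Divides x y (h.tree i) (w.tree i) := by
      intro i
      obtain ⟨u, hu⟩ := hw i
      rw [hu]
      exact (hM' i m (le_sup_of_le_right (Finset.le_sup (Finset.mem_univ i)))).bind u
    obtain ⟨k, hk⟩ := g.exists_extension w d1
    obtain ⟨l, hl⟩ := h.exists_extension w d2
    exact ⟨⟨z⟩, Quotient.mk _ k, Quotient.mk _ l,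
      Quotient.sound fun i => (hk i).trans (hl i).symm⟩

end Ore

/-! ### The canonical action -/

section Boundary

variable {S : Type} {R : Set (SkeinRelation S)} {X : FTV}

/-- `Above f j i`: the leaf `j` lies on the `i`-th tree of `f`. -/
def Above {A B : FSCat R X} (f : A ⟶ B) (j : Fin B.size) (i : Fin A.size) : Prop :=
  Quotient.lift (s := forestSetoid R X A.size B.size)
    (fun f : FreeForest S X A.size B.size => j ∈ (f.tree i).leaves)
    (fun _ _ h => by simp only [(h i).leaves_eq]) f

theorem exists_above {A B : FSCat R X} (f : A ⟶ B) (j : Fin B.size) : ∃ i, Above f j i := by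
  induction f using Quotient.inductionOn with
  | h f => exact f.exists_mem j

theorem Above.unique {A B : FSCat R X} {f : A ⟶ B} {j : Fin B.size} {i i' : Fin A.size}
    (h : Above f j i) (h' : Above f j i') : i = i' := by
  induction f using Quotient.inductionOn with
  | h f => exact f.root_unique h h'

theorem Above.comp {A B C : FSCat R X} {f : A ⟶ B} {g : B ⟶ C} {k : Fin C.size} {j : Fin B.size}
    {i : Fin A.size} (h : Above f j i) (h' : Above g k j) : Above (f ≫ g) k i := by
  induction f using Quotient.inductionOn with
  | h f =>
  induction g using Quotient.inductionOn with
  | h g =>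
    show k ∈ ((f.tree i).bind g.tree).leaves
    rw [CTree.leaves_bind]
    exact List.mem_flatMap.2 ⟨j, h, h'⟩

/-- The map from the leaves of a forest to its roots, that sends every leaf `j` to the index of the
tree on which it lies. -/
noncomputable def root {A B : FSCat R X} (f : A ⟶ B) (j : Fin B.size) : Fin A.size :=
  (exists_above f j).choose

theorem above_root {A B : FSCat R X} (f : A ⟶ B) (j : Fin B.size) : Above f j (root f j) :=
  (exists_above f j).choose_spec

theorem root_eq {A B : FSCat R X} {f : A ⟶ B} {j : Fin B.size} {i : Fin A.size}
    (h : Above f j i) : root f j = i := (above_root f j).unique h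

theorem root_comp {A B C : FSCat R X} (f : A ⟶ B) (g : B ⟶ C) (k : Fin C.size) :
    root (f ≫ g) k = root f (root g k) :=
  root_eq ((above_root f _).comp (above_root g k))

theorem root_id {A : FSCat R X} (j : Fin A.size) : root (𝟙 A) j = j :=
  root_eq (by
    show j ∈ (CTree.leaf (S := S) j).leaves
    simp [CTree.leaves])

/-- The object `1`: the morphisms `one ⟶ A` are the trees with `A.size` leaves. -/
abbrev one (R : Set (SkeinRelation S)) (X : FTV) : FSCat R X := ⟨1⟩

/-- The inverse limit of the sets of leaves over all trees `t` of type `X` along the maps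
`Leaf (t ∘ f) → Leaf t`. -/
@[ext]
structure Limit (R : Set (SkeinRelation S)) (X : FTV) where
  val : ∀ {A : FSCat R X}, (one R X ⟶ A) → Fin A.size
  compat : ∀ {A B : FSCat R X} (t : one R X ⟶ A) (f : A ⟶ B), root f (val (t ≫ f)) = val t

/-- The canonical space of the forest-skein category `⟨S | R⟩`: the inverse limit of the sets of leaves
of its trees. -/
abbrev Boundary (R : Set (SkeinRelation S)) : Type := Limit R .F

/-- A forest regarded as a forest of type `X` with trivial permutation of the leaves. -/
def FreeForest.toType (X : FTV) {r l : ℕ} (f : FreeForest S .F r l) : FreeForest S X r l :=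
  ⟨f.tree, by rw [show _ = List.finRange l from f.admits]; exact X.admits_finRange l⟩

/-- The object of the category of type `X` with the same number of leaves. -/
abbrev toObj (X : FTV) (A : FSCat R .F) : FSCat R X := ⟨A.size⟩

/-- The inclusion of the forest-skein category into its version of type `X`. -/
def incl (X : FTV) {A B : FSCat R .F} (f : A ⟶ B) : toObj X A ⟶ toObj X B :=
  Quotient.map (sa := forestSetoid R .F A.size B.size) (sb := forestSetoid R X A.size B.size)
    (FreeForest.toType X) (fun _ _ h => h) f

theorem incl_comp (X : FTV) {A B C : FSCat R .F} (f : A ⟶ B) (g : B ⟶ C) :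
    incl X (f ≫ g) = incl X f ≫ incl X g := by
  induction f using Quotient.inductionOn with
  | h f =>
  induction g using Quotient.inductionOn with
  | h g => rfl

theorem above_incl {A B : FSCat R .F} {f : A ⟶ B} {j : Fin B.size} {i : Fin A.size} :
    Above (incl X f) j i ↔ Above f j i := by
  induction f using Quotient.inductionOn with
  | h f => rfl

theorem root_incl {A B : FSCat R .F} (f : A ⟶ B) (j : Fin B.size) :
    root (incl X f) j = root f j := root_eq (above_incl.2 (above_root f j))

/-- Every tree of type `X` becomes planar after a permutation of its leaves. -/
theorem exists_planarize {A : FSCat R X} (u : one R X ⟶ A) :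
    ∃ (B : FSCat R .F) (p : A ⟶ toObj X B) (t : one R .F ⟶ B), u ≫ p = incl X t := by
  classical
  induction u using Quotient.inductionOn with
  | h u =>
  let L : List (Fin A.size) := (List.finRange 1).flatMap fun i => (u.tree i).leaves
  have hL : L.Nodup := u.nodup
  have hlen : L.length = A.size := u.admits.perm.length_eq.trans List.length_finRange
  have hidx : ∀ j, L.idxOf j < A.size := fun j =>
    (List.idxOf_lt_length_iff.2 (u.admits.perm.mem_iff.2 (List.mem_finRange j))).trans_eq hlen
  let g : Fin A.size → CTree S (Fin A.size) := fun j => .leaf ⟨L.idxOf j, hidx j⟩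
  have hg : L.flatMap (fun j => (g j).leaves) = List.finRange A.size := by
    simp only [g, CTree.leaves, ← List.map_eq_flatMap]
    refine List.ext_getElem (by simp [hlen]) fun i hi hi' => ?_
    have hi'' : i < L.length := by simpa using hi
    simp [hL.idxOf_getElem i hi'']
  let p : FreeForest S X A.size A.size := ⟨g, u.admits.cancel (by
    rw [show _ = List.finRange A.size from hg]
    exact X.admits_finRange _)⟩
  let t : FreeForest S .F 1 A.size := ⟨fun i => (u.tree i).bind g, by
    show _ = _
    simp only [CTree.leaves_bind]
    rw [← List.flatMap_assoc]
    exact hg⟩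
  exact ⟨⟨A.size⟩, Quotient.mk _ p, Quotient.mk _ t, rfl⟩

section Action

variable [OreCategory (FSCat R X)]

theorem act_unique (η : Limit R X) {A B C D : FSCat R X} (u v : one R X ⟶ A) (w : one R X ⟶ B)
    (k : A ⟶ C) (l : B ⟶ C) (k' : A ⟶ D) (l' : B ⟶ D) (h : u ≫ k = w ≫ l)
    (h' : u ≫ k' = w ≫ l') : root l (η.val (v ≫ k)) = root l' (η.val (v ≫ k')) := by
  obtain ⟨E, m, m', hm⟩ := OreCategory.common_multiple (u ≫ k) (u ≫ k')
  have h1 : k ≫ m = k' ≫ m' := OreCategory.left_cancel u _ _ (by simpa using hm)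
  have h2 : l ≫ m = l' ≫ m' := OreCategory.left_cancel w _ _ (by
    rw [← Category.assoc, ← h, hm, h', Category.assoc])
  rw [← η.compat (v ≫ k) m, ← η.compat (v ≫ k') m', ← root_comp, ← root_comp, h2,
    Category.assoc, Category.assoc, h1]

end Action

variable [OreCategory (FSCat R .F)] [OreCategory (FSCat R X)]

theorem planarize_unique (ξ : Boundary R) {A : FSCat R X} (u : one R X ⟶ A) {B C : FSCat R .F}
    (p : A ⟶ toObj X B) (q : A ⟶ toObj X C) (t : one R .F ⟶ B) (s : one R .F ⟶ C)
    (hp : u ≫ p = incl X t) (hq : u ≫ q = incl X s) :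
    root p (ξ.val t) = root q (ξ.val s) := by
  obtain ⟨D, k, l, h⟩ := OreCategory.common_multiple t s
  have h1 : p ≫ incl X k = q ≫ incl X l := OreCategory.left_cancel u _ _ (by
    rw [← Category.assoc, ← Category.assoc, hp, hq, ← incl_comp, ← incl_comp, h])
  rw [← ξ.compat t k, ← ξ.compat s l, ← h, ← root_incl (X := X) k, ← root_incl (X := X) l]
  exact (root_comp p (incl X k) _).symm.trans ((congrArg (root · _) h1).trans (root_comp q _ _))

/-- A point of the boundary determines a leaf of every tree of type `X`: relabelling the leaves of a
tree only relabels the chosen leaf. -/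
noncomputable def Boundary.extend (X : FTV) [OreCategory (FSCat R X)] (ξ : Boundary R) :
    Limit R X where
  val u := root (exists_planarize u).choose_spec.choose
    (ξ.val (exists_planarize u).choose_spec.choose_spec.choose)
  compat {A B} u f := by
    have h := (exists_planarize (u ≫ f)).choose_spec.choose_spec.choose_spec
    have h' := (exists_planarize u).choose_spec.choose_spec.choose_spec
    rw [← root_comp]
    exact planarize_unique ξ u _ _ _ _ (by rw [← h, Category.assoc]) h'

theorem Boundary.extend_val (ξ : Boundary R) {A : FSCat R X} {B : FSCat R .F} (u : one R X ⟶ A)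
    (p : A ⟶ toObj X B) (t : one R .F ⟶ B) (h : u ≫ p = incl X t) :
    (ξ.extend X).val u = root p (ξ.val t) :=
  planarize_unique ξ u _ _ _ _ (exists_planarize u).choose_spec.choose_spec.choose_spec h

/-- The points of the boundary correspond to the compatible choices of leaves of all trees of type
`X`. -/
noncomputable def Boundary.equivLimit (R : Set (SkeinRelation S)) (X : FTV)
    [OreCategory (FSCat R .F)] [OreCategory (FSCat R X)] : Boundary R ≃ Limit R X where
  toFun := Boundary.extend X
  invFun η :=
    { val := fun t => η.val (incl X t)
      compat := fun t f => by
        rw [← root_incl (X := X), incl_comp]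
        exact η.compat (incl X t) (incl X f) }
  left_inv ξ := by
    ext A t
    have := ξ.extend_val (incl X t) (𝟙 _) t (Category.comp_id _)
    exact congrArg Fin.val (this.trans (root_id _))
  right_inv η := by
    ext A u
    obtain ⟨B, p, t, h⟩ := exists_planarize u
    refine congrArg Fin.val ((Boundary.extend_val _ u p t h).trans ?_)
    show root p (η.val (incl X t)) = _
    rw [← h]
    exact η.compat u p

/-- The group of type `X` of the forest-skein category `⟨S | R⟩`. -/
abbrev FSGroup (R : Set (SkeinRelation S)) (X : FTV) : Type := Frac (FSCat R X) (one R X)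

end Boundary

section Action

variable {S : Type} {R : Set (SkeinRelation S)} {X : FTV} [OreCategory (FSCat R X)]

/-- The action of a pair `(u, v)` of trees: the leaf of `w` selected by the image of `η` is found by
choosing `k`, `l` with `u ∘ k = w ∘ l`; it is the one that carries the leaf of `w ∘ l` which has the
same number as the leaf of `v ∘ k` selected by `η`. -/
noncomputable def actPair (u : FracPair (FSCat R X) (one R X)) (η : Limit R X) : Limit R X where
  val w :=
    let H := OreCategory.common_multiple u.2.1 w
    root H.choose_spec.choose_spec.choose (η.val (u.2.2 ≫ H.choose_spec.choose))
  compat {A B} w f := by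
    have h := (OreCategory.common_multiple u.2.1 (w ≫ f)).choose_spec.choose_spec.choose_spec
    have h' := (OreCategory.common_multiple u.2.1 w).choose_spec.choose_spec.choose_spec
    rw [← root_comp]
    exact act_unique η u.2.1 u.2.2 w _ _ _ _ (h.trans (Category.assoc _ _ _)) h'

theorem actPair_val {A B C : FSCat R X} (u v : one R X ⟶ A) (η : Limit R X) (w : one R X ⟶ B)
    (k : A ⟶ C) (l : B ⟶ C) (h : u ≫ k = w ≫ l) :
    (actPair ⟨A, u, v⟩ η).val w = root l (η.val (v ≫ k)) :=
  act_unique η u v w _ _ _ _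
    (OreCategory.common_multiple u w).choose_spec.choose_spec.choose_spec h

/-- The action of the group on the inverse limit. -/
noncomputable def act (g : FSGroup R X) (η : Limit R X) : Limit R X :=
  Quot.lift (fun u => actPair u η) (by
    rintro ⟨A, u, v⟩ ⟨B, u', v'⟩ ⟨p, hu, hv⟩
    dsimp only at p hu hv ⊢
    ext C w
    obtain ⟨D, k, l, h⟩ := OreCategory.common_multiple u' w
    rw [actPair_val u' v' η w k l h,
      actPair_val u v η w (p ≫ k) l (by rw [← h, hu, Category.assoc]), hv, Category.assoc]) g

theorem act_val {A B C : FSCat R X} (u v : one R X ⟶ A) (η : Limit R X) (w : one R X ⟶ B)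
    (k : A ⟶ C) (l : B ⟶ C) (h : u ≫ k = w ≫ l) :
    (act (Frac.mk u v) η).val w = root l (η.val (v ≫ k)) := actPair_val u v η w k l h

/-- The action is characterised by `([u, v] · η)(u) = η(v)`. -/
theorem act_mk {A : FSCat R X} (u v : one R X ⟶ A) (η : Limit R X) :
    (act (Frac.mk u v) η).val u = η.val v := by
  rw [act_val u v η u (𝟙 A) (𝟙 A) rfl, root_id, Category.comp_id]

noncomputable instance : MulAction (FSGroup R X) (Limit R X) where
  smul := act
  one_smul η := by
    show act (Frac.mk (𝟙 _) (𝟙 _)) η = η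
    ext A w
    rw [act_val (𝟙 _) (𝟙 _) η w w (𝟙 A) (by simp), root_id, Category.id_comp]
  mul_smul g h η := by
    show act (g * h) η = act g (act h η)
    induction g using Frac.ind with
    | h f g =>
    induction h using Frac.ind with
    | h f' g' =>
    obtain ⟨_, p, q, h⟩ := OreCategory.common_multiple g f'
    rw [Frac.mk_mul_mk f g f' g' p q h]
    ext C w
    obtain ⟨D, k, l, hkl⟩ := OreCategory.common_multiple (f ≫ p) w
    rw [act_val _ _ η w k l hkl,
      act_val f g _ w (p ≫ k) l (by rw [← hkl, Category.assoc]), ← Category.assoc g p k, h,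
      Category.assoc f' q k, ← Frac.mk_comp f' g' (q ≫ k), act_mk, Category.assoc]

variable [OreCategory (FSCat R .F)]

/-- The canonical action of the group of type `X` on the boundary. It is the unique action with
`([t, s] · ξ)(t) = ξ(s)` for all trees `t`, `s` of type `X` with the same number of leaves. -/
noncomputable def canonicalAction (R : Set (SkeinRelation S)) (X : FTV)
    [OreCategory (FSCat R .F)] [OreCategory (FSCat R X)] :
    FSGroup R X →* Equiv.Perm (Boundary R) where
  toFun g := (Boundary.equivLimit R X).symm.permCongr (MulAction.toPerm g)
  map_one' := by
    ext1 ξ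
    simp [Equiv.permCongr_apply]
  map_mul' g h := by
    ext1 ξ
    simp [Equiv.permCongr_apply, mul_smul]

theorem canonicalAction_mk {A : FSCat R X} (t s : one R X ⟶ A) (ξ : Boundary R) :
    ((canonicalAction R X (Frac.mk t s) ξ).extend X).val t = (ξ.extend X).val s := by
  have : (canonicalAction R X (Frac.mk t s) ξ).extend X = act (Frac.mk t s) (ξ.extend X) :=
    (Boundary.equivLimit R X).apply_symm_apply _
  rw [this, act_mk]

end Action

/-! ### From the boundary to the circle -/

section Circle

variable {S : Type} (R : Set (SkeinRelation S))

/-- The forest that consists of `m` carets of colour `c`. -/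
def carets (c : S) (m : ℕ) : FreeForest S .F m (m * 2) :=
  ⟨fun i => .node c (.leaf ⟨i * 2, by omega⟩) (.leaf ⟨i * 2 + 1, by omega⟩), by
    show _ = _
    apply List.map_injective_iff.2 Fin.val_injective
    simp only [CTree.leaves, List.map_flatMap, List.map_coe_finRange_eq_range]
    induction m with
    | zero => rfl
    | succ m ih =>
      rw [List.finRange_succ_last]
      simp only [List.flatMap_append, List.flatMap_map]
      simp only [List.cons_append, List.nil_append, List.map_cons, List.map_nil, Fin.val_castSucc,
        List.flatMap_cons, List.flatMap_nil, Fin.val_last, List.append_nil] at ih ⊢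
      rw [ih, Nat.succ_mul, List.range_succ, List.range_succ]
      simp⟩

/-- The complete binary tree with `2 ^ k` leaves all of whose vertices have colour `c`. The address of
its `i`-th leaf is the binary expansion of `i` with `k` digits. -/
def completeTree (c : S) : (k : ℕ) → (one R .F ⟶ (⟨2 ^ k⟩ : FSCat R .F))
  | 0 => 𝟙 (one R .F)
  | k + 1 => completeTree c k ≫ (carets c (2 ^ k)).hom R

variable {R}

/-- The binary sequence of a point of the boundary: its first `k` digits are the address of the
leaf of the complete tree of colour `c` with `2 ^ k` leaves that the point selects. -/
def binaryDigit (c : S) (ξ : Boundary R) (k : ℕ) : ℕ := (ξ.val (completeTree R c (k + 1))).val % 2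

/-- The circle `ℝ / ℤ`. -/
abbrev Circle₁ : Type := AddCircle (1 : ℝ)

/-- The point `∑ p_k / 2 ^ k` of the circle, where `p_1, p_2, …` is the binary sequence of `ξ`. -/
noncomputable def circlePoint (c : S) (ξ : Boundary R) : Circle₁ :=
  ((∑' k : ℕ, (binaryDigit c ξ k : ℝ) / 2 ^ (k + 1) : ℝ) : Circle₁)

/-- The binary sequence of `ξ` is eventually equal to `1`. -/
def EventuallyOne (c : S) (ξ : Boundary R) : Prop := ∃ m, ∀ k ≥ m, binaryDigit c ξ k = 1

/-- `h` is the bijection of the circle induced by `g`. For the types `F` and `T` this means that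
`circlePoint` intertwines the action of `g` on the boundary with `h`. For the type `V`, where the
action on the boundary does not pass to the quotient, the circle is identified with the set of points
whose binary sequence is not eventually `1`. -/
def IsInduced (c : S) {X : FTV} [OreCategory (FSCat R .F)] [OreCategory (FSCat R X)]
    (g : FSGroup R X) (h : Equiv.Perm Circle₁) : Prop :=
  ∀ ξ : Boundary R, (X = .V → ¬ EventuallyOne c ξ) →
    h (circlePoint c ξ) = circlePoint c (canonicalAction R X g ξ)

end Circle

/-! ### Infinite piecewise linear bijections of the circle -/

section InfinitePL

/-- `h` is differentiable at `p` with derivative `m`: near a real number `x` that represents `p`, the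
map `h` lifts to a real function with derivative `m` at `x`. -/
def HasSlopeAt (h : Circle₁ → Circle₁) (m : ℝ) (p : Circle₁) : Prop :=
  ∃ (x : ℝ) (f : ℝ → ℝ), (x : Circle₁) = p ∧ HasDerivAt f m x ∧
    ∀ᶠ y : ℝ in nhds x, h (y : Circle₁) = (f y : Circle₁)

/-- The set of breakpoints: the points where `h` is not differentiable. -/
def breakpoints (h : Circle₁ → Circle₁) : Set Circle₁ := {p | ¬ ∃ m, HasSlopeAt h m p}

/-- The set `ℤ[1/2] / ℤ`. -/
def dyadic : Set Circle₁ := {p | ∃ (i : ℤ) (k : ℕ), p = (((i : ℝ) / 2 ^ k : ℝ) : Circle₁)}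

/-- Membership in the set of infinite piecewise linear bijections of type `V`. -/
structure IsInfinitePL (h : Equiv.Perm Circle₁) : Prop where
  right_continuous : ∀ x : ℝ, ContinuousWithinAt (fun y : ℝ => h (y : Circle₁)) (Set.Ici x) x
  finite_discontinuities : {p : Circle₁ | ¬ ContinuousAt h p}.Finite
  finite_accumulation : {p : Circle₁ | AccPt p (Filter.principal (breakpoints h))}.Finite
  accumulation_left : ∀ p : Circle₁, AccPt p (Filter.principal (breakpoints h)) →
    ∃ ε : ℝ, 0 < ε ∧ ∀ t : ℝ, 0 < t → t < ε → p + (t : Circle₁) ∉ breakpoints h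
  breakpoints_dyadic : breakpoints h ⊆ dyadic
  map_dyadic : ∀ p ∈ dyadic, h p ∈ dyadic
  slopes : ∀ (p : Circle₁) (m : ℝ), HasSlopeAt h m p → ∃ k : ℤ, m = (2 : ℝ) ^ k

/-- The sets `𝓘F ⊆ 𝓘T ⊆ 𝓘V`: no condition for `V`, continuity for `T`, and moreover `0` is fixed for
`F`. -/
def infinitePL : FTV → Set (Equiv.Perm Circle₁)
  | .V => {h | IsInfinitePL h}
  | .T => {h | IsInfinitePL h ∧ Continuous h}
  | .F => {h | IsInfinitePL h ∧ Continuous h ∧ h 0 = 0}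

end InfinitePL

/-- The skein presentation `⟨a, b | x(a) = ρ(b)⟩`, where `ρ` is the right vine with as many leaves
as `x`. -/
abbrev vinePresentation {n : ℕ} (x : PlanarTree Unit (n + 2)) : Set (SkeinRelation Colour) :=
  twoColour x (rightVine (n + 1))

end ForestSkein

namespace ForestSkein

open Filter Topology

/-! ### Local lifts of maps of the circle -/

/-! The skein relation can be realised on the Cantor space of binary sequences. Let colour `a` split
a sequence into its first digit and its tail. Cut the space along the leaves of x(a), and cut the
part over the last leaf in the same way again and again. This exhausts everything except 111… and
yields pieces 0, 1, 2, … from left to right. Let colour `b` split off piece 0, its right half being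
embedded by the map that moves every piece to the next one and fixes 111…. Applying this map n + 1
times is the embedding over the last leaf of x (`shiftPieces_iterate_eq`), so x(a) and ρ(b) have the
same leaf maps (`leafOf_relation`). Hence a binary sequence selects leaves of all trees compatibly
with the relation. Since every tree is a factor of a complete tree of colour `a`, the boundary has
no other points (`exists_limitOf_eq`).

In this model [t, s] carries the copy of the space over the leaf k of s to the copy over the leaf k
of t (`seqAction_glue`). These copies are embedded by branches (`IsBranch`): continuous maps that
respect equality of real values and, away from 111…, locally replace one prefix by another.
Replacing prefixes is affine between dyadic intervals, with a power of 2 as slope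
(`exists_affine_interval`). So the induced bijection is affine to the right of every point, and to
the left of every point outside a finite set of leaf ends; breakpoints accumulate only where a leaf
is approached at its end 111…, that is, from the left. For F and T the cyclic order of the leaves is
kept, the ends of neighbouring leaves match, and the action descends to a continuous map of the
circle. For V the sequences that are not eventually 1 represent each point once, and the action
preserves them.

That 𝓘X is a group rests on germs. By Darboux, a derivative whose values are powers of 2 is locally
constant, and breakpoints never accumulate from the right. So an element of 𝓘V is affine to the
right of every point (`IsInfinitePL.exists_rightAffineAt`), and conversely such germs replace
several of the axioms (`IsInfinitePL.of_rightAffineAt`). The germs compose and invert because their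
slopes are positive. What remains is to follow discontinuities, accumulation points and dyadic
points through products and inverses; for inverses the essential input is `continuousAt_symm`. -/

/-- The representative in `[c - 1/2, c + 1/2)` of a point of the circle. -/
noncomputable def repNear (c : ℝ) (q : Circle₁) : ℝ := AddCircle.equivIco 1 (c - 1 / 2) q

theorem coe_repNear (c : ℝ) (q : Circle₁) : (repNear c q : Circle₁) = q :=
  AddCircle.coe_equivIco

theorem repNear_coe {c y : ℝ} (h₁ : c - 1 / 2 ≤ y) (h₂ : y < c + 1 / 2) :
    repNear c (y : Circle₁) = y :=
  AddCircle.equivIco_coe_of_mem ⟨h₁, by linarith⟩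

theorem repNear_self (c : ℝ) : repNear c (c : Circle₁) = c :=
  repNear_coe (by linarith) (by linarith)

theorem eventually_repNear_coe {c y : ℝ} (h₁ : c - 1 / 2 < y) (h₂ : y < c + 1 / 2) :
    ∀ᶠ z : ℝ in 𝓝 y, repNear c (z : Circle₁) = z := by
  filter_upwards [Ioo_mem_nhds h₁ h₂] with z hz using repNear_coe hz.1.le hz.2

/-- The quotient map is a local homeomorphism, so local questions on the circle can be settled on
the real line. -/
theorem map_coe_nhds (x : ℝ) : map ((↑) : ℝ → Circle₁) (𝓝 x) = 𝓝 (x : Circle₁) :=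
  (AddCircle.isLocalHomeomorph_coe (p := (1 : ℝ))).map_nhds_eq x

theorem continuousAt_repNear {c : ℝ} {q : Circle₁} (hq : (c : Circle₁) = q) :
    ContinuousAt (repNear c) q := by
  subst hq
  rw [ContinuousAt, ← map_coe_nhds, tendsto_map'_iff, repNear_self]
  refine tendsto_id.congr' ?_
  filter_upwards [eventually_repNear_coe (c := c) (y := c) (by linarith) (by linarith)] with z hz
  exact hz.symm

theorem continuousAt_coe_iff {Y : Type*} [TopologicalSpace Y] {h : Circle₁ → Y} {x : ℝ} :
    ContinuousAt h (x : Circle₁) ↔ ContinuousAt (fun y : ℝ => h y) x := by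
  rw [ContinuousAt, ContinuousAt, ← map_coe_nhds, tendsto_map'_iff]
  rfl

theorem exists_coe_eq (p : Circle₁) : ∃ x : ℝ, (x : Circle₁) = p :=
  ⟨repNear 0 p, coe_repNear 0 p⟩

/-- Differentiability can be tested on the lift with values near `c`. -/
theorem hasSlopeAt_iff {h : Circle₁ → Circle₁} {m x c : ℝ} (hc : (c : Circle₁) = h x) :
    HasSlopeAt h m x ↔ HasDerivAt (fun y : ℝ => repNear c (h y)) m x := by
  constructor
  · rintro ⟨x', f, hx, hf, hfh⟩
    -- The given lift may be based at another representative of the point and may take values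
    -- outside the window around `c`. Integer translations `k` in the source and `l` in the target
    -- correct both.
    obtain ⟨k, hk⟩ : ∃ k : ℤ, x' = x + k := by
      have : ((x' - x : ℝ) : Circle₁) = 0 := by simp [hx]
      obtain ⟨k, hk⟩ := (AddCircle.coe_eq_zero_iff _).1 this
      exact ⟨k, by simp at hk; linarith⟩
    subst hk
    obtain ⟨l, hl⟩ : ∃ l : ℤ, c = f (x + k) + l := by
      have : ((c - f (x + k) : ℝ) : Circle₁) = 0 := by
        rw [AddCircle.coe_sub, hc, ← hfh.self_of_nhds, hx, sub_self]
      obtain ⟨l, hl⟩ := (AddCircle.coe_eq_zero_iff _).1 this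
      exact ⟨l, by simp at hl; linarith⟩
    have hint : ∀ (y : ℝ) (i : ℤ), ((y + i : ℝ) : Circle₁) = (y : Circle₁) := fun y i => by
      rw [AddCircle.coe_add, add_eq_left]
      exact (AddCircle.coe_eq_zero_iff _).2 ⟨i, by simp⟩
    have hd : HasDerivAt (fun y => f (y + k) + l) m x :=
      (HasDerivAt.comp_add_const x (k : ℝ) hf).add_const _
    refine hd.congr_of_eventuallyEq ?_
    have h1 : ∀ᶠ y : ℝ in 𝓝 x, h (y : Circle₁) = f (y + k) := by
      have : Tendsto (fun y : ℝ => y + k) (𝓝 x) (𝓝 (x + k)) := by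
        exact (continuous_id.add continuous_const).tendsto x
      filter_upwards [this.eventually hfh] with y hy
      rw [← hy, hint]
    have h2 : Tendsto (fun y => f (y + k) + l) (𝓝 x) (𝓝 c) := hl ▸ hd.continuousAt.tendsto
    filter_upwards [h1, h2.eventually (eventually_repNear_coe (c := c) (y := c)
      (by linarith) (by linarith))] with y hy hy'
    rw [hy, ← hint _ l, hy']
  · intro hd
    exact ⟨x, _, rfl, hd, .of_forall fun y => (coe_repNear _ _).symm⟩

theorem HasSlopeAt.continuousAt {h : Circle₁ → Circle₁} {m : ℝ} {p : Circle₁}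
    (H : HasSlopeAt h m p) : ContinuousAt h p := by
  obtain ⟨x, rfl⟩ := exists_coe_eq p
  obtain ⟨c, hc⟩ := exists_coe_eq (h x)
  have := ((hasSlopeAt_iff hc).1 H).continuousAt
  rw [continuousAt_coe_iff]
  have h2 : ContinuousAt (fun y : ℝ => ((repNear c (h y) : ℝ) : Circle₁)) x :=
    (AddCircle.continuous_mk' (1 : ℝ)).continuousAt.comp this
  simpa only [coe_repNear] using h2

/-- Lifts with different base points have the same derivative. -/
theorem HasSlopeAt.hasDerivAt {h : Circle₁ → Circle₁} {m x c : ℝ}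
    (H : HasSlopeAt h m (x : Circle₁)) (h₁ : c - 1 / 2 < repNear c (h x)) :
    HasDerivAt (fun y : ℝ => repNear c (h y)) m x := by
  have h₂ : repNear c (h x) < c + 1 / 2 := by
    have := (AddCircle.equivIco 1 (c - 1 / 2) (h x)).2.2
    have h3 : repNear c (h x) < c - 1 / 2 + 1 := this
    linarith
  have hd := (hasSlopeAt_iff (coe_repNear c (h x))).1 H
  refine hd.congr_of_eventuallyEq ?_
  have ht := hd.continuousAt.tendsto
  have hr : repNear (repNear c (h x)) (h x) = repNear c (h x) := by
    have := repNear_self (repNear c (h x))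
    rwa [coe_repNear] at this
  simp only [hr] at ht
  filter_upwards [ht.eventually (eventually_repNear_coe h₁ h₂)] with y hy
  rwa [coe_repNear] at hy

/-! ### One-sided affine germs -/

/-- To the right of `x` the map `h` is affine with slope `m`. -/
def RightAffineAt (h : Circle₁ → Circle₁) (m x : ℝ) : Prop :=
  ∀ᶠ y : ℝ in 𝓝[≥] x, h (y : Circle₁) = h x + ((m * (y - x) : ℝ) : Circle₁)

/-- To the left of `x` the map `h` is affine with slope `m`. -/
def LeftAffineAt (h : Circle₁ → Circle₁) (m x : ℝ) : Prop :=
  ∀ᶠ y : ℝ in 𝓝[≤] x, h (y : Circle₁) = h x + ((m * (y - x) : ℝ) : Circle₁)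

theorem tendsto_affine (m x : ℝ) :
    Tendsto (fun y : ℝ => ((m * (y - x) : ℝ) : Circle₁)) (𝓝 x) (𝓝 0) := by
  have : Continuous fun y : ℝ => ((m * (y - x) : ℝ) : Circle₁) :=
    (AddCircle.continuous_mk' (1 : ℝ)).comp (by fun_prop)
  simpa using this.tendsto x

theorem RightAffineAt.continuousWithinAt {h : Circle₁ → Circle₁} {m x : ℝ}
    (H : RightAffineAt h m x) : ContinuousWithinAt (fun y : ℝ => h y) (Set.Ici x) x := by
  have := (tendsto_const_nhds (x := h x)).add ((tendsto_affine m x).mono_left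
    (nhdsWithin_le_nhds (s := Set.Ici x)))
  rw [add_zero] at this
  exact this.congr' (H.mono fun y hy => hy.symm)

theorem LeftAffineAt.continuousWithinAt {h : Circle₁ → Circle₁} {m x : ℝ}
    (H : LeftAffineAt h m x) : ContinuousWithinAt (fun y : ℝ => h y) (Set.Iic x) x := by
  have := (tendsto_const_nhds (x := h x)).add ((tendsto_affine m x).mono_left
    (nhdsWithin_le_nhds (s := Set.Iic x)))
  rw [add_zero] at this
  exact this.congr' (H.mono fun y hy => hy.symm)

theorem RightAffineAt.continuousAt {h : Circle₁ → Circle₁} {m m' x : ℝ}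
    (H : RightAffineAt h m x) (H' : LeftAffineAt h m' x) : ContinuousAt h (x : Circle₁) := by
  rw [continuousAt_coe_iff, continuousAt_iff_continuous_left_right]
  exact ⟨H'.continuousWithinAt, H.continuousWithinAt⟩

theorem hasSlopeAt_of_eventually {h : Circle₁ → Circle₁} {m x : ℝ}
    (H : ∀ᶠ y : ℝ in 𝓝 x, h (y : Circle₁) = h x + ((m * (y - x) : ℝ) : Circle₁)) :
    HasSlopeAt h m (x : Circle₁) := by
  obtain ⟨c, hc⟩ := exists_coe_eq (h x)
  refine ⟨x, fun y => c + m * (y - x), rfl, ?_, ?_⟩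
  · have := (((hasDerivAt_id x).sub_const x).const_mul m).const_add c
    simpa using this
  · filter_upwards [H] with y hy
    rw [hy, AddCircle.coe_add, hc]

/-- Derivatives within `[x, ∞)` are unique, so the right germ alone decides what a two-sided slope
can be. -/
theorem RightAffineAt.slope_eq {h : Circle₁ → Circle₁} {m m' x : ℝ}
    (H : RightAffineAt h m x) (H' : HasSlopeAt h m' (x : Circle₁)) : m' = m := by
  obtain ⟨c, hc⟩ := exists_coe_eq (h x)
  have h1 := ((hasSlopeAt_iff hc).1 H').hasDerivWithinAt (s := Set.Ici x)
  have h2 : HasDerivWithinAt (fun y => c + m * (y - x)) m (Set.Ici x) x := by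
    have := (((hasDerivAt_id x).sub_const x).const_mul m).const_add c
    simpa using this.hasDerivWithinAt
  refine (uniqueDiffWithinAt_Ici x).eq_deriv _ h1 (h2.congr_of_eventuallyEq ?_ ?_)
  · have ht : Tendsto (fun y => c + m * (y - x)) (𝓝[≥] x) (𝓝 c) := by
      have := h2.continuousWithinAt.tendsto
      simpa using this
    filter_upwards [H, ht.eventually (eventually_repNear_coe (c := c) (y := c)
      (by linarith) (by linarith))] with y hy hy'
    rw [hy, ← hc, ← AddCircle.coe_add, hy']
  · show repNear c (h x) = _
    rw [← hc, repNear_self]; simp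

theorem RightAffineAt.exists_forall {h : Circle₁ → Circle₁} {m x : ℝ} (H : RightAffineAt h m x) :
    ∃ ε > 0, ∀ t : ℝ, 0 < t → t < ε → HasSlopeAt h m ((x + t : ℝ) : Circle₁) := by
  obtain ⟨u, hu, hux⟩ := mem_nhdsGE_iff_exists_Ico_subset.1 H
  refine ⟨u - x, sub_pos.2 hu, fun t h0 ht => hasSlopeAt_of_eventually ?_⟩
  have hy : x + t ∈ Set.Ioo x u := ⟨by linarith, by linarith⟩
  filter_upwards [isOpen_Ioo.mem_nhds hy] with z hz
  have h1 : h (z : Circle₁) = _ := hux ⟨hz.1.le, hz.2⟩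
  have h2 : h ((x + t : ℝ) : Circle₁) = _ := hux ⟨hy.1.le, hy.2⟩
  rw [h1, h2, add_assoc, ← AddCircle.coe_add]
  congr 2
  ring

/-! ### Dyadic points -/

theorem coe_mem_dyadic {x : ℝ} :
    (x : Circle₁) ∈ dyadic ↔ ∃ (i : ℤ) (k : ℕ), x = (i : ℝ) / 2 ^ k := by
  constructor
  · rintro ⟨i, k, h⟩
    have : ((x - i / 2 ^ k : ℝ) : Circle₁) = 0 := by rw [AddCircle.coe_sub, h, sub_self]
    obtain ⟨l, hl⟩ := (AddCircle.coe_eq_zero_iff _).1 this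
    refine ⟨i + l * 2 ^ k, k, ?_⟩
    have : x = i / 2 ^ k + l := by simp at hl; linarith
    rw [this]
    push_cast
    field_simp
  · rintro ⟨i, k, rfl⟩
    exact ⟨i, k, rfl⟩

theorem dyadic_add {p q : Circle₁} (hp : p ∈ dyadic) (hq : q ∈ dyadic) : p + q ∈ dyadic := by
  obtain ⟨i, k, rfl⟩ := hp
  obtain ⟨j, l, rfl⟩ := hq
  rw [← AddCircle.coe_add]
  refine coe_mem_dyadic.2 ⟨i * 2 ^ l + j * 2 ^ k, k + l, ?_⟩
  push_cast
  rw [pow_add]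
  field_simp

theorem dyadic_neg {p : Circle₁} (hp : p ∈ dyadic) : -p ∈ dyadic := by
  obtain ⟨i, k, rfl⟩ := hp
  rw [← AddCircle.coe_neg]
  exact coe_mem_dyadic.2 ⟨-i, k, by push_cast; ring⟩

theorem dyadic_sub {p q : Circle₁} (hp : p ∈ dyadic) (hq : q ∈ dyadic) : p - q ∈ dyadic :=
  sub_eq_add_neg p q ▸ dyadic_add hp (dyadic_neg hq)

theorem dyadic_zpow_mul (k : ℤ) {x : ℝ} (hx : (x : Circle₁) ∈ dyadic) :
    (((2 : ℝ) ^ k * x : ℝ) : Circle₁) ∈ dyadic := by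
  obtain ⟨i, l, rfl⟩ := coe_mem_dyadic.1 hx
  obtain ⟨m, rfl | rfl⟩ := k.eq_nat_or_neg
  · refine coe_mem_dyadic.2 ⟨2 ^ m * i, l, ?_⟩
    push_cast
    rw [zpow_natCast]
    ring
  · refine coe_mem_dyadic.2 ⟨i, m + l, ?_⟩
    rw [zpow_neg, zpow_natCast, pow_add]
    field_simp

theorem dyadic_zpow_mul_iff (k : ℤ) {x : ℝ} :
    (((2 : ℝ) ^ k * x : ℝ) : Circle₁) ∈ dyadic ↔ (x : Circle₁) ∈ dyadic := by
  refine ⟨fun h => ?_, dyadic_zpow_mul k⟩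
  have := dyadic_zpow_mul (-k) h
  rwa [← mul_assoc, ← zpow_add₀ two_ne_zero, neg_add_cancel, zpow_zero, one_mul] at this

theorem exists_dyadic_between {a b : ℝ} (hab : a < b) :
    ∃ z, a < z ∧ z < b ∧ (z : Circle₁) ∈ dyadic := by
  obtain ⟨k, hk⟩ := exists_pow_lt_of_lt_one (sub_pos.2 hab) (by norm_num : (1 / 2 : ℝ) < 1)
  have h2 : (0 : ℝ) < 2 ^ k := by positivity
  refine ⟨(⌊a * 2 ^ k⌋ + 1 : ℤ) / 2 ^ k, ?_, ?_, coe_mem_dyadic.2 ⟨_, _, rfl⟩⟩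
  · rw [lt_div_iff₀ h2]
    push_cast
    exact Int.lt_floor_add_one _
  · have h1 : (⌊a * 2 ^ k⌋ : ℝ) ≤ a * 2 ^ k := Int.floor_le _
    rw [div_lt_iff₀ h2]
    push_cast
    rw [one_div, inv_pow, inv_lt_iff_one_lt_mul₀ h2] at hk
    nlinarith

/-! ### Germs of infinite piecewise linear bijections -/

/-- A map with dyadic slopes near a point is affine near this point. -/
theorem eventually_affine {h : Circle₁ → Circle₁} {x : ℝ}
    (H : ∀ᶠ y : ℝ in 𝓝 x, ∃ k : ℤ, HasSlopeAt h (2 ^ k) (y : Circle₁)) :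
    ∃ k : ℤ, ∀ᶠ y : ℝ in 𝓝 x, h (y : Circle₁) = h x + (((2 : ℝ) ^ k * (y - x) : ℝ) : Circle₁) := by
  obtain ⟨c, hc⟩ := exists_coe_eq (h x)
  set F : ℝ → ℝ := fun y => repNear c (h y) with hF
  have hFx : F x = c := by simp only [hF]; rw [← hc, repNear_self]
  have hcont : ContinuousAt F x := by
    obtain ⟨k, hk⟩ := H.self_of_nhds
    exact ((hasSlopeAt_iff hc).1 hk).continuousAt
  -- The representative jumps only at the left end of its window; staying away from it lets one lift
  -- `F` serve for all nearby points.
  have hev : ∀ᶠ y in 𝓝 x, c - 1 / 2 < F y :=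
    hcont.eventually_const_lt (by rw [hFx]; linarith)
  obtain ⟨ε, hε, hball⟩ := Metric.eventually_nhds_iff_ball.1 (H.and hev)
  have hder : ∀ y ∈ Metric.ball x ε, ∃ k : ℤ, HasDerivAt F (2 ^ k) y := fun y hy => by
    obtain ⟨⟨k, hk⟩, hy'⟩ := hball y hy
    exact ⟨k, hk.hasDerivAt hy'⟩
  rw [Real.ball_eq_Ioo] at hder
  have hx : x ∈ Set.Ioo (x - ε) (x + ε) := ⟨by linarith, by linarith⟩
  -- Darboux: the values of a derivative form an interval.
  have hord := (Set.ordConnected_Ioo (a := x - ε) (b := x + ε)).image_deriv (f := F)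
    fun y hy => (hder y hy).choose_spec.differentiableAt
  have hval : ∀ m ∈ deriv F '' Set.Ioo (x - ε) (x + ε), ∃ k : ℤ, m = (2 : ℝ) ^ k := by
    rintro _ ⟨y, hy, rfl⟩
    obtain ⟨k, hk⟩ := hder y hy
    exact ⟨k, hk.deriv⟩
  have hno : ∀ i j : ℤ, (2 : ℝ) ^ i ∈ deriv F '' Set.Ioo (x - ε) (x + ε) →
      (2 : ℝ) ^ j ∈ deriv F '' Set.Ioo (x - ε) (x + ε) → ¬ i < j := by
    intro i j hi hj hij
    have hpos : (0 : ℝ) < 2 ^ i := by positivity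
    have hj2 : (2 : ℝ) ^ i * 2 ≤ 2 ^ j := by
      rw [← zpow_add_one₀ two_ne_zero]
      exact zpow_le_zpow_right₀ one_le_two (by omega)
    -- The factor 3/2 gives an intermediate value strictly between the consecutive powers 2^i and
    -- 2^(i+1), hence one that is not a power of 2.
    obtain ⟨l, hl⟩ := hval _ (hord.out hi hj (⟨by linarith, by linarith⟩ :
      (2 : ℝ) ^ i * (3 / 2) ∈ Set.Icc _ _))
    have h1 : (2 : ℝ) ^ i < 2 ^ l := by rw [← hl]; linarith
    have h2 : (2 : ℝ) ^ l < 2 ^ (i + 1) := by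
      rw [← hl, zpow_add_one₀ two_ne_zero]; linarith
    have h1' := (zpow_lt_zpow_iff_right₀ one_lt_two).1 h1
    have h2' := (zpow_lt_zpow_iff_right₀ one_lt_two).1 h2
    omega
  obtain ⟨k, hk⟩ := hder x hx
  have hkmem : (2 : ℝ) ^ k ∈ deriv F '' Set.Ioo (x - ε) (x + ε) := ⟨x, hx, hk.deriv⟩
  have hder' : ∀ y ∈ Set.Ioo (x - ε) (x + ε), HasDerivAt F (2 ^ k) y := by
    intro y hy
    obtain ⟨l, hl⟩ := hder y hy
    have hlmem : (2 : ℝ) ^ l ∈ deriv F '' Set.Ioo (x - ε) (x + ε) := ⟨y, hy, hl.deriv⟩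
    have : l = k := le_antisymm (not_lt.1 (hno _ _ hkmem hlmem)) (not_lt.1 (hno _ _ hlmem hkmem))
    exact this ▸ hl
  refine ⟨k, ?_⟩
  filter_upwards [isOpen_Ioo.mem_nhds hx] with y hy
  have hG : ∀ z ∈ Set.Ioo (x - ε) (x + ε), HasDerivWithinAt (fun z => F z - 2 ^ k * z) 0
      (Set.Ioo (x - ε) (x + ε)) z := fun z hz => by
    have := (hder' z hz).fun_sub ((hasDerivAt_id' z).const_mul ((2 : ℝ) ^ k))
    rw [mul_one, sub_self] at this
    exact this.hasDerivWithinAt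
  have hconst := (convex_Ioo (x - ε) (x + ε)).is_const_of_fderivWithin_eq_zero (𝕜 := ℝ)
    (f := fun z => F z - 2 ^ k * z) (fun z hz => (hG z hz).differentiableWithinAt) (fun z hz => by
      have hd := (hG z hz).hasFDerivWithinAt.fderivWithin (isOpen_Ioo.uniqueDiffWithinAt hz)
      rw [hd]; ext; simp) hx hy
  have h1 : F y = F x + 2 ^ k * (y - x) := by
    have : F x - 2 ^ k * x = F y - 2 ^ k * y := hconst
    linarith
  have h2 : ((F y : ℝ) : Circle₁) = h y := coe_repNear _ _
  have h3 : ((F x : ℝ) : Circle₁) = h x := coe_repNear _ _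
  rw [← h2, ← h3, h1, AddCircle.coe_add]

/-- Local affine formulas patch together along the connected open interval, and continuity from the
right carries the common formula to its end point. -/
theorem exists_rightAffineAt {h : Circle₁ → Circle₁} {x ε : ℝ} (hε : 0 < ε)
    (hx : ContinuousWithinAt (fun y : ℝ => h (y : Circle₁)) (Set.Ici x) x)
    (H : ∀ y ∈ Set.Ioo x (x + ε), ∃ k : ℤ, HasSlopeAt h (2 ^ k) (y : Circle₁)) :
    ∃ k : ℤ, RightAffineAt h (2 ^ k) x := by
  have H1 : ∀ y : ℝ, ∃ k : ℤ, y ∈ Set.Ioo x (x + ε) → ∀ᶠ z : ℝ in 𝓝 y,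
      h (z : Circle₁) = h y + (((2 : ℝ) ^ k * (z - y) : ℝ) : Circle₁) := by
    intro y
    by_cases hy : y ∈ Set.Ioo x (x + ε)
    · obtain ⟨k, hk⟩ := eventually_affine (Filter.mem_of_superset (isOpen_Ioo.mem_nhds hy) H)
      exact ⟨k, fun _ => hk⟩
    · exact ⟨0, fun h => (hy h).elim⟩
  choose k hk using H1
  have key : ∀ y ∈ Set.Ioo x (x + ε), ∀ z ∈ Set.Ioo x (x + ε), k y = k z ∧
      h (z : Circle₁) = h y + (((2 : ℝ) ^ k y * (z - y) : ℝ) : Circle₁) := by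
    intro y hy z hz
    -- Sharing the exponent and the affine formula is symmetric and transitive, and it holds between
    -- a point and its neighbours; connectedness does the rest.
    refine isPreconnected_Ioo.induction₂ (fun y z => k y = k z ∧
      h (z : Circle₁) = h y + (((2 : ℝ) ^ k y * (z - y) : ℝ) : Circle₁)) ?_ ?_ ?_ hy hz
    · intro y hy
      refine mem_nhdsWithin_of_mem_nhds ?_
      filter_upwards [(hk y hy).eventually_nhds, isOpen_Ioo.mem_nhds hy] with z hz hz'
      refine ⟨?_, hz.self_of_nhds⟩
      have h1 : HasSlopeAt h ((2 : ℝ) ^ k y) (z : Circle₁) := by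
        refine hasSlopeAt_of_eventually ?_
        filter_upwards [hz] with w hw
        rw [hw, hz.self_of_nhds, add_assoc, ← AddCircle.coe_add]
        congr 2
        ring
      have h2 : RightAffineAt h ((2 : ℝ) ^ k z) z := (hk z hz').filter_mono nhdsWithin_le_nhds
      exact zpow_right_injective₀ two_pos (by norm_num) (h2.slope_eq h1)
    · rintro u v w - - - ⟨h1, h2⟩ ⟨h3, h4⟩
      refine ⟨h1.trans h3, ?_⟩
      rw [h4, h2, add_assoc, ← AddCircle.coe_add, ← h1]
      congr 2
      ring
    · rintro u v - - ⟨h1, h2⟩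
      refine ⟨h1.symm, ?_⟩
      rw [h2, add_assoc, ← AddCircle.coe_add, ← h1]
      ring_nf
      simp
  have hm : x + ε / 2 ∈ Set.Ioo x (x + ε) := ⟨by linarith, by linarith⟩
  set y := x + ε / 2
  have hIoo : ∀ᶠ z : ℝ in 𝓝[>] x, z ∈ Set.Ioo x (x + ε) := Ioo_mem_nhdsGT (by linarith)
  have hlim : Tendsto (fun z : ℝ => h (z : Circle₁)) (𝓝[>] x)
      (𝓝 (h y + (((2 : ℝ) ^ k y * (x - y) : ℝ) : Circle₁))) := by
    have hc : Continuous fun z : ℝ => h y + (((2 : ℝ) ^ k y * (z - y) : ℝ) : Circle₁) :=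
      continuous_const.add ((AddCircle.continuous_mk' (1 : ℝ)).comp (by fun_prop))
    refine ((hc.tendsto x).mono_left nhdsWithin_le_nhds).congr' ?_
    filter_upwards [hIoo] with z hz using ((key y hm z hz).2).symm
  -- Both the map and the affine formula have a limit at `x` from the right, which identifies `h x`.
  have hval := tendsto_nhds_unique (hx.tendsto.mono_left (nhdsWithin_mono x Set.Ioi_subset_Ici_self))
    hlim
  refine ⟨k y, ?_⟩
  have : ∀ᶠ z : ℝ in 𝓝[≥] x, z ∈ Set.Ico x (x + ε) := Ico_mem_nhdsGE (by linarith)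
  filter_upwards [this] with z hz
  rcases hz.1.eq_or_lt with rfl | hlt
  · simp
  · rw [(key y hm z ⟨hlt, hz.2⟩).2, hval, add_assoc, ← AddCircle.coe_add]
    congr 2
    ring

theorem coe_injOn_Icc {a b : ℝ} (hab : b < a + 1) :
    Set.InjOn ((↑) : ℝ → Circle₁) (Set.Icc a b) := by
  intro y hy z hz h
  exact (AddCircle.coe_eq_coe_iff_of_mem_Ico (p := (1 : ℝ)) (a := a)
    ⟨hy.1, hy.2.trans_lt hab⟩ ⟨hz.1, hz.2.trans_lt hab⟩).1 h

theorem eventually_not_mem_of_not_accPt {B : Set Circle₁} {x : ℝ}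
    (h : ¬ AccPt (x : Circle₁) (𝓟 B)) : ∃ ε > 0, ∀ y ∈ Set.Ioo x (x + ε), (y : Circle₁) ∉ B := by
  rw [accPt_iff_frequently, not_frequently, ← map_coe_nhds, eventually_map] at h
  obtain ⟨ε, hε, hball⟩ := Metric.eventually_nhds_iff_ball.1 h
  refine ⟨min ε (1 / 2), by positivity, fun y hy hB => ?_⟩
  have h1 := min_le_left ε (1 / 2)
  have h2 := min_le_right ε (1 / 2)
  refine hball y ?_ ⟨fun he => ?_, hB⟩
  · rw [Real.ball_eq_Ioo]; exact ⟨by linarith [hy.1], by linarith [hy.2]⟩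
  · have := coe_injOn_Icc (a := x) (b := x + 1 / 2) (by linarith) ⟨hy.1.le, by linarith [hy.2]⟩
      ⟨le_rfl, by linarith⟩ he
    exact hy.1.ne' this

/-- No breakpoints accumulate at `x` from the right: at an accumulation point this is an axiom,
elsewhere it is clear. Between `x` and the next breakpoint the slopes are powers of 2. -/
theorem IsInfinitePL.exists_rightAffineAt {h : Equiv.Perm Circle₁} (H : IsInfinitePL h) (x : ℝ) :
    ∃ k : ℤ, RightAffineAt h (2 ^ k) x := by
  have : ∃ ε > 0, ∀ y ∈ Set.Ioo x (x + ε), (y : Circle₁) ∉ breakpoints h := by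
    by_cases hacc : AccPt (x : Circle₁) (𝓟 (breakpoints h))
    · obtain ⟨ε, hε, hB⟩ := H.accumulation_left _ hacc
      refine ⟨ε, hε, fun y hy => ?_⟩
      have := hB (y - x) (by linarith [hy.1]) (by linarith [hy.2])
      rwa [← AddCircle.coe_add, add_sub_cancel] at this
    · exact eventually_not_mem_of_not_accPt hacc
  obtain ⟨ε, hε, hB⟩ := this
  refine ForestSkein.exists_rightAffineAt hε (H.right_continuous x) fun y hy => ?_
  obtain ⟨m, hm⟩ := not_not.1 (hB y hy)
  obtain ⟨k, rfl⟩ := H.slopes _ _ hm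
  exact ⟨k, hm⟩

/-- A right germ at every point yields right continuity, the free arc to the right and the form of
the slopes all at once. Only finiteness and dyadicity are left to check. -/
theorem IsInfinitePL.of_rightAffineAt {h : Equiv.Perm Circle₁}
    (hr : ∀ x : ℝ, ∃ k : ℤ, RightAffineAt h (2 ^ k) x)
    (hd : {p : Circle₁ | ¬ ContinuousAt h p}.Finite)
    (ha : {p : Circle₁ | AccPt p (𝓟 (breakpoints h))}.Finite)
    (hb : breakpoints h ⊆ dyadic) (hm : ∀ p ∈ dyadic, h p ∈ dyadic) : IsInfinitePL h where
  right_continuous x := (hr x).choose_spec.continuousWithinAt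
  finite_discontinuities := hd
  finite_accumulation := ha
  accumulation_left p _ := by
    obtain ⟨x, rfl⟩ := exists_coe_eq p
    obtain ⟨k, hk⟩ := hr x
    obtain ⟨ε, hε, H⟩ := hk.exists_forall
    exact ⟨ε, hε, fun t h0 ht hB => hB ⟨_, by rw [← AddCircle.coe_add]; exact H t h0 ht⟩⟩
  breakpoints_dyadic := hb
  map_dyadic := hm
  slopes p m h1 := by
    obtain ⟨x, rfl⟩ := exists_coe_eq p
    obtain ⟨k, hk⟩ := hr x
    exact ⟨k, hk.slope_eq h1⟩

/-- A map that preserves dyadic points and is affine to the right of `x`, with slope a power of two,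
also reflects the dyadicity of `x`: compare `x` with a dyadic point nearby. -/
theorem RightAffineAt.mem_dyadic_iff {h : Circle₁ → Circle₁} {k : ℤ} {x : ℝ}
    (H : RightAffineAt h (2 ^ k) x) (hm : ∀ p ∈ dyadic, h p ∈ dyadic) :
    h x ∈ dyadic ↔ (x : Circle₁) ∈ dyadic := by
  refine ⟨fun hx => ?_, hm _⟩
  obtain ⟨u, hu, hux⟩ := mem_nhdsGE_iff_exists_Ico_subset.1 H
  obtain ⟨z, h1, h2, hz⟩ := exists_dyadic_between (show x < u from hu)
  have h3 : h (z : Circle₁) = _ := hux ⟨h1.le, h2⟩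
  have h4 := dyadic_sub (hm _ hz) hx
  rw [h3, add_sub_cancel_left, dyadic_zpow_mul_iff] at h4
  have := dyadic_sub hz h4
  rwa [← AddCircle.coe_sub, sub_sub_cancel] at this

theorem IsInfinitePL.mem_dyadic_iff {h : Equiv.Perm Circle₁} (H : IsInfinitePL h) (p : Circle₁) :
    h p ∈ dyadic ↔ p ∈ dyadic := by
  obtain ⟨x, rfl⟩ := exists_coe_eq p
  obtain ⟨k, hk⟩ := H.exists_rightAffineAt x
  exact hk.mem_dyadic_iff H.map_dyadic

/-! ### Composition and inversion of germs -/

/-- Positivity of the slope sends right neighbourhoods to right neighbourhoods, so a one-sided germ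
of the outer map suffices. -/
theorem RightAffineAt.comp {g h : Circle₁ → Circle₁} {m m' x c : ℝ} (hm : 0 < m)
    (H : RightAffineAt h m x) (hc : (c : Circle₁) = h x) (H' : RightAffineAt g m' c) :
    RightAffineAt (g ∘ h) (m' * m) x := by
  have ht : Tendsto (fun y => c + m * (y - x)) (𝓝[≥] x) (𝓝[≥] c) := by
    refine tendsto_nhdsWithin_iff.2 ⟨?_, ?_⟩
    · have : Continuous fun y => c + m * (y - x) := by fun_prop
      simpa using (this.tendsto x).mono_left nhdsWithin_le_nhds
    · filter_upwards [self_mem_nhdsWithin] with y hy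
      have : 0 ≤ m * (y - x) := mul_nonneg hm.le (sub_nonneg.2 hy)
      exact le_add_of_nonneg_right this
  filter_upwards [H, ht.eventually H'] with y h1 h2
  show g (h y) = g (h x) + _
  rw [h1, ← hc, ← AddCircle.coe_add, h2]
  congr 2
  ring

/-- The affine formula is solved for its argument; bijectivity makes this the inverse map, and no
continuity of the inverse is needed. -/
theorem RightAffineAt.symm {h : Equiv.Perm Circle₁} {m x c : ℝ} (hm : 0 < m)
    (H : RightAffineAt h m x) (hc : (c : Circle₁) = h x) : RightAffineAt h.symm m⁻¹ c := by
  have ht : Tendsto (fun z => x + m⁻¹ * (z - c)) (𝓝[≥] c) (𝓝[≥] x) := by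
    refine tendsto_nhdsWithin_iff.2 ⟨?_, ?_⟩
    · have : Continuous fun z => x + m⁻¹ * (z - c) := by fun_prop
      simpa using (this.tendsto c).mono_left nhdsWithin_le_nhds
    · filter_upwards [self_mem_nhdsWithin] with z hz
      have : 0 ≤ m⁻¹ * (z - c) := mul_nonneg (inv_nonneg.2 hm.le) (sub_nonneg.2 hz)
      exact le_add_of_nonneg_right this
  filter_upwards [ht.eventually H] with z hz
  rw [Equiv.symm_apply_eq, hc, Equiv.symm_apply_apply, ← AddCircle.coe_add, hz, ← hc,
    ← AddCircle.coe_add, add_sub_cancel_left, mul_inv_cancel_left₀ hm.ne', add_sub_cancel]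

theorem HasSlopeAt.comp {g h : Circle₁ → Circle₁} {m m' : ℝ} {p : Circle₁}
    (H' : HasSlopeAt g m' (h p)) (H : HasSlopeAt h m p) : HasSlopeAt (g ∘ h) (m' * m) p := by
  obtain ⟨x, f, rfl, hf, hfh⟩ := H
  obtain ⟨d, hd⟩ := exists_coe_eq (g (h x))
  have hx : h (x : Circle₁) = (f x : Circle₁) := hfh.self_of_nhds
  rw [hx] at H' hd
  have h1 := (hasSlopeAt_iff hd).1 H'
  refine ⟨x, fun y => repNear d (g (f y)), rfl, h1.comp x hf, ?_⟩
  filter_upwards [hfh] with y hy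
  rw [coe_repNear, Function.comp, hy]

/-- The inverse of a bijection that is continuous near `p` is continuous at the image of `p`. -/
theorem continuousAt_symm {h : Equiv.Perm Circle₁} {p : Circle₁}
    (H : ∀ᶠ q in 𝓝 p, ContinuousAt h q) : ContinuousAt h.symm (h p) := by
  obtain ⟨x, rfl⟩ := exists_coe_eq p
  obtain ⟨c, hc⟩ := exists_coe_eq (h x)
  set f : ℝ → ℝ := fun y => repNear c (h y) with hf
  have hfx : f x = c := by simp only [hf]; rw [← hc, repNear_self]
  have hfc : ∀ y : ℝ, ((f y : ℝ) : Circle₁) = h y := fun y => coe_repNear _ _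
  have hlift : ∀ᶠ y in 𝓝 x, ContinuousAt f y := by
    have h1 : ContinuousAt f x := by
      have := continuousAt_coe_iff.1 H.self_of_nhds
      exact ContinuousAt.comp (f := fun y : ℝ => h y) (continuousAt_repNear hc) this
    rw [← map_coe_nhds, eventually_map] at H
    have h2 : ∀ᶠ y in 𝓝 x, c - 1 / 2 < f y :=
      h1.eventually_const_lt (by rw [hfx]; linarith)
    filter_upwards [H, h2] with y hy hy'
    -- The value `h y` avoids the cut point of the window, the only place where the choice of
    -- representatives is discontinuous.
    have hne : h (y : Circle₁) ≠ ((c - 1 / 2 : ℝ) : Circle₁) := by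
      intro he
      have : f y = c - 1 / 2 := by
        simp only [hf]
        rw [he, repNear_coe le_rfl (by linarith)]
      linarith
    have h3 := AddCircle.continuousAt_equivIco (1 : ℝ) (c - 1 / 2) hne
    exact ContinuousAt.comp (f := fun y : ℝ => h y) (continuousAt_subtype_val.comp h3)
      (continuousAt_coe_iff.1 hy)
  obtain ⟨ε, hε, hball⟩ := Metric.eventually_nhds_iff_ball.1 hlift
  rw [ContinuousAt, Equiv.symm_apply_apply, ← hc, ← map_coe_nhds c, tendsto_map'_iff,
    ← map_coe_nhds x]
  intro U hU
  obtain ⟨δ, hδ, hδU⟩ := Metric.mem_nhds_iff.1 hU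
  -- Half of the minimum keeps the closed interval inside both balls; 1/4 keeps its length below 1,
  -- so that it embeds in the circle.
  set η := min (min ε δ / 2) (1 / 4) with hη
  have hη0 : 0 < η := by positivity
  have h1 : η ≤ min ε δ / 2 := min_le_left _ _
  have h2 : η ≤ 1 / 4 := min_le_right _ _
  have h3 : min ε δ ≤ ε := min_le_left _ _
  have h4 : min ε δ ≤ δ := min_le_right _ _
  have hcont : ContinuousOn f (Set.Icc (x - η) (x + η)) := fun y hy =>
    (hball y (by rw [Real.ball_eq_Ioo]; exact ⟨by linarith [hy.1], by linarith [hy.2]⟩)).continuousWithinAt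
  have hinj : Set.InjOn f (Set.Icc (x - η) (x + η)) := by
    intro y hy z hz hyz
    refine coe_injOn_Icc (by linarith) hy hz (h.injective ?_)
    rw [← hfc, ← hfc, hyz]
  have hnhds : f '' Set.Icc (x - η) (x + η) ∈ 𝓝 c := by
    have hl : x - η ∈ Set.Icc (x - η) (x + η) := ⟨le_rfl, by linarith⟩
    have hr : x + η ∈ Set.Icc (x - η) (x + η) := ⟨by linarith, le_rfl⟩
    have hx : x ∈ Set.Icc (x - η) (x + η) := ⟨by linarith, by linarith⟩
    -- An injective continuous function on an interval is strictly monotone, so by the intermediate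
    -- value theorem its image is a neighbourhood of the value at the interior point `x`.
    rcases hcont.strictMonoOn_of_injOn_Icc' (by linarith) hinj with hmono | hanti
    · refine mem_of_superset (Icc_mem_nhds ?_ ?_) (intermediate_value_Icc (by linarith) hcont)
      · rw [← hfx]; exact hmono hl hx (by linarith)
      · rw [← hfx]; exact hmono hx hr (by linarith)
    · refine mem_of_superset (Icc_mem_nhds ?_ ?_) (intermediate_value_Icc' (by linarith) hcont)
      · rw [← hfx]; exact hanti hx hr (by linarith)
      · rw [← hfx]; exact hanti hl hx (by linarith)
  refine mem_map.2 (mem_of_superset hnhds ?_)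
  rintro _ ⟨y, hy, rfl⟩
  show h.symm (f y : Circle₁) ∈ U
  rw [hfc, Equiv.symm_apply_apply]
  exact hδU (by rw [Real.ball_eq_Ioo]; exact ⟨by linarith [hy.1], by linarith [hy.2]⟩)

/-- This is the one-dimensional inverse function rule, which needs continuity of the inverse at the
image point as an input. -/
theorem HasSlopeAt.symm {h : Equiv.Perm Circle₁} {m : ℝ} {p : Circle₁} (hm : m ≠ 0)
    (H : HasSlopeAt h m p) (Hc : ContinuousAt h.symm (h p)) : HasSlopeAt h.symm m⁻¹ (h p) := by
  obtain ⟨x, rfl⟩ := exists_coe_eq p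
  obtain ⟨c, hc⟩ := exists_coe_eq (h x)
  have hd := (hasSlopeAt_iff hc).1 H
  rw [← hc] at Hc ⊢
  have hx : (x : Circle₁) = h.symm c := by rw [hc, Equiv.symm_apply_apply]
  refine (hasSlopeAt_iff hx).2 ?_
  have hself : repNear x (h.symm (c : Circle₁)) = x := by rw [← hx, repNear_self]
  have hcont : ContinuousAt (fun z : ℝ => repNear x (h.symm z)) c :=
    ContinuousAt.comp (f := fun z : ℝ => h.symm z) (continuousAt_repNear hx)
      (continuousAt_coe_iff.1 Hc)
  refine HasDerivAt.of_local_left_inverse (f := fun y : ℝ => repNear c (h y)) hcont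
    (by simpa only [hself] using hd) hm ?_
  filter_upwards [eventually_repNear_coe (c := c) (y := c) (by linarith) (by linarith)] with z hz
  rw [coe_repNear, Equiv.apply_symm_apply, hz]

theorem accPt_of_preimage {h : Equiv.Perm Circle₁} {B : Set Circle₁} {p : Circle₁}
    (H : AccPt p (𝓟 (h ⁻¹' B))) (hc : ContinuousAt h p) : AccPt (h p) (𝓟 B) := by
  rw [accPt_iff_frequently] at H ⊢
  exact hc.tendsto.frequently (H.mono fun y hy => ⟨fun he => hy.1 (h.injective he), hy.2⟩)

/-! ### The group axioms -/

theorem IsInfinitePL.one : IsInfinitePL 1 := by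
  have hs : ∀ x : ℝ, HasSlopeAt (1 : Equiv.Perm Circle₁) 1 (x : Circle₁) := fun x =>
    ⟨x, id, rfl, hasDerivAt_id x, .of_forall fun y => rfl⟩
  have hB : breakpoints (1 : Equiv.Perm Circle₁) = ∅ := by
    refine Set.eq_empty_of_forall_notMem fun p hp => hp ?_
    obtain ⟨x, rfl⟩ := exists_coe_eq p
    exact ⟨1, hs x⟩
  refine .of_rightAffineAt (fun x => ⟨0, .of_forall fun y => ?_⟩) ?_ ?_ ?_ fun p hp => hp
  · simp
  · have : ∀ p, ContinuousAt (1 : Equiv.Perm Circle₁) p := fun p => continuousAt_id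
    exact Set.finite_empty.subset fun p hp => hp (this p)
  · rw [hB]
    simp [AccPt, neBot_iff]
  · rw [hB]
    exact Set.empty_subset _

theorem IsInfinitePL.mul {g h : Equiv.Perm Circle₁} (hg : IsInfinitePL g) (hh : IsInfinitePL h) :
    IsInfinitePL (g * h) := by
  have hB : breakpoints (g * h : Equiv.Perm Circle₁) ⊆ breakpoints h ∪ h ⁻¹' breakpoints g := by
    intro p hp
    by_contra hn
    rw [Set.mem_union, not_or] at hn
    obtain ⟨m, hm⟩ := not_not.1 hn.1
    obtain ⟨m', hm'⟩ := not_not.1 hn.2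
    exact hp ⟨_, hm'.comp hm⟩
  refine .of_rightAffineAt (fun x => ?_) ?_ ?_ ?_ fun p hp => hg.map_dyadic _ (hh.map_dyadic _ hp)
  · obtain ⟨k, hk⟩ := hh.exists_rightAffineAt x
    obtain ⟨c, hc⟩ := exists_coe_eq (h x)
    obtain ⟨l, hl⟩ := hg.exists_rightAffineAt c
    have := hk.comp (by positivity) hc hl
    rw [← zpow_add₀ two_ne_zero] at this
    exact ⟨l + k, this⟩
  · refine (hh.finite_discontinuities.union
      (hg.finite_discontinuities.preimage h.injective.injOn)).subset fun p hp => ?_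
    by_contra hn
    rw [Set.mem_union, not_or] at hn
    exact hp ((not_not.1 hn.2).comp (not_not.1 hn.1))
  · refine ((hh.finite_discontinuities.union hh.finite_accumulation).union
      (hg.finite_accumulation.preimage h.injective.injOn)).subset fun p hp => ?_
    have hp' := hp.mono (principal_mono.2 hB)
    rw [← sup_principal, accPt_sup] at hp'
    -- Where `h` is continuous, an accumulation of preimages of breakpoints of `g` is pushed forward
    -- to one of breakpoints of `g`; the other points are finitely many discontinuities.
    by_cases hc : ContinuousAt h p
    · exact hp'.elim (fun h1 => .inl (.inr h1)) fun h1 => .inr (accPt_of_preimage h1 hc)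
    · exact .inl (.inl hc)
  · refine hB.trans (Set.union_subset hh.breakpoints_dyadic fun p hp => ?_)
    exact (hh.mem_dyadic_iff p).1 (hg.breakpoints_dyadic hp)

theorem IsInfinitePL.continuousAt_symm {h : Equiv.Perm Circle₁} (H : IsInfinitePL h) {p : Circle₁}
    (hp : ContinuousAt h p) : ContinuousAt h.symm (h p) := by
  refine ForestSkein.continuousAt_symm ?_
  -- The discontinuities other than `p` form a finite, hence closed, set; off it `h` is continuous
  -- on a whole neighbourhood of `p`.
  have hfin := H.finite_discontinuities.subset (Set.sdiff_subset (t := {p}))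
  filter_upwards [hfin.isClosed.isOpen_compl.mem_nhds (x := p) (by simp)] with q hq
  by_contra hn
  by_cases hqp : q = p
  · exact hn (hqp ▸ hp)
  · exact hq ⟨hn, hqp⟩

/-- Right germs invert unconditionally. Continuity and slopes of `h` at a point pass to the inverse
at the image point, so the bad points of the inverse are images of bad points of `h`. -/
theorem IsInfinitePL.inv {h : Equiv.Perm Circle₁} (H : IsInfinitePL h) : IsInfinitePL h⁻¹ := by
  have hD : {p | ¬ ContinuousAt h.symm p} ⊆ h.symm ⁻¹' {p | ¬ ContinuousAt h p} := by
    intro q hq hc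
    exact hq (by simpa using H.continuousAt_symm hc)
  have hB : breakpoints h.symm ⊆ h.symm ⁻¹' breakpoints h := by
    rintro q hq ⟨m, hm⟩
    obtain ⟨k, rfl⟩ := H.slopes _ _ hm
    have := hm.symm (by positivity) (H.continuousAt_symm hm.continuousAt)
    rw [Equiv.apply_symm_apply] at this
    exact hq ⟨_, this⟩
  have hdy : ∀ q, h.symm q ∈ dyadic ↔ q ∈ dyadic := fun q => by
    rw [← H.mem_dyadic_iff, Equiv.apply_symm_apply]
  show IsInfinitePL h.symm
  refine .of_rightAffineAt (fun c => ?_) ?_ ?_ ?_ fun p hp => (hdy p).2 hp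
  · obtain ⟨x, hx⟩ := exists_coe_eq (h.symm c)
    obtain ⟨k, hk⟩ := H.exists_rightAffineAt x
    exact ⟨-k, zpow_neg (2 : ℝ) k ▸ hk.symm (by positivity) (by rw [hx, Equiv.apply_symm_apply])⟩
  · exact (H.finite_discontinuities.preimage h.symm.injective.injOn).subset hD
  · refine ((H.finite_discontinuities.union H.finite_accumulation).preimage
      h.symm.injective.injOn).subset fun q hq => ?_
    have hq' := hq.mono (principal_mono.2 hB)
    by_cases hc : ContinuousAt h.symm q
    · exact .inr (accPt_of_preimage hq' hc)
    · exact .inl (hD hc)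
  · exact fun q hq => (hdy q).1 (H.breakpoints_dyadic (hB hq))

theorem continuous_symm {h : Equiv.Perm Circle₁} (H : Continuous h) : Continuous h.symm :=
  continuous_iff_continuousAt.2 fun q => by
    simpa using ForestSkein.continuousAt_symm (p := h.symm q) (.of_forall fun p => H.continuousAt)

/-- The sets `𝓘F`, `𝓘T`, `𝓘V` are groups. -/
def infinitePLSubgroup (X : FTV) : Subgroup (Equiv.Perm Circle₁) where
  carrier := infinitePL X
  one_mem' := by
    cases X
    · exact ⟨.one, continuous_id, rfl⟩
    · exact ⟨.one, continuous_id⟩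
    · exact IsInfinitePL.one
  mul_mem' {g h} hg hh := by
    cases X
    · exact ⟨hg.1.mul hh.1, hg.2.1.comp hh.2.1, (congrArg g hh.2.2).trans hg.2.2⟩
    · exact ⟨hg.1.mul hh.1, hg.2.comp hh.2⟩
    · exact IsInfinitePL.mul hg hh
  inv_mem' {h} H := by
    cases X
    · exact ⟨H.1.inv, continuous_symm H.2.1, h.symm_apply_eq.2 H.2.2.symm⟩
    · exact ⟨H.1.inv, continuous_symm H.2⟩
    · exact IsInfinitePL.inv H

/-! ### Binary sequences -/

/-- Binary sequences. -/
abbrev BinSeq : Type := ℕ → Bool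

namespace BinSeq

/-- The sequence with first digit `b` followed by `p`. -/
def cons (b : Bool) (p : BinSeq) : BinSeq
  | 0 => b
  | n + 1 => p n

/-- The sequence `p` preceded by the word `u`. -/
def prepend : List Bool → BinSeq → BinSeq
  | [], p => p
  | b :: u, p => cons b (prepend u p)

/-- The sequence `1, 1, 1, …`. -/
def ones : BinSeq := fun _ => true

/-- The sequence `0, 0, 0, …`. -/
def zeros : BinSeq := fun _ => false

/-- The sequence is eventually equal to `1`. -/
def EventuallyOnes (p : BinSeq) : Prop := ∃ m, ∀ k ≥ m, p k = true

theorem cons_eta (p : BinSeq) : cons (p 0) (fun k => p (k + 1)) = p := by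
  funext k
  cases k <;> rfl

/-- A binary sequence consists of its first digit and the remaining ones. -/
def consEquiv : Bool × BinSeq ≃ BinSeq where
  toFun u := cons u.1 u.2
  invFun p := (p 0, fun k => p (k + 1))
  left_inv _ := rfl
  right_inv p := cons_eta p

theorem cons_ones : cons true ones = ones := cons_eta ones

theorem cons_zeros : cons false zeros = zeros := cons_eta zeros

theorem cons_eq_ones {b : Bool} {p : BinSeq} (h : cons b p = ones) : b = true ∧ p = ones :=
  ⟨congrFun h 0, funext fun k => congrFun h (k + 1)⟩

theorem prepend_append (u w : List Bool) (p : BinSeq) :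
    prepend (u ++ w) p = prepend u (prepend w p) := by
  induction u with
  | nil => rfl
  | cons b u ih => simp [prepend, ih]

theorem prepend_eq_ones {u : List Bool} {p : BinSeq} (h : prepend u p = ones) : p = ones := by
  induction u with
  | nil => exact h
  | cons b u ih => exact ih (cons_eq_ones h).2

theorem eventuallyOnes_cons {b : Bool} {p : BinSeq} :
    EventuallyOnes (cons b p) ↔ EventuallyOnes p := by
  constructor
  · rintro ⟨m, hm⟩
    exact ⟨m, fun k hk => hm (k + 1) (by omega)⟩
  · rintro ⟨m, hm⟩
    refine ⟨m + 1, fun k hk => ?_⟩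
    cases k with
    | zero => omega
    | succ k => exact hm k (by omega)

theorem eventuallyOnes_prepend {u : List Bool} {p : BinSeq} :
    EventuallyOnes (prepend u p) ↔ EventuallyOnes p := by
  induction u with
  | nil => rfl
  | cons b u ih => exact eventuallyOnes_cons.trans ih

theorem eventuallyOnes_ones : EventuallyOnes ones := ⟨0, fun _ _ => rfl⟩

theorem not_eventuallyOnes_zeros : ¬ EventuallyOnes zeros := fun ⟨m, hm⟩ =>
  Bool.false_ne_true (hm m le_rfl)

/-- Two words that are prefixes of the same sequence are comparable. -/
theorem prepend_eq_prepend {u w : List Bool} {p q : BinSeq} (h : prepend u p = prepend w q) :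
    (∃ v, w = u ++ v ∧ p = prepend v q) ∨ ∃ v, u = w ++ v ∧ q = prepend v p := by
  induction u generalizing w with
  | nil => exact .inl ⟨w, rfl, h⟩
  | cons b u ih =>
    cases w with
    | nil => exact .inr ⟨b :: u, rfl, h.symm⟩
    | cons c w =>
      obtain ⟨h1, h2⟩ := Prod.ext_iff.1 (consEquiv.injective
        (a₁ := (b, prepend u p)) (a₂ := (c, prepend w q)) h)
      obtain rfl : b = c := h1
      rcases ih h2 with ⟨v, rfl, h'⟩ | ⟨v, rfl, h'⟩
      · exact .inl ⟨v, rfl, h'⟩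
      · exact .inr ⟨v, rfl, h'⟩

theorem prepend_apply_of_lt {u : List Bool} {k : ℕ} (h : k < u.length) (p q : BinSeq) :
    prepend u p k = prepend u q k := by
  induction u generalizing k with
  | nil => simp at h
  | cons b u ih =>
    cases k with
    | zero => rfl
    | succ k => exact ih (by simpa using h)

theorem prepend_apply_add (u : List Bool) (p : BinSeq) (k : ℕ) :
    prepend u p (k + u.length) = p k := by
  induction u with
  | nil => rfl
  | cons b u ih => exact ih

theorem eq_prepend_of_agree {u : List Bool} {p q : BinSeq}
    (h : ∀ k < u.length, q k = prepend u p k) : q = prepend u fun k => q (k + u.length) := by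
  funext k
  rcases lt_or_ge k u.length with hk | hk
  · rw [h k hk]; exact prepend_apply_of_lt hk _ _
  · obtain ⟨j, rfl⟩ := Nat.exists_eq_add_of_le' hk
    rw [prepend_apply_add]

theorem agree_mem_nhds (m : ℕ) (p : BinSeq) : {q : BinSeq | ∀ k < m, q k = p k} ∈ 𝓝 p := by
  have : {q : BinSeq | ∀ k < m, q k = p k} = (Set.Iio m).pi fun k => {p k} := by
    ext q; simp [Set.mem_pi]
  rw [this]
  exact set_pi_mem_nhds (Set.finite_Iio m) fun k _ => by simp

theorem continuous_cons (b : Bool) : Continuous (cons b) := by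
  refine continuous_pi fun k => ?_
  cases k with
  | zero => exact continuous_const
  | succ k => exact continuous_apply k

theorem continuous_prepend (u : List Bool) : Continuous (prepend u) := by
  induction u with
  | nil => exact continuous_id
  | cons b u ih => exact (continuous_cons b).comp ih

/-! ### Binary expansions of real numbers -/

/-- The real number with binary expansion `p`. -/
noncomputable def val (p : BinSeq) : ℝ := ∑' k : ℕ, ((p k).toNat : ℝ) / 2 ^ (k + 1)

theorem toNat_le_one' (b : Bool) : (b.toNat : ℝ) ≤ 1 := by cases b <;> simp

theorem summable_half : Summable fun k : ℕ => (1 : ℝ) / 2 ^ (k + 1) := by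
  have := (summable_geometric_two).mul_right (1 / 2 : ℝ)
  refine this.congr fun k => ?_
  rw [← pow_succ, one_div_pow]

theorem term_le (p : BinSeq) (k : ℕ) : ((p k).toNat : ℝ) / 2 ^ (k + 1) ≤ 1 / 2 ^ (k + 1) :=
  div_le_div_of_nonneg_right (toNat_le_one' _) (by positivity)

theorem summable_val (p : BinSeq) : Summable fun k : ℕ => ((p k).toNat : ℝ) / 2 ^ (k + 1) :=
  summable_half.of_nonneg_of_le (fun k => by positivity) (term_le p)

theorem val_cons (b : Bool) (p : BinSeq) : val (cons b p) = (b.toNat + val p) / 2 := by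
  rw [val, (summable_val _).tsum_eq_zero_add]
  have : ∀ k : ℕ, ((cons b p (k + 1)).toNat : ℝ) / 2 ^ (k + 1 + 1)
      = ((p k).toNat : ℝ) / 2 ^ (k + 1) * (1 / 2) := fun k => by
    rw [pow_succ _ (k + 1)]; show ((p k).toNat : ℝ) / _ = _; field_simp
  simp only [this, tsum_mul_right]
  show (b.toNat : ℝ) / 2 ^ (0 + 1) + val p * (1 / 2) = _
  ring

theorem val_nonneg (p : BinSeq) : 0 ≤ val p := tsum_nonneg fun k => by positivity

theorem val_ones : val ones = 1 := by
  have h := val_cons true ones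
  rw [cons_ones] at h
  simp at h
  linarith

theorem val_zeros : val zeros = 0 := by simp [val, zeros]

theorem val_le_one (p : BinSeq) : val p ≤ 1 := by
  rw [← val_ones]
  exact (summable_val p).tsum_le_tsum (fun k => by simpa [ones] using term_le p k) (summable_val _)

theorem val_lt_one {p : BinSeq} (h : p ≠ ones) : val p < 1 := by
  obtain ⟨k, hk⟩ := Function.ne_iff.1 h
  have hk' : p k = false := by simpa [ones] using hk
  rw [← val_ones]
  exact (summable_val p).tsum_lt_tsum (i := k) (fun k => by simpa [ones] using term_le p k)
    (by simp [ones, hk']) (summable_val _)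

theorem eq_ones_of_val {p : BinSeq} (h : val p = 1) : p = ones := by
  by_contra hn
  exact (val_lt_one hn).ne h

theorem eq_zeros_of_val {p : BinSeq} (h : val p = 0) : p = zeros := by
  have := ((summable_val p).hasSum_iff.2 h)
  rw [hasSum_zero_iff_of_nonneg fun k => by positivity] at this
  funext k
  have hk := congrFun this k
  cases hpk : p k
  · rfl
  · simp [hpk] at hk

/-- Each digit halves the scale, so adding a prefix acts on values as an affine map of ratio
2^(-|u|). All slopes of the induced bijections come from here. -/
theorem val_prepend (u : List Bool) (p : BinSeq) :
    val (prepend u p) = val (prepend u zeros) + val p / 2 ^ u.length := by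
  induction u with
  | nil => simp [prepend, val_zeros]
  | cons b u ih =>
    simp only [prepend, val_cons, List.length_cons, pow_succ]
    rw [ih]
    field_simp
    ring

theorem val_prepend_inj {u : List Bool} {p q : BinSeq} :
    val (prepend u p) = val (prepend u q) ↔ val p = val q := by
  rw [val_prepend u p, val_prepend u q, add_right_inj, div_left_inj' (by positivity)]

theorem continuous_val : Continuous val := by
  refine continuous_tsum (u := fun k : ℕ => (1 : ℝ) / 2 ^ (k + 1)) (fun k => ?_) summable_half
    fun k p => ?_
  · exact (continuous_of_discreteTopology (f := fun b : Bool => (b.toNat : ℝ) / 2 ^ (k + 1))).comp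
      (continuous_apply k)
  · rw [Real.norm_of_nonneg (by positivity)]
    exact term_le p k

theorem val_prepend_zeros (u : List Bool) : ∃ i : ℤ, val (prepend u zeros) = i / 2 ^ u.length := by
  induction u with
  | nil => exact ⟨0, by simp [prepend, val_zeros]⟩
  | cons b u ih =>
    obtain ⟨i, hi⟩ := ih
    refine ⟨b.toNat * 2 ^ u.length + i, ?_⟩
    simp only [prepend, val_cons, List.length_cons, pow_succ, hi]
    push_cast
    field_simp

/-- A point of `[0, 1)` has a binary expansion that is not eventually `1`. -/
theorem exists_val_eq {x : ℝ} (h0 : 0 ≤ x) (h1 : x < 1) :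
    ∃ p : BinSeq, ¬ EventuallyOnes p ∧ val p = x := by
  -- The digits are read off the orbit of `x` under the doubling map: digit k tells which half of
  -- [0, 1) contains the k-th point.
  let f : ℝ → ℝ := fun y => Int.fract (2 * y)
  let y : ℕ → ℝ := fun k => f^[k] x
  have hy : ∀ k, 0 ≤ y k ∧ y k < 1 := fun k => by
    cases k with
    | zero => exact ⟨h0, h1⟩
    | succ k =>
      simp only [y, Function.iterate_succ_apply']
      exact ⟨Int.fract_nonneg _, Int.fract_lt_one _⟩
  let p : BinSeq := fun k => decide (1 / 2 ≤ y k)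
  have hstep : ∀ k, y k = ((p k).toNat + y (k + 1)) / 2 := by
    intro k
    have hs : y (k + 1) = Int.fract (2 * y k) := Function.iterate_succ_apply' _ _ _
    obtain ⟨h2, h3⟩ := hy k
    by_cases h : 1 / 2 ≤ y k
    · have : ⌊2 * y k⌋ = 1 := Int.floor_eq_iff.2 ⟨by push_cast; linarith, by push_cast; linarith⟩
      rw [hs, Int.fract, this, show p k = true from decide_eq_true h]
      push_cast [Bool.toNat_true]
      ring
    · have : ⌊2 * y k⌋ = 0 := Int.floor_eq_iff.2 ⟨by push_cast; linarith, by push_cast; linarith⟩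
      rw [hs, Int.fract, this, show p k = false from decide_eq_false h]
      push_cast [Bool.toNat_false]
      ring
  -- The orbit and the values of the shifted sequences obey the same recursion z ↦ (digit + z) / 2,
  -- so the discrepancy at `k` is half of that at `k + 1`, while all discrepancies are at most 1.
  have hdist : ∀ m k, |val (fun i => p (i + k)) - y k| ≤ 1 / 2 ^ m := by
    intro m
    induction m with
    | zero =>
      intro k
      have := val_nonneg fun i => p (i + k)
      have := val_le_one fun i => p (i + k)
      obtain ⟨h2, h3⟩ := hy k
      rw [abs_le]
      constructor <;> norm_num <;> linarith
    | succ m ih =>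
      intro k
      have h2 : val (fun i => p (i + k)) = ((p k).toNat + val fun i => p (i + (k + 1))) / 2 := by
        rw [← val_cons]
        congr 1
        funext i
        cases i with
        | zero => simp [cons]
        | succ i => simp only [cons]; congr 1; omega
      rw [h2, hstep k, pow_succ, show ∀ a b c : ℝ, (a + b) / 2 - (a + c) / 2 = (b - c) / 2 by
        intros; ring, abs_div, abs_two, ← div_div]
      exact div_le_div_of_nonneg_right (ih (k + 1)) two_pos.le
  have hval : ∀ k, val (fun i => p (i + k)) = y k := by
    intro k
    by_contra hne
    obtain ⟨m, hm⟩ := exists_pow_lt_of_lt_one (abs_pos.2 (sub_ne_zero.2 hne))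
      (by norm_num : (1 / 2 : ℝ) < 1)
    rw [one_div_pow] at hm
    exact absurd (hdist m k) (not_le.2 hm)
  refine ⟨p, ?_, hval 0⟩
  -- A tail 111… would have value 1, but the orbit stays in [0, 1).
  rintro ⟨m, hm⟩
  have h2 : (fun i => p (i + m)) = ones := funext fun i => hm _ (by omega)
  have h3 := hval m
  rw [h2, val_ones] at h3
  exact (hy m).2.ne h3.symm

/-- Binary expansions that are not eventually `1` are unique. -/
theorem eq_of_val_eq {p q : BinSeq} (hp : ¬ EventuallyOnes p) (hq : ¬ EventuallyOnes q)
    (h : val p = val q) : p = q := by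
  have hlt : ∀ {r : BinSeq}, ¬ EventuallyOnes r → val r < 1 := fun hr =>
    val_lt_one fun he => hr (he ▸ eventuallyOnes_ones)
  have hstep : ∀ {r s : BinSeq}, ¬ EventuallyOnes r → ¬ EventuallyOnes s → val r = val s →
      r 0 = s 0 ∧ val (fun k => r (k + 1)) = val (fun k => s (k + 1)) := by
    intro r s hr hs h
    rw [← cons_eta r, eventuallyOnes_cons] at hr
    rw [← cons_eta s, eventuallyOnes_cons] at hs
    rw [← cons_eta r, ← cons_eta s, val_cons, val_cons] at h
    have := hlt hr
    have := hlt hs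
    have := val_nonneg fun k => r (k + 1)
    have := val_nonneg fun k => s (k + 1)
    -- The tails have values in [0, 1), so different first digits would put the two values into
    -- different halves.
    cases hr0 : r 0 <;> cases hs0 : s 0 <;> simp [hr0, hs0] at h ⊢ <;> linarith
  have hshift : ∀ {r : BinSeq} (k : ℕ), ¬ EventuallyOnes r → ¬ EventuallyOnes fun i => r (i + k) :=
    fun k hr ⟨m, hm⟩ => hr ⟨m + k, fun i hi => by
      have := hm (i - k) (by omega)
      simp only [Nat.sub_add_cancel (show k ≤ i by omega)] at this
      exact this⟩
  have key : ∀ k, val (fun i => p (i + k)) = val (fun i => q (i + k)) := by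
    intro k
    induction k with
    | zero => exact h
    | succ k ih =>
      have := (hstep (hshift k hp) (hshift k hq) ih).2
      simpa only [add_assoc, add_comm 1 k] using this
  funext k
  have := (hstep (hshift k hp) (hshift k hq) (key k)).1
  simpa using this

/-- A nonzero sequence has the same value as one with infinitely many ones. -/
theorem exists_left_expansion {p : BinSeq} (hp : p ≠ zeros) :
    ∃ q : BinSeq, val q = val p ∧ ∀ m, ∃ k ≥ m, q k = true := by
  by_cases h : ∀ m, ∃ k ≥ m, p k = true
  · exact ⟨p, rfl, h⟩
  · simp only [not_forall, not_exists, not_and, Bool.not_eq_true] at h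
    obtain ⟨m, hm⟩ := h
    induction m generalizing p with
    | zero => exact (hp (funext fun k => hm k (Nat.zero_le k))).elim
    | succ m ih =>
      by_cases htail : (fun k => p (k + 1)) = zeros
      · have h0 : p 0 = true := by
          by_contra h0
          rw [Bool.not_eq_true] at h0
          exact hp (by rw [← cons_eta p, h0, htail, cons_zeros])
        -- The other expansion of 1000… is 0111….
        refine ⟨cons false ones, ?_, fun m => ⟨m + 1, by omega, rfl⟩⟩
        rw [← cons_eta p, htail, h0, val_cons, val_cons, val_ones, val_zeros]
        simp
      · obtain ⟨q, hq, hq'⟩ := ih htail fun k hk => hm (k + 1) (by omega)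
        refine ⟨cons (p 0) q, ?_, fun m => ?_⟩
        · conv_rhs => rw [← cons_eta p]
          rw [val_cons, val_cons, hq]
        · obtain ⟨k, hk, hqk⟩ := hq' m
          exact ⟨k + 1, by omega, hqk⟩

/-! ### Branches and splittings -/

/-- Maps of the space of binary sequences that locally replace prefixes away from `1, 1, …`, and that
descend to the unit interval. -/
structure IsBranch (f : BinSeq → BinSeq) : Prop where
  val_congr : ∀ {p q}, val p = val q → val (f p) = val (f q)
  replace : ∀ p, p ≠ ones → f p ≠ ones ∧
    ∃ u q w, p = prepend u q ∧ ∀ r, f (prepend u r) = prepend w r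
  ones : EventuallyOnes (f ones)
  continuous : Continuous f

theorem IsBranch.id : IsBranch id where
  val_congr h := h
  replace p hp := ⟨hp, [], p, [], rfl, fun _ => rfl⟩
  ones := eventuallyOnes_ones
  continuous := continuous_id

/-- Replacing a prefix does not alter the tail; the sequence 111…, which the replacement clause
leaves out, is covered by the field `ones`. -/
theorem IsBranch.eventuallyOnes_iff {f : BinSeq → BinSeq} (hf : IsBranch f) (p : BinSeq) :
    EventuallyOnes (f p) ↔ EventuallyOnes p := by
  by_cases hp : p = BinSeq.ones
  · subst hp
    exact iff_of_true hf.ones eventuallyOnes_ones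
  · obtain ⟨u, q, w, rfl, h⟩ := (hf.replace p hp).2
    rw [h, eventuallyOnes_prepend, eventuallyOnes_prepend]

/-- The prefix written by `g` and the prefix read by `f` begin the same sequence, so one extends the
other. Lengthening the shorter rule makes the two fit together. -/
theorem IsBranch.comp {f g : BinSeq → BinSeq} (hf : IsBranch f) (hg : IsBranch g) :
    IsBranch (f ∘ g) where
  val_congr h := hf.val_congr (hg.val_congr h)
  replace p hp := by
    obtain ⟨h1, u, q, w, rfl, h2⟩ := hg.replace p hp
    obtain ⟨h3, u', q', w', h4, h5⟩ := hf.replace _ h1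
    refine ⟨h3, ?_⟩
    rw [h2] at h4
    rcases prepend_eq_prepend h4 with ⟨v, rfl, rfl⟩ | ⟨v, rfl, rfl⟩
    · exact ⟨u ++ v, q', w', by rw [prepend_append], fun r => by
        rw [Function.comp, prepend_append, h2, ← prepend_append, h5]⟩
    · exact ⟨u, q, w' ++ v, rfl, fun r => by
        rw [Function.comp, h2, prepend_append, h5, prepend_append]⟩
  ones := (hf.eventuallyOnes_iff _).2 hg.ones
  continuous := hf.continuous.comp hg.continuous

theorem isBranch_prepend (u : List Bool) : IsBranch (prepend u) where
  val_congr h := val_prepend_inj.2 h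
  replace p hp := ⟨fun h => hp (prepend_eq_ones h), [], p, u, rfl, fun _ => rfl⟩
  ones := eventuallyOnes_prepend.2 eventuallyOnes_ones
  continuous := continuous_prepend u

/-- A splitting of the space of binary sequences into a left and a right half. -/
structure IsSplitting (σ : Bool × BinSeq ≃ BinSeq) : Prop where
  branch : ∀ b, IsBranch fun p => σ (b, p)
  left_zeros : val (σ (false, zeros)) = 0
  left_ones : val (σ (false, BinSeq.ones)) = val (σ (true, zeros))
  right_ones : val (σ (true, BinSeq.ones)) = 1

theorem isSplitting_consEquiv : IsSplitting consEquiv where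
  branch b := isBranch_prepend [b]
  left_zeros := by
    show val (cons false zeros) = 0
    rw [cons_zeros, val_zeros]
  left_ones := by
    show val (cons false BinSeq.ones) = val (cons true zeros)
    simp [val_cons, val_ones, val_zeros]
  right_ones := by
    show val (cons true BinSeq.ones) = 1
    rw [cons_ones, val_ones]

end BinSeq

open BinSeq

/-! ### Leaf maps of coloured trees -/

section Leaf

variable {S α β : Type} (σ : S → Bool × BinSeq ≃ BinSeq)

/-- If every vertex of colour `c` splits the space of binary sequences by `σ c`, then a point selects
a leaf of the tree and a point of the space that sits on top of this leaf. -/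
def leafOf : CTree S α → BinSeq → α × BinSeq
  | .leaf i, p => (i, p)
  | .node c l r, p => bif ((σ c).symm p).1 then leafOf r ((σ c).symm p).2
      else leafOf l ((σ c).symm p).2

open Classical in
/-- The embedding of the space on top of the leaf labelled `k`. -/
noncomputable def glue : CTree S α → α → BinSeq → BinSeq
  | .leaf _, _, p => p
  | .node c l r, k, p => if k ∈ l.leaves then σ c (false, glue l k p) else σ c (true, glue r k p)

theorem leafOf_glue {t : CTree S α} {k : α} (hk : k ∈ t.leaves) (p : BinSeq) :
    leafOf σ t (glue σ t k p) = (k, p) := by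
  induction t with
  | leaf i =>
    obtain rfl : k = i := by simpa [CTree.leaves] using hk
    rfl
  | node c l r hl hr =>
    by_cases h : k ∈ l.leaves
    · simp [leafOf, glue, h, hl h]
    · have h' : k ∈ r.leaves := by simpa [CTree.leaves, h] using hk
      simp [leafOf, glue, h, hr h']

theorem leafOf_mem (t : CTree S α) (p : BinSeq) : (leafOf σ t p).1 ∈ t.leaves := by
  induction t generalizing p with
  | leaf i => simp [leafOf, CTree.leaves]
  | node c l r hl hr =>
    rw [CTree.leaves, List.mem_append, leafOf]
    cases ((σ c).symm p).1
    · exact .inl (hl _)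
    · exact .inr (hr _)

/-- Labels must be distinct because `glue` looks for a label in the left subtree before it turns to
the right one. -/
theorem glue_leafOf {t : CTree S α} (ht : t.leaves.Nodup) (p : BinSeq) :
    glue σ t (leafOf σ t p).1 (leafOf σ t p).2 = p := by
  induction t generalizing p with
  | leaf i => rfl
  | node c l r hl hr =>
    have ht' := List.nodup_append'.1 ht
    have hp : p = σ c (((σ c).symm p).1, ((σ c).symm p).2) := by simp
    generalize ((σ c).symm p).1 = b at hp
    generalize ((σ c).symm p).2 = q at hp
    subst hp
    cases b
    · simp [leafOf, glue, leafOf_mem, hl ht'.1]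
    · have : (leafOf σ r q).1 ∉ l.leaves := fun h => ht'.2.2 h (leafOf_mem σ r q)
      simp [leafOf, glue, this, hr ht'.2.1]

theorem leafOf_bind (t : CTree S α) (g : α → CTree S β) (p : BinSeq) :
    leafOf σ (t.bind g) p = leafOf σ (g (leafOf σ t p).1) (leafOf σ t p).2 := by
  induction t generalizing p with
  | leaf i => rfl
  | node c l r hl hr =>
    simp only [CTree.bind, leafOf]
    cases ((σ c).symm p).1
    · exact hl _
    · exact hr _

theorem leafOf_paint (c : S) (t : CTree Unit α) (p : BinSeq) :
    leafOf σ (t.paint c) p = leafOf (fun _ => σ c) t p := by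
  induction t generalizing p with
  | leaf i => rfl
  | node _ l r hl hr =>
    simp only [CTree.paint, leafOf, hl, hr]

variable {σ}

/-- If the splittings respect the skein relations, then skein equivalent trees have the same leaf
maps. -/
theorem SkeinEq.leafOf_eq {R : Set (SkeinRelation S)}
    (hR : ∀ r ∈ R, leafOf σ r.lhs.tree = leafOf σ r.rhs.tree) {t u : CTree S α}
    (h : SkeinEq R t u) : leafOf σ t = leafOf σ u := by
  induction h with
  | rel r h => exact hR r h
  | refl t => rfl
  | symm _ ih => exact ih.symm
  | trans _ _ ih1 ih2 => exact ih1.trans ih2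
  | comp _ _ ih1 ih2 =>
    funext p
    rw [leafOf_bind, leafOf_bind, ih1, ih2]

theorem isBranch_glue (hσ : ∀ c, IsSplitting (σ c)) (t : CTree S α) (k : α) :
    IsBranch (glue σ t k) := by
  induction t with
  | leaf i => exact .id
  | node c l r hl hr =>
    by_cases h : k ∈ l.leaves
    · have : glue σ (.node c l r) k = (fun p => σ c (false, p)) ∘ glue σ l k := by
        funext p; simp [glue, h]
      exact this ▸ ((hσ c).branch false).comp hl
    · have : glue σ (.node c l r) k = (fun p => σ c (true, p)) ∘ glue σ r k := by
        funext p; simp [glue, h]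
      exact this ▸ ((hσ c).branch true).comp hr

/-- The spaces on top of consecutive leaves have a common end point. -/
theorem isChain_glue (hσ : ∀ c, IsSplitting (σ c)) {t : CTree S α} (ht : t.leaves.Nodup) :
    t.leaves.IsChain (fun k k' => val (glue σ t k ones) = val (glue σ t k' zeros)) ∧
    (∀ k ∈ t.leaves.head?, val (glue σ t k zeros) = 0) ∧
    ∀ k ∈ t.leaves.getLast?, val (glue σ t k ones) = 1 := by
  induction t with
  | leaf i => simp [CTree.leaves, glue, val_zeros, val_ones]
  | node c l r hl hr =>
    have ht' := List.nodup_append'.1 ht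
    obtain ⟨l1, l2, l3⟩ := hl ht'.1
    obtain ⟨r1, r2, r3⟩ := hr ht'.2.1
    have gl : ∀ k ∈ l.leaves, glue σ (.node c l r) k = fun p => σ c (false, glue σ l k p) := by
      intro k hk; funext p; simp [glue, hk]
    have gr : ∀ k ∈ r.leaves, glue σ (.node c l r) k = fun p => σ c (true, glue σ r k p) := by
      intro k hk; funext p
      have : k ∉ l.leaves := fun h => ht'.2.2 h hk
      simp [glue, this]
    have hc : ∀ (b : Bool) {p q : BinSeq}, val p = val q → val (σ c (b, p)) = val (σ c (b, q)) :=
      fun b _ _ h => ((hσ c).branch b).val_congr h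
    refine ⟨List.isChain_append.2 ⟨?_, ?_, fun k hk k' hk' => ?_⟩, fun k hk => ?_, fun k hk => ?_⟩
    · refine l1.imp_of_mem_imp fun k k' hk hk' h => ?_
      rw [gl k hk, gl k' hk']
      exact hc _ h
    · refine r1.imp_of_mem_imp fun k k' hk hk' h => ?_
      rw [gr k hk, gr k' hk']
      exact hc _ h
    -- At the junction, the last leaf of `l` ends at value 1 and the first leaf of `r` begins at
    -- value 0 inside their halves; the splitting glues these two ends.
    · rw [gl k (List.mem_of_mem_getLast? hk), gr k' (List.mem_of_mem_head? hk')]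
      exact (hc false ((l3 k hk).trans val_ones.symm)).trans
        ((hσ c).left_ones.trans (hc true ((r2 k' hk').trans val_zeros.symm)).symm)
    · have : k ∈ l.leaves.head? := by
        simpa [CTree.leaves, List.head?_append, List.head?_eq_some_head l.leaves_ne_nil] using hk
      rw [gl k (List.mem_of_mem_head? this)]
      exact (hc false ((l2 k this).trans val_zeros.symm)).trans (hσ c).left_zeros
    · have : k ∈ r.leaves.getLast? := by
        simpa [CTree.leaves, List.getLast?_append, List.getLast?_eq_some_getLast r.leaves_ne_nil]
          using hk
      rw [gr k (List.mem_of_mem_getLast? this)]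
      exact (hc true ((r3 k this).trans val_ones.symm)).trans (hσ c).right_ones

end Leaf

/-! ### The splitting of the vine colour -/

section Vine

variable {n : ℕ} (x : PlanarTree Unit (n + 2))

/-- The embedding of the space of binary sequences on top of the `k`-th leaf of `x`. -/
noncomputable def leafMap (k : Fin (n + 2)) : BinSeq → BinSeq := glue (fun _ => consEquiv) x.tree k

theorem glue_cons_eq_prepend {α : Type} (t : CTree Unit α) (k : α) :
    ∃ u : List Bool, glue (fun _ => consEquiv) t k = prepend u := by
  induction t with
  | leaf i => exact ⟨[], rfl⟩
  | node c l r hl hr =>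
    obtain ⟨u, hu⟩ := hl
    obtain ⟨w, hw⟩ := hr
    by_cases h : k ∈ l.leaves
    · exact ⟨false :: u, by funext p; simp [glue, h, hu]; rfl⟩
    · exact ⟨true :: w, by funext p; simp [glue, h, hw]; rfl⟩

/-- The root of `x` is a caret because `x` has at least two leaves. Hence the word is nonempty,
which is what makes repeated descent into the last leaf terminate. -/
theorem leafMap_eq_prepend (k : Fin (n + 2)) :
    ∃ u : List Bool, u ≠ [] ∧ leafMap x k = prepend u := by
  obtain ⟨t, ht⟩ := x
  cases t with
  | leaf i => simpa [CTree.leaves] using congrArg List.length ht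
  | node c l r =>
    obtain ⟨u, hu⟩ := glue_cons_eq_prepend l k
    obtain ⟨w, hw⟩ := glue_cons_eq_prepend r k
    by_cases h : k ∈ l.leaves
    · exact ⟨false :: u, by simp, by funext p; simp [leafMap, glue, h, hu]; rfl⟩
    · exact ⟨true :: w, by simp, by funext p; simp [leafMap, glue, h, hw]; rfl⟩

theorem planar_nodup {S : Type} {m : ℕ} (t : PlanarTree S m) : t.tree.leaves.Nodup :=
  t.planar ▸ List.nodup_finRange m

theorem leafOf_leafMap (k : Fin (n + 2)) (p : BinSeq) :
    leafOf (fun _ => consEquiv) x.tree (leafMap x k p) = (k, p) :=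
  leafOf_glue _ (x.planar ▸ List.mem_finRange k) p

theorem exists_leafMap_eq (p : BinSeq) : ∃ k q, p = leafMap x k q :=
  ⟨_, _, (glue_leafOf _ (planar_nodup x) p).symm⟩

theorem leafMap_inj {k k' : Fin (n + 2)} {p q : BinSeq} (h : leafMap x k p = leafMap x k' q) :
    k = k' ∧ p = q := by
  have := congrArg (leafOf (fun _ => consEquiv) x.tree) h
  rwa [leafOf_leafMap, leafOf_leafMap, Prod.mk.injEq] at this

/-- The values 0 and 1 have only one binary expansion each in this space, so the outer end
conditions become equalities of sequences. -/
theorem leafMap_chain : (∀ k : ℕ, ∀ h : k + 1 < n + 2,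
      val (leafMap x ⟨k, by omega⟩ ones) = val (leafMap x ⟨k + 1, h⟩ zeros)) ∧
    leafMap x 0 zeros = zeros ∧ leafMap x (Fin.last (n + 1)) ones = ones := by
  obtain ⟨h1, h2, h3⟩ := isChain_glue (σ := fun _ => consEquiv) (fun _ => isSplitting_consEquiv)
    (planar_nodup x)
  rw [x.planar] at h1 h2 h3
  refine ⟨fun k h => ?_, eq_zeros_of_val (h2 0 ?_), eq_ones_of_val (h3 (Fin.last (n + 1)) ?_)⟩
  · have := List.isChain_iff_getElem.1 h1 k (by simpa using h)
    simpa [leafMap] using this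
  · simp [List.finRange_succ]
  · simp [List.finRange_succ_last]

theorem leafMap_zeros : leafMap x 0 zeros = zeros := (leafMap_chain x).2.1

theorem leafMap_ones : leafMap x (Fin.last (n + 1)) ones = ones := (leafMap_chain x).2.2

/-! ### The pieces and their shift -/

/-- Away from `1, 1, …`, the space is cut into the pieces on top of all leaves of `x` but the last one,
and, repeatedly, the piece on top of the last leaf is cut in the same way. These are the embeddings of
the pieces, from left to right. -/
noncomputable def piece (j : ℕ) (p : BinSeq) : BinSeq :=
  if h : j < n + 1 then leafMap x ⟨j, by omega⟩ p
  else leafMap x (Fin.last (n + 1)) (piece (j - (n + 1)) p)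

theorem piece_of_lt {j : ℕ} (h : j < n + 1) (p : BinSeq) :
    piece x j p = leafMap x ⟨j, by omega⟩ p := by rw [piece, dif_pos h]

theorem piece_add (j : ℕ) (p : BinSeq) :
    piece x (j + (n + 1)) p = leafMap x (Fin.last (n + 1)) (piece x j p) := by
  rw [piece, dif_neg (by omega), Nat.add_sub_cancel]

/-- Induction on the number of a piece. -/
theorem piece_induction {P : ℕ → Prop} (h0 : ∀ j < n + 1, P j) (h1 : ∀ j, P j → P (j + (n + 1)))
    (j : ℕ) : P j := by
  induction j using Nat.strong_induction_on with
  | _ j ih =>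
    rcases lt_or_ge j (n + 1) with h | h
    · exact h0 j h
    · obtain ⟨i, rfl⟩ := Nat.exists_eq_add_of_le' h
      exact h1 i (ih i (by omega))

theorem piece_eq_prepend (j : ℕ) : ∃ u : List Bool, piece x j = prepend u := by
  induction j using piece_induction (n := n) with
  | h0 j h =>
    obtain ⟨u, -, hu⟩ := leafMap_eq_prepend x ⟨j, by omega⟩
    exact ⟨u, funext fun p => by rw [piece_of_lt x h, hu]⟩
  | h1 j ih =>
    obtain ⟨w, hw⟩ := ih
    obtain ⟨u, -, hu⟩ := leafMap_eq_prepend x (Fin.last (n + 1))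
    exact ⟨u ++ w, funext fun p => by rw [piece_add, hu, hw, prepend_append]⟩

/-- The sequence 111… lies over the last leaf at every stage of the cutting, whereas a piece finally
leaves through another leaf. -/
theorem piece_ne_ones (j : ℕ) (p : BinSeq) : piece x j p ≠ ones := by
  induction j using piece_induction (n := n) with
  | h0 j h =>
    rw [piece_of_lt x h, ← leafMap_ones x]
    intro he
    have := congrArg Fin.val (leafMap_inj x he).1
    simp at this
    omega
  | h1 j ih =>
    rw [piece_add, ← leafMap_ones x]
    exact fun he => ih (leafMap_inj x he).2

theorem piece_inj {j j' : ℕ} {p q : BinSeq} (h : piece x j p = piece x j' q) : j = j' ∧ p = q := by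
  induction j using piece_induction (n := n) generalizing j' with
  | h0 j hj =>
    rw [piece_of_lt x hj] at h
    rcases lt_or_ge j' (n + 1) with hj' | hj'
    · rw [piece_of_lt x hj'] at h
      exact ⟨congrArg Fin.val (leafMap_inj x h).1, (leafMap_inj x h).2⟩
    · obtain ⟨i, rfl⟩ := Nat.exists_eq_add_of_le' hj'
      rw [piece_add] at h
      have := congrArg Fin.val (leafMap_inj x h).1
      simp at this
      omega
  | h1 j ih =>
    rw [piece_add] at h
    rcases lt_or_ge j' (n + 1) with hj' | hj'
    · rw [piece_of_lt x hj'] at h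
      have := congrArg Fin.val (leafMap_inj x h).1
      simp at this
      omega
    · obtain ⟨i, rfl⟩ := Nat.exists_eq_add_of_le' hj'
      rw [piece_add] at h
      obtain ⟨rfl, h'⟩ := ih (leafMap_inj x h).2
      exact ⟨rfl, h'⟩

/-- The last leaf has a nonempty address consisting of ones only. Each descent into it moves a digit
0 of the sequence closer to the front, so the descent stops. -/
theorem exists_piece_eq {p : BinSeq} (hp : p ≠ ones) : ∃ j q, p = piece x j q := by
  obtain ⟨m, hm⟩ := Function.ne_iff.1 hp
  induction m using Nat.strong_induction_on generalizing p with
  | _ m ih =>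
    obtain ⟨k, q, rfl⟩ := exists_leafMap_eq x p
    induction k using Fin.lastCases with
    | cast k => exact ⟨k, q, (piece_of_lt x k.2 q).symm⟩
    | last =>
      obtain ⟨u, hu, hux⟩ := leafMap_eq_prepend x (Fin.last (n + 1))
      have hones := leafMap_ones x
      rw [hux] at hones hm
      have hlen := List.length_pos_iff.2 hu
      -- The word `u` is a prefix of 111…, so the differing digit comes after it.
      have hmu : u.length ≤ m := by
        by_contra hlt
        exact hm ((prepend_apply_of_lt (by omega) q ones).trans (congrFun hones m))
      obtain ⟨i, rfl⟩ := Nat.exists_eq_add_of_le' hmu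
      rw [prepend_apply_add] at hm
      obtain ⟨j, r, rfl⟩ := ih i (by omega) (p := q) (fun h => hm (by rw [h]; rfl)) hm
      exact ⟨j + (n + 1), r, (piece_add x j r).symm⟩

open Classical in
/-- The map that shifts every piece to the next one. -/
noncomputable def shiftPieces (p : BinSeq) : BinSeq :=
  if h : p ≠ ones then
    piece x ((exists_piece_eq x h).choose + 1) (exists_piece_eq x h).choose_spec.choose
  else ones

theorem shiftPieces_ones : shiftPieces x ones = ones := by
  rw [shiftPieces, dif_neg (not_not.2 rfl)]

theorem shiftPieces_piece (j : ℕ) (p : BinSeq) :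
    shiftPieces x (piece x j p) = piece x (j + 1) p := by
  have h := piece_ne_ones x j p
  rw [shiftPieces, dif_pos h]
  obtain ⟨h1, h2⟩ := piece_inj x (exists_piece_eq x h).choose_spec.choose_spec
  exact congrArg₂ (fun i r => piece x (i + 1) r) h1.symm h2.symm

theorem shiftPieces_iterate (m j : ℕ) (p : BinSeq) :
    (shiftPieces x)^[m] (piece x j p) = piece x (j + m) p := by
  induction m with
  | zero => rfl
  | succ m ih => rw [Function.iterate_succ_apply', ih, shiftPieces_piece]; rfl

/-- One round of cutting produces n + 1 pieces, so moving by n + 1 pieces is the same as one descent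
into the last leaf. This identity is the skein relation in the model. -/
theorem shiftPieces_iterate_eq (p : BinSeq) :
    (shiftPieces x)^[n + 1] p = leafMap x (Fin.last (n + 1)) p := by
  by_cases hp : p = ones
  · rw [hp, leafMap_ones]
    exact Function.iterate_fixed (shiftPieces_ones x) _
  · obtain ⟨j, q, rfl⟩ := exists_piece_eq x hp
    rw [shiftPieces_iterate, piece_add]

/-- The embedding over the last leaf is an iterate of the shift, and a map commutes with its
iterates. -/
theorem shiftPieces_leafMap (p : BinSeq) : shiftPieces x (leafMap x (Fin.last (n + 1)) p) =
    leafMap x (Fin.last (n + 1)) (shiftPieces x p) := by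
  rw [← shiftPieces_iterate_eq, ← shiftPieces_iterate_eq, 
    ← Function.iterate_succ_apply' (shiftPieces x), Function.iterate_succ_apply]

/-- The shift is injective, and its image consists of 111… and all pieces but piece 0. -/
theorem vineSplit_bijective : Function.Bijective
    fun u : Bool × BinSeq => bif u.1 then shiftPieces x u.2 else piece x 0 u.2 := by
  have hne : ∀ p q, shiftPieces x p ≠ piece x 0 q := by
    intro p q h
    by_cases hp : p = ones
    · rw [hp, shiftPieces_ones] at h
      exact piece_ne_ones x 0 q h.symm
    · obtain ⟨j, r, rfl⟩ := exists_piece_eq x hp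
      rw [shiftPieces_piece] at h
      exact absurd (piece_inj x h).1 (by omega)
  have hshift : ∀ p q, shiftPieces x p = shiftPieces x q → p = q := by
    intro p q h
    by_cases hp : p = ones
    · by_cases hq : q = ones
      · rw [hp, hq]
      · obtain ⟨j, r, rfl⟩ := exists_piece_eq x hq
        rw [hp, shiftPieces_ones, shiftPieces_piece] at h
        exact absurd h.symm (piece_ne_ones x _ _)
    · obtain ⟨j, r, rfl⟩ := exists_piece_eq x hp
      by_cases hq : q = ones
      · rw [hq, shiftPieces_ones, shiftPieces_piece] at h
        exact absurd h (piece_ne_ones x _ _)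
      · obtain ⟨j', r', rfl⟩ := exists_piece_eq x hq
        rw [shiftPieces_piece, shiftPieces_piece] at h
        obtain ⟨h1, rfl⟩ := piece_inj x h
        obtain rfl : j = j' := by omega
        rfl
  constructor
  · rintro ⟨_ | _, p⟩ ⟨_ | _, q⟩ h
    · exact congrArg (Prod.mk false) (piece_inj x h).2
    · exact absurd (Eq.symm h) (hne q p)
    · exact absurd h (hne p q)
    · exact congrArg (Prod.mk true) (hshift p q h)
  · intro p
    by_cases hp : p = ones
    · exact ⟨(true, ones), by rw [hp]; exact shiftPieces_ones x⟩
    · obtain ⟨j, q, rfl⟩ := exists_piece_eq x hp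
      cases j with
      | zero => exact ⟨(false, q), rfl⟩
      | succ j => exact ⟨(true, piece x j q), shiftPieces_piece x j q⟩

/-- The splitting for the second colour: the left half is the first piece. -/
noncomputable def vineSplit : Bool × BinSeq ≃ BinSeq := Equiv.ofBijective _ (vineSplit_bijective x)

theorem vineSplit_false (p : BinSeq) : vineSplit x (false, p) = piece x 0 p := rfl

theorem vineSplit_true (p : BinSeq) : vineSplit x (true, p) = shiftPieces x p := rfl

/-- Within a round, neighbouring pieces lie over neighbouring leaves of `x`; later rounds are
rescaled copies. -/
theorem val_piece_ones (j : ℕ) : val (piece x j ones) = val (piece x (j + 1) zeros) := by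
  induction j using piece_induction (n := n) with
  | h0 j h =>
    rw [piece_of_lt x h, (leafMap_chain x).1 j (by omega)]
    rcases Nat.lt_or_ge (j + 1) (n + 1) with h' | h'
    · rw [piece_of_lt x h']
    -- The last piece of a round meets the first piece of the next round, which begins where the
    -- last leaf begins because leaf 0 keeps 000… fixed.
    · obtain rfl : j = n := by omega
      have h0 := piece_add x 0 zeros
      rw [zero_add, piece_of_lt x (j := 0) (by omega)] at h0
      rw [h0]
      show _ = val (leafMap x _ (leafMap x 0 zeros))
      rw [leafMap_zeros]
      rfl
  | h1 j ih =>
    rw [show j + (n + 1) + 1 = j + 1 + (n + 1) by omega, piece_add, piece_add]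
    obtain ⟨u, -, hu⟩ := leafMap_eq_prepend x (Fin.last (n + 1))
    rw [hu, val_prepend_inj, ih]

theorem val_piece_zeros_strictMono : StrictMono fun j => val (piece x j zeros) := by
  refine strictMono_nat_of_lt_succ fun j => ?_
  rw [← val_piece_ones]
  obtain ⟨u, hu⟩ := piece_eq_prepend x j
  rw [hu, val_prepend u ones, val_ones, lt_add_iff_pos_right]
  positivity

/-- Away from 111…, sequences of equal value lie in one piece or at the common end of two
consecutive pieces. In the second case their images are again at the common end of consecutive
pieces. -/
theorem shiftPieces_val_congr {p q : BinSeq} (h : val p = val q) :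
    val (shiftPieces x p) = val (shiftPieces x q) := by
  by_cases hp : p = ones
  · rw [hp, val_ones] at h
    rw [hp, eq_ones_of_val h.symm]
  by_cases hq : q = ones
  · rw [hq, val_ones] at h
    exact absurd (eq_ones_of_val h) hp
  obtain ⟨j, p, rfl⟩ := exists_piece_eq x hp
  obtain ⟨j', q, rfl⟩ := exists_piece_eq x hq
  clear hp hq
  rw [shiftPieces_piece, shiftPieces_piece]
  wlog hjj : j ≤ j' generalizing j j' p q
  · exact (this j' q j p h.symm (by omega)).symm
  have hinj : ∀ (i : ℕ) {r s : BinSeq}, val (piece x i r) = val (piece x i s) ↔ val r = val s := by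
    intro i r s
    obtain ⟨u, hu⟩ := piece_eq_prepend x i
    rw [hu, val_prepend_inj]
  have hbound : ∀ (i : ℕ) (r : BinSeq), val (piece x i zeros) ≤ val (piece x i r) ∧
      val (piece x i r) ≤ val (piece x (i + 1) zeros) := by
    intro i r
    rw [← val_piece_ones]
    obtain ⟨u, hu⟩ := piece_eq_prepend x i
    rw [hu, val_prepend u r, val_prepend u ones, val_ones]
    have h1 := val_nonneg r
    have h2 := val_le_one r
    exact ⟨le_add_of_nonneg_right (by positivity),
      add_le_add_right (div_le_div_of_nonneg_right h2 (by positivity)) _⟩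
  rcases hjj.eq_or_lt with rfl | hlt
  · exact (hinj _).2 ((hinj _).1 h)
  · have hm := val_piece_zeros_strictMono x
    have h1 := (hbound j p).2
    have h2 := (hbound j' q).1
    have h3 : val (piece x (j + 1) zeros) ≤ val (piece x j' zeros) := hm.monotone hlt
    -- Equality of values squeezes piece `j` against piece `j'`, so nothing lies between them.
    obtain rfl : j + 1 = j' := hm.injective (le_antisymm h3 (by linarith))
    have h4 : val p = val ones := (hinj j).1 (by rw [val_piece_ones]; linarith)
    have h5 : val q = val zeros := (hinj (j + 1)).1 (by linarith)
    rw [(hinj (j + 1)).2 h4, (hinj (j + 1 + 1)).2 h5, val_piece_ones]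

/-- The shift commutes with adding the word `u` of ones that leads to the last leaf. So every
further copy of `u` at the beginning of the input gives another |u| ones at the beginning of the
output. -/
theorem continuousAt_shiftPieces_ones : ContinuousAt (shiftPieces x) ones := by
  obtain ⟨u, hu, hux⟩ := leafMap_eq_prepend x (Fin.last (n + 1))
  have hones := leafMap_ones x
  rw [hux] at hones
  have hlen := List.length_pos_iff.2 hu
  have key : ∀ m : ℕ, ∃ M : ℕ, ∀ q : BinSeq, (∀ k < M, q k = true) →
      ∀ k < m, shiftPieces x q k = true := by
    intro m
    induction m with
    | zero => exact ⟨0, fun q _ k hk => by omega⟩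
    | succ m ih =>
      obtain ⟨M, hM⟩ := ih
      refine ⟨M + u.length, fun q hq k hk => ?_⟩
      have h1 := eq_prepend_of_agree (u := u) (p := ones) (q := q)
        fun i hi => by rw [hones]; exact hq i (by omega)
      rw [h1, ← hux, shiftPieces_leafMap, hux]
      rcases lt_or_ge k u.length with hku | hku
      · rw [prepend_apply_of_lt hku _ ones, hones]; rfl
      · obtain ⟨i, rfl⟩ := Nat.exists_eq_add_of_le' hku
        rw [prepend_apply_add]
        exact hM _ (fun j hj => hq _ (by omega)) i (by omega)
  refine tendsto_pi_nhds.2 fun k => ?_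
  obtain ⟨M, hM⟩ := key (k + 1)
  refine tendsto_nhds_of_eventually_eq ?_
  filter_upwards [agree_mem_nhds M ones] with q hq
  rw [hM q hq k (by omega), shiftPieces_ones]
  rfl

/-- Away from 111… the map replaces one fixed prefix by another on a whole neighbourhood, namely the
sequences with that prefix. -/
theorem continuous_shiftPieces : Continuous (shiftPieces x) := by
  refine continuous_iff_continuousAt.2 fun p => ?_
  by_cases hp : p = ones
  · exact hp ▸ continuousAt_shiftPieces_ones x
  · obtain ⟨j, q, rfl⟩ := exists_piece_eq x hp
    obtain ⟨u, hu⟩ := piece_eq_prepend x j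
    obtain ⟨w, hw⟩ := piece_eq_prepend x (j + 1)
    have hc : Continuous fun r : BinSeq => prepend w fun k => r (k + u.length) :=
      (continuous_prepend w).comp (continuous_pi fun k => continuous_apply _)
    refine hc.continuousAt.congr ?_
    filter_upwards [agree_mem_nhds u.length (piece x j q)] with r hr
    rw [hu] at hr
    conv_rhs => rw [eq_prepend_of_agree hr]
    rw [← hu, shiftPieces_piece, hw]

theorem isSplitting_vineSplit : IsSplitting (vineSplit x) where
  branch b := by
    cases b
    · obtain ⟨u, hu⟩ := piece_eq_prepend x 0
      have : (fun p => vineSplit x (false, p)) = prepend u := hu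
      exact this ▸ isBranch_prepend u
    · show IsBranch (shiftPieces x)
      refine ⟨shiftPieces_val_congr x, fun p hp => ?_, ?_, continuous_shiftPieces x⟩
      · obtain ⟨j, q, rfl⟩ := exists_piece_eq x hp
        obtain ⟨u, hu⟩ := piece_eq_prepend x j
        obtain ⟨w, hw⟩ := piece_eq_prepend x (j + 1)
        refine ⟨by rw [shiftPieces_piece]; exact piece_ne_ones x _ _, u, q, w, by rw [hu],
          fun r => ?_⟩
        rw [← hu, shiftPieces_piece, hw]
      · rw [shiftPieces_ones]
        exact eventuallyOnes_ones
  left_zeros := by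
    rw [vineSplit_false, piece_of_lt x (by omega)]
    show val (leafMap x 0 zeros) = 0
    rw [leafMap_zeros, val_zeros]
  left_ones := by
    rw [vineSplit_false, vineSplit_true, val_piece_ones]
    have : zeros = piece x 0 zeros := by
      rw [piece_of_lt x (by omega)]
      exact (leafMap_zeros x).symm
    conv_rhs => rw [this, shiftPieces_piece]
  right_ones := by rw [vineSplit_true, shiftPieces_ones, val_ones]

/-- The splittings of the two colours. -/
noncomputable def split : Colour → Bool × BinSeq ≃ BinSeq
  | .a => consEquiv
  | .b => vineSplit x

theorem isSplitting_split (c : Colour) : IsSplitting (split x c) := by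
  cases c
  · exact isSplitting_consEquiv
  · exact isSplitting_vineSplit x

/-- Every caret of the vine peels off piece 0 and undoes one shift on its right. So leaf k carries
piece k, and the last leaf carries what has been shifted once per caret. -/
theorem leafOf_rightVine (m : ℕ) : (∀ k (h : k < m), ∀ p,
      leafOf (split x) ((rightVine m).tree.paint .b) (piece x k p) = (⟨k, by omega⟩, p)) ∧
    ∀ p, leafOf (split x) ((rightVine m).tree.paint .b) ((shiftPieces x)^[m] p)
      = (Fin.last m, p) := by
  have hbind : ∀ {m : ℕ} (t : CTree Unit (Fin m)) (c : Colour) (p : BinSeq),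
      leafOf (split x) ((t.bind fun i => CTree.leaf i.succ).paint c) p
        = ((leafOf (split x) (t.paint c) p).1.succ, (leafOf (split x) (t.paint c) p).2) := by
    intro m t c p
    rw [leafOf_paint, leafOf_bind, leafOf_paint]
    rfl
  induction m with
  | zero => exact ⟨fun k h => by omega, fun p => rfl⟩
  | succ m ih =>
    have hr : ∀ p, leafOf (split x) ((rightVine (m + 1)).tree.paint .b) (shiftPieces x p)
        = ((leafOf (split x) ((rightVine m).tree.paint .b) p).1.succ,
          (leafOf (split x) ((rightVine m).tree.paint .b) p).2) := by
      intro p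
      have : (split x .b).symm (shiftPieces x p) = (true, p) :=
        (vineSplit x).symm_apply_apply (true, p)
      rw [← hbind]
      simp [rightVine, CTree.paint, leafOf, this]
    refine ⟨fun k h p => ?_, fun p => ?_⟩
    · cases k with
      | zero =>
        have : (split x .b).symm (piece x 0 p) = (false, p) :=
          (vineSplit x).symm_apply_apply (false, p)
        simp [rightVine, CTree.paint, leafOf, this]
      | succ k =>
        rw [← shiftPieces_piece, hr, ih.1 k (by omega)]
        rfl
    · rw [Function.iterate_succ_apply', hr, ih.2]
      rfl

/-- The splittings respect the skein relation. -/
theorem leafOf_relation : ∀ r ∈ vinePresentation x,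
    leafOf (split x) r.lhs.tree = leafOf (split x) r.rhs.tree := by
  rintro r rfl
  funext p
  show leafOf (split x) (x.tree.paint .a) p
    = leafOf (split x) ((rightVine (n + 1)).tree.paint .b) p
  obtain ⟨k, q, rfl⟩ := exists_leafMap_eq x p
  rw [leafOf_paint]
  refine (leafOf_leafMap x k q).trans ?_
  induction k using Fin.lastCases with
  | cast k =>
    have := (leafOf_rightVine x (n + 1)).1 k k.2 q
    rw [piece_of_lt x k.2] at this
    exact this.symm
  | last =>
    have := (leafOf_rightVine x (n + 1)).2 q
    rw [shiftPieces_iterate_eq] at this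
    exact this.symm

end Vine

/-! ### The boundary as the space of binary sequences -/

section BoundaryModel

variable {n : ℕ} {x : PlanarTree Unit (n + 2)} {X : FTV}

/-- The leaf map of the `i`-th tree of a forest. -/
noncomputable def homLeaf {A B : FSCat (vinePresentation x) X} (f : A ⟶ B) (i : Fin A.size) :
    BinSeq → Fin B.size × BinSeq :=
  Quotient.lift (s := forestSetoid (vinePresentation x) X A.size B.size)
    (fun f : FreeForest Colour X A.size B.size => leafOf (split x) (f.tree i))
    (fun _ _ h => (h i).leafOf_eq (leafOf_relation x)) f

theorem homLeaf_comp {A B C : FSCat (vinePresentation x) X} (f : A ⟶ B) (g : B ⟶ C)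
    (i : Fin A.size) (p : BinSeq) :
    homLeaf (f ≫ g) i p = homLeaf g (homLeaf f i p).1 (homLeaf f i p).2 := by
  induction f using Quotient.inductionOn with
  | h f =>
  induction g using Quotient.inductionOn with
  | h g => exact leafOf_bind _ _ _ _

theorem root_homLeaf {A B : FSCat (vinePresentation x) X} (f : A ⟶ B) (i : Fin A.size)
    (p : BinSeq) : root f (homLeaf f i p).1 = i := by
  refine root_eq ?_
  induction f using Quotient.inductionOn with
  | h f => exact leafOf_mem _ _ _

theorem homLeaf_incl {A B : FSCat (vinePresentation x) .F} (f : A ⟶ B) (i : Fin A.size)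
    (p : BinSeq) : homLeaf (incl X f) i p = homLeaf f i p := by
  induction f using Quotient.inductionOn with
  | h f => rfl

/-- The compatible choice of leaves given by a binary sequence. -/
noncomputable def limitOf (x : PlanarTree Unit (n + 2)) (X : FTV) (p : BinSeq) :
    Limit (vinePresentation x) X where
  val u := (homLeaf u 0 p).1
  compat t f := by rw [homLeaf_comp, root_homLeaf]

/-- The leaf map of a relabelled tree selects the relabelled leaf, so computing with the tree itself
agrees with making it planar and going back. -/
theorem extend_limitOf (p : BinSeq) : Boundary.extend X (limitOf x .F p) = limitOf x X p := by
  ext A u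
  obtain ⟨B, q, t, h⟩ := exists_planarize u
  rw [Boundary.extend_val _ u q t h]
  show ((root q (homLeaf t 0 p).1 : Fin A.size) : ℕ) = (homLeaf u 0 p).1
  rw [← homLeaf_incl (X := X) t 0 p, ← h, homLeaf_comp, root_homLeaf]

/-- If `t` at `q` and `s` at `p` select the same leaf and the same point over it, this persists
after any forest is put on top of both. On a common multiple of `t` and `w` the action therefore
selects the leaf that belongs to `q`. -/
theorem canonicalAction_limitOf {A : FSCat (vinePresentation x) X}
    (t s : one (vinePresentation x) X ⟶ A) {p q : BinSeq} (h : homLeaf t 0 q = homLeaf s 0 p) :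
    canonicalAction (vinePresentation x) X (Frac.mk t s) (limitOf x .F p) = limitOf x .F q := by
  apply (Boundary.equivLimit (vinePresentation x) X).injective
  have h1 : Boundary.equivLimit (vinePresentation x) X
      (canonicalAction (vinePresentation x) X (Frac.mk t s) (limitOf x .F p))
        = act (Frac.mk t s) (Boundary.extend X (limitOf x .F p)) :=
    (Boundary.equivLimit (vinePresentation x) X).apply_symm_apply _
  have h2 : Boundary.equivLimit (vinePresentation x) X (limitOf x .F q)
      = limitOf x X q := extend_limitOf q
  rw [h1, h2, extend_limitOf]
  ext C w
  obtain ⟨D, k, l, hkl⟩ := OreCategory.common_multiple t w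
  rw [act_val t s _ w k l hkl]
  show ((root l (homLeaf (s ≫ k) 0 p).1 : Fin C.size) : ℕ) = (homLeaf w 0 q).1
  rw [homLeaf_comp, ← h, ← homLeaf_comp, hkl, homLeaf_comp, root_homLeaf]

/-- The free forest that represents the complete tree. -/
def completeForest (c : Colour) : (k : ℕ) → FreeForest Colour .F 1 (2 ^ k)
  | 0 => FreeForest.id Colour .F 1
  | k + 1 => (completeForest c k).comp (carets c (2 ^ k))

theorem completeForest_hom (R : Set (SkeinRelation Colour)) (c : Colour) (k : ℕ) :
    (completeForest c k).hom R = completeTree R c k := by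
  induction k with
  | zero => rfl
  | succ k ih => rw [completeTree, ← ih]; rfl

/-- The tree is complete of depth `k` and coloured by `c`. -/
def IsComplete (c : Colour) {α : Type} : ℕ → CTree Colour α → Prop
  | 0, t => ∃ i, t = .leaf i
  | _ + 1, .leaf _ => False
  | k + 1, .node c' l r => c' = c ∧ IsComplete c k l ∧ IsComplete c k r

theorem IsComplete.bind {c : Colour} {α β : Type} {k : ℕ} {t : CTree Colour α}
    (ht : IsComplete c k t) {g : α → CTree Colour β} (hg : ∀ i, IsComplete c 1 (g i)) :
    IsComplete c (k + 1) (t.bind g) := by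
  induction k generalizing t with
  | zero =>
    obtain ⟨i, rfl⟩ := ht
    exact hg i
  | succ k ih =>
    cases t with
    | leaf i => exact ht.elim
    | node c' l r => exact ⟨ht.1, ih ht.2.1, ih ht.2.2⟩

theorem IsComplete.fullTo {c : Colour} {α : Type} {k : ℕ} {t : CTree Colour α}
    (ht : IsComplete c k t) : FullTo c k t := by
  induction k generalizing t with
  | zero => trivial
  | succ k ih =>
    cases t with
    | leaf i => exact ht.elim
    | node c' l r => exact ⟨ht.1, ih ht.2.1, ih ht.2.2⟩

theorem completeForest_complete (c : Colour) (k : ℕ) (i : Fin 1) :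
    IsComplete c k ((completeForest c k).tree i) := by
  induction k with
  | zero => exact ⟨i, rfl⟩
  | succ k ih => exact ih.bind fun j => ⟨rfl, ⟨_, rfl⟩, ⟨_, rfl⟩⟩

/-- Every tree is a factor of a complete tree. -/
theorem exists_comp_eq_completeTree {A : FSCat (vinePresentation x) .F}
    (t : one (vinePresentation x) .F ⟶ A) :
    ∃ (d : ℕ) (f : A ⟶ ⟨2 ^ d⟩), t ≫ f = completeTree _ .a d := by
  induction t using Quotient.inductionOn with
  | h t =>
  obtain ⟨M, hM⟩ := exists_divides_quasi (x := x) (y := rightVine (n + 1)) (t.tree 0)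
    ((List.nodup_flatMap.1 t.nodup).1 0 (List.mem_finRange _))
  -- A complete quasi-tree of colour `a` has finite depth, so it is itself a factor of a complete
  -- tree of colour `a`.
  obtain ⟨d, hd⟩ := quasi_mono (x := x) (y := rightVine (n + 1)) .a M id
  have hd' : MonoDepth .a d (quasi x (rightVine (n + 1)) .a M) := by
    simpa only [id, CTree.bind_leaf] using hd
  have hdiv : ∀ i, Divides x (rightVine (n + 1)) (t.tree i) ((completeForest .a d).tree i) := by
    intro i
    obtain rfl := Subsingleton.elim (0 : Fin 1) i
    obtain ⟨k, hk⟩ := hd'.exists_bind (completeForest_complete .a d 0).fullTo (quasi_nodup .a M)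
    exact hk ▸ (hM M le_rfl).bind k
  obtain ⟨f, hf⟩ := t.exists_extension (completeForest .a d) hdiv
  refine ⟨d, Quotient.mk _ f, ?_⟩
  rw [← completeForest_hom]
  exact Quotient.sound hf

theorem homLeaf_carets {m : ℕ} (i : Fin m) (p : BinSeq) :
    ((homLeaf ((carets .a m).hom (vinePresentation x)) i p).1 : ℕ) = i * 2 + (p 0).toNat ∧
    (homLeaf ((carets .a m).hom (vinePresentation x)) i p).2 = fun k => p (k + 1) := by
  show (((leafOf (split x) (.node .a (.leaf _) (.leaf _)) p).1 : Fin (m * 2)) : ℕ) = _ ∧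
    (leafOf (split x) (.node .a (.leaf _) (.leaf _)) p).2 = _
  have : (split x .a).symm p = (p 0, fun k => p (k + 1)) := rfl
  rw [leafOf, this]
  cases p 0 <;> exact ⟨rfl, rfl⟩

theorem root_carets {m : ℕ} (j : Fin (m * 2)) :
    ((root ((carets .a m).hom (vinePresentation x)) j : Fin m) : ℕ) = (j : ℕ) / 2 := by
  have hlt : (j : ℕ) / 2 < m := by omega
  refine congrArg Fin.val (root_eq (i := (⟨(j : ℕ) / 2, hlt⟩ : Fin m)) ?_)
  show j ∈ (CTree.node Colour.a (.leaf _) (.leaf _)).leaves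
  simp only [CTree.leaves, List.mem_append, List.mem_singleton, Fin.ext_iff]
  omega

theorem homLeaf_completeTree_succ (k : ℕ) (p : BinSeq) :
    homLeaf (completeTree (vinePresentation x) .a (k + 1)) 0 p =
      homLeaf ((carets .a (2 ^ k)).hom (vinePresentation x))
        (homLeaf (completeTree (vinePresentation x) .a k) 0 p).1
        (homLeaf (completeTree (vinePresentation x) .a k) 0 p).2 :=
  homLeaf_comp (completeTree (vinePresentation x) .a k)
    ((carets Colour.a (2 ^ k)).hom (vinePresentation x)) 0 p

theorem homLeaf_completeTree_snd (k : ℕ) (p : BinSeq) :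
    (homLeaf (completeTree (vinePresentation x) .a k) 0 p).2 = fun m => p (m + k) := by
  induction k with
  | zero => rfl
  | succ k ih =>
    rw [homLeaf_completeTree_succ]
    refine (homLeaf_carets _ _).2.trans ?_
    rw [ih]
    funext m
    exact congrArg p (by omega)

theorem binaryDigit_limitOf (p : BinSeq) (k : ℕ) :
    binaryDigit .a (limitOf x .F p) k = (p k).toNat := by
  show ((homLeaf (completeTree (vinePresentation x) .a (k + 1)) 0 p).1 : ℕ) % 2 = _
  rw [homLeaf_completeTree_succ]
  refine (congrArg (· % 2) (homLeaf_carets _ _).1).trans ?_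
  rw [homLeaf_completeTree_snd]
  have := Bool.toNat_le (p k)
  simp only [zero_add]
  omega

/-- Complete trees are cofinal, so a point is determined by the leaves it selects there. The index
of such a leaf has its half fixed by the previous complete tree and its parity fixed by the binary
digit. -/
theorem exists_limitOf_eq (ξ : Boundary (vinePresentation x)) : ∃ p, limitOf x .F p = ξ := by
  let p : BinSeq := fun k => decide (binaryDigit .a ξ k = 1)
  have hp : ∀ k, binaryDigit .a (limitOf x .F p) k = binaryDigit .a ξ k := by
    intro k
    rw [binaryDigit_limitOf]
    have : binaryDigit .a ξ k < 2 := Nat.mod_lt _ two_pos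
    by_cases h : binaryDigit .a ξ k = 1
    · simp [p, h]
    · simp only [p, h, decide_false, Bool.toNat_false]
      omega
  have hval : ∀ k, (limitOf x .F p).val (completeTree _ .a k) = ξ.val (completeTree _ .a k) := by
    intro k
    induction k with
    | zero =>
      have : Subsingleton (Fin (2 ^ 0)) := inferInstanceAs (Subsingleton (Fin 1))
      exact Subsingleton.elim (α := Fin (2 ^ 0)) _ _
    | succ k ih =>
      have h1 := fun η : Boundary (vinePresentation x) => (root_carets (x := x) _).symm.trans
        (congrArg Fin.val (η.compat (completeTree _ .a k) ((carets .a (2 ^ k)).hom _)))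
      have h2 := h1 ξ
      have h3 := h1 (limitOf x .F p)
      rw [ih, ← h2] at h3
      have h4 : ((limitOf x .F p).val (completeTree _ .a (k + 1)) : ℕ) % 2
        = (ξ.val (completeTree _ .a (k + 1)) : ℕ) % 2 := hp k
      refine Fin.ext ?_
      have h5 : ((limitOf x .F p).val (completeTree _ .a (k + 1)) : ℕ) / 2
        = (ξ.val (completeTree _ .a (k + 1)) : ℕ) / 2 := h3
      omega
  refine ⟨p, ?_⟩
  ext A t
  obtain ⟨d, f, h⟩ := exists_comp_eq_completeTree t
  rw [← ξ.compat t f, ← (limitOf x .F p).compat t f, h, hval]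

theorem circlePoint_limitOf (p : BinSeq) :
    circlePoint .a (limitOf x .F p) = (val p : Circle₁) := by
  simp only [circlePoint, binaryDigit_limitOf, val]

theorem eventuallyOne_limitOf {p : BinSeq} :
    EventuallyOne .a (limitOf x .F p) ↔ EventuallyOnes p := by
  simp only [EventuallyOne, EventuallyOnes, binaryDigit_limitOf, Bool.toNat_eq_one]

theorem limitOf_injective : Function.Injective (limitOf x .F) := by
  intro p q h
  funext k
  have := binaryDigit_limitOf (x := x) p k
  rw [h, binaryDigit_limitOf] at this
  cases hp : p k <;> cases hq : q k <;> simp_all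

end BoundaryModel

/-! ### The induced bijections of the circle -/

/-- The point of the circle with binary expansion `p`. -/
noncomputable def seqPoint (p : BinSeq) : Circle₁ := (val p : Circle₁)

theorem continuous_seqPoint : Continuous seqPoint :=
  (AddCircle.continuous_mk' (1 : ℝ)).comp continuous_val

theorem exists_seqPoint_eq (q : Circle₁) : ∃ p, ¬ EventuallyOnes p ∧ seqPoint p = q := by
  obtain ⟨⟨y, hy⟩, rfl⟩ := (AddCircle.equivIco 1 (0 : ℝ)).symm.surjective q
  obtain ⟨p, hp, h⟩ := exists_val_eq hy.1 (by simpa using hy.2)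
  exact ⟨p, hp, by rw [seqPoint, h]; rfl⟩

/-- The sequences that are not eventually `1` are in bijection with the circle. -/
noncomputable def finiteExpansions : {p : BinSeq // ¬ EventuallyOnes p} ≃ Circle₁ :=
  Equiv.ofBijective (fun p => seqPoint p) (by
    constructor
    · rintro ⟨p, hp⟩ ⟨q, hq⟩ h
      have hlt : ∀ {r : BinSeq}, ¬ EventuallyOnes r → val r ∈ Set.Ico (0 : ℝ) (0 + 1) := fun hr =>
        ⟨val_nonneg _, by
          rw [zero_add]; exact val_lt_one fun he => hr (he ▸ eventuallyOnes_ones)⟩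
      exact Subtype.ext (eq_of_val_eq hp hq
        ((AddCircle.coe_eq_coe_iff_of_mem_Ico (hlt hp) (hlt hq)).1 h))
    · intro q
      obtain ⟨p, hp, h⟩ := exists_seqPoint_eq q
      exact ⟨⟨p, hp⟩, h⟩)

/-! ### Adjacent leaves on the circle -/

section Tree

variable {X : FTV} {l : ℕ} (f : FreeForest Colour X 1 l)

theorem FreeForest.admits_leaves : X.Admits (f.tree 0).leaves := by
  simpa [List.finRange_succ] using f.admits

theorem FreeForest.mem_leaves (k : Fin l) : k ∈ (f.tree 0).leaves :=
  f.admits_leaves.perm.mem_iff.2 (List.mem_finRange k)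

theorem FreeForest.nodup_leaves : (f.tree 0).leaves.Nodup :=
  f.admits_leaves.perm.nodup_iff.2 (List.nodup_finRange l)

theorem FreeForest.leaves_isRotated (hX : X ≠ .V) : (f.tree 0).leaves ~r List.finRange l := by
  have h := f.admits_leaves
  cases X with
  | F => exact (show _ = _ from h) ▸ List.IsRotated.refl _
  | T => exact h
  | V => exact absurd rfl hX

/-- Addition in `Fin (m + 1)` wraps around, so the closing link of the cycle is the case of the last
index. -/
theorem chain_finRange {m : ℕ} {R : Fin (m + 1) → Fin (m + 1) → Prop}
    (h : Cycle.Chain R (List.finRange (m + 1) : Cycle (Fin (m + 1)))) (k : Fin (m + 1)) :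
    R k (k + 1) := by
  let R' : ℕ → ℕ → Prop := fun i j => ∀ (hi : i < m + 1) (hj : j < m + 1), R ⟨i, hi⟩ ⟨j, hj⟩
  have h' : Cycle.Chain R' (List.range m.succ : Cycle ℕ) := by
    have : (List.range m.succ : Cycle ℕ)
        = Cycle.map Fin.val (List.finRange (m + 1) : Cycle (Fin (m + 1))) := by
      rw [Cycle.map_coe, List.map_coe_finRange_eq_range]
    rw [this, Cycle.chain_map]
    exact h.imp fun i j hij _ _ => hij
  rw [Cycle.chain_range_succ] at h'
  induction k using Fin.lastCases with
  | last => rw [Fin.last_add_one]; exact h'.1 _ _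
  | cast k => rw [Fin.coeSucc_eq_succ]; exact h'.2 k k.2 _ _

/-- For forests of type `F` and `T`, consecutive leaves have a common end point on the circle. -/
theorem seqPoint_glue_succ {σ : Colour → Bool × BinSeq ≃ BinSeq} (hσ : ∀ c, IsSplitting (σ c))
    {m : ℕ} (f : FreeForest Colour X 1 (m + 1)) (hX : X ≠ .V) (k : Fin (m + 1)) :
    seqPoint (glue σ (f.tree 0) k ones) = seqPoint (glue σ (f.tree 0) (k + 1) zeros) := by
  obtain ⟨h1, h2, h3⟩ := isChain_glue hσ f.nodup_leaves
  refine chain_finRange (R := fun k k' => seqPoint (glue σ (f.tree 0) k ones)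
    = seqPoint (glue σ (f.tree 0) k' zeros)) ?_ k
  -- A cyclic chain ignores rotations, so it may be checked along the planar order of the leaves.
  rw [← Cycle.coe_eq_coe.2 (f.leaves_isRotated hX)]
  cases hL : (f.tree 0).leaves with
  | nil => exact absurd hL (CTree.leaves_ne_nil _)
  | cons a L =>
    rw [hL] at h1 h2 h3
    rw [Cycle.chain_coe_cons, ← List.cons_append]
    refine List.isChain_append.2 ⟨h1.imp fun k k' h => ?_, List.isChain_singleton _, ?_⟩
    · rw [seqPoint, seqPoint, h]
    -- The closing link joins the right end 1 to the left end 0, the same point of the circle.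
    · intro k hk k' hk'
      obtain rfl : a = k' := by simpa using hk'
      rw [seqPoint, seqPoint, h3 k hk, h2 a (by simp)]
      exact AddCircle.coe_period 1

end Tree

/-! ### The action on sequences and on the circle -/

section Induced

variable {n : ℕ} {x : PlanarTree Unit (n + 2)} {X : FTV}

/-- The action on the space of binary sequences. -/
noncomputable def seqAction (x : PlanarTree Unit (n + 2)) (X : FTV) :
    FSGroup (vinePresentation x) X →* Equiv.Perm BinSeq :=
  (Equiv.ofBijective (limitOf x .F) ⟨limitOf_injective, exists_limitOf_eq⟩).symm.permCongrHom.toMonoidHom.comp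
    (canonicalAction (vinePresentation x) X)

theorem limitOf_seqAction (g : FSGroup (vinePresentation x) X) (p : BinSeq) :
    limitOf x .F (seqAction x X g p)
      = canonicalAction (vinePresentation x) X g (limitOf x .F p) :=
  (Equiv.ofBijective (limitOf x .F) ⟨limitOf_injective, exists_limitOf_eq⟩).apply_symm_apply _

theorem exists_eq_mk (g : FSGroup (vinePresentation x) X) :
    ∃ (l : ℕ) (t s : FreeForest Colour X 1 l), g = Frac.mk (t.hom _) (s.hom _) := by
  induction g using Frac.ind with
  | @h A t s =>
  induction t using Quotient.inductionOn with
  | h t =>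
  induction s using Quotient.inductionOn with
  | h s => exact ⟨A.size, t, s, rfl⟩

/-- A group element moves the space on top of a leaf to the space on top of the leaf with the same
label. -/
theorem seqAction_glue {l : ℕ} (t s : FreeForest Colour X 1 l) (k : Fin l) (r : BinSeq) :
    seqAction x X (Frac.mk (t.hom _) (s.hom _)) (glue (split x) (s.tree 0) k r)
      = glue (split x) (t.tree 0) k r := by
  apply limitOf_injective (x := x)
  rw [limitOf_seqAction]
  refine canonicalAction_limitOf _ _ ?_
  exact (leafOf_glue _ (t.mem_leaves k) r).trans (leafOf_glue _ (s.mem_leaves k) r).symm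

theorem exists_glue_eq {l : ℕ} (s : FreeForest Colour X 1 l) (p : BinSeq) :
    ∃ k r, p = glue (split x) (s.tree 0) k r :=
  ⟨_, _, (glue_leafOf _ s.nodup_leaves p).symm⟩

theorem eventuallyOnes_glue {α : Type} (t : CTree Colour α) (k : α) (r : BinSeq) :
    EventuallyOnes (glue (split x) t k r) ↔ EventuallyOnes r :=
  (isBranch_glue (isSplitting_split x) t k).eventuallyOnes_iff r

theorem eventuallyOnes_seqAction (g : FSGroup (vinePresentation x) X) (p : BinSeq) :
    EventuallyOnes (seqAction x X g p) ↔ EventuallyOnes p := by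
  obtain ⟨l, t, s, rfl⟩ := exists_eq_mk g
  obtain ⟨k, r, rfl⟩ := exists_glue_eq (x := x) s p
  rw [seqAction_glue, eventuallyOnes_glue, eventuallyOnes_glue]

/-- The homomorphism to the group of bijections of the circle. -/
noncomputable def circleAction (x : PlanarTree Unit (n + 2)) (X : FTV) :
    FSGroup (vinePresentation x) X →* Equiv.Perm Circle₁ where
  toFun g := finiteExpansions.permCongr
    ((seqAction x X g).subtypePerm fun p => (eventuallyOnes_seqAction g p).not)
  map_one' := by
    ext q
    simp [Equiv.permCongr_apply]
  map_mul' g h := by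
    ext q
    simp [Equiv.permCongr_apply]

theorem circleAction_seqPoint (g : FSGroup (vinePresentation x) X) {p : BinSeq}
    (hp : ¬ EventuallyOnes p) : circleAction x X g (seqPoint p) = seqPoint (seqAction x X g p) := by
  have : seqPoint p = finiteExpansions ⟨p, hp⟩ := rfl
  rw [this]
  show finiteExpansions _ = _
  rw [Equiv.trans_apply, Equiv.symm_apply_apply]
  rfl

theorem circleAction_glue {l : ℕ} (t s : FreeForest Colour X 1 l) (k : Fin l) {r : BinSeq}
    (hr : ¬ EventuallyOnes r) :
    circleAction x X (Frac.mk (t.hom _) (s.hom _)) (seqPoint (glue (split x) (s.tree 0) k r))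
      = seqPoint (glue (split x) (t.tree 0) k r) := by
  rw [circleAction_seqPoint _ (by rwa [eventuallyOnes_glue]), seqAction_glue]

theorem seqPoint_glue_congr {α : Type} (t : CTree Colour α) (k : α) {p q : BinSeq}
    (h : val p = val q) :
    seqPoint (glue (split x) t k p) = seqPoint (glue (split x) t k q) :=
  congrArg ((↑) : ℝ → Circle₁) ((isBranch_glue (isSplitting_split x) t k).val_congr h)

/-- For the types `F` and `T`, all points of the boundary are respected. -/
theorem circleAction_glue_of_ne {l : ℕ} (hX : X ≠ .V) (t s : FreeForest Colour X 1 l) (k : Fin l)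
    (r : BinSeq) :
    circleAction x X (Frac.mk (t.hom _) (s.hom _)) (seqPoint (glue (split x) (s.tree 0) k r))
      = seqPoint (glue (split x) (t.tree 0) k r) := by
  by_cases hr : r = ones
  · subst hr
    cases l with
    | zero => exact k.elim0
    | succ m =>
      -- In both trees the right end over leaf k is the left end over leaf k + 1, and the sequence
      -- 000… there is not eventually 1.
      rw [seqPoint_glue_succ (isSplitting_split x) s hX,
        seqPoint_glue_succ (isSplitting_split x) t hX,
        circleAction_glue _ _ _ not_eventuallyOnes_zeros]
  · obtain ⟨q, hq, hqr⟩ := exists_val_eq (val_nonneg r) (val_lt_one hr)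
    rw [← seqPoint_glue_congr (s.tree 0) k hqr, ← seqPoint_glue_congr (t.tree 0) k hqr,
      circleAction_glue _ _ _ hq]

/-- Every point of the circle has an expansion that is not eventually 1, which forces uniqueness.
For F and T the remaining expansions are respected because adjacent leaf ends match. -/
theorem isInduced_iff (g : FSGroup (vinePresentation x) X) (h : Equiv.Perm Circle₁) :
    IsInduced .a g h ↔ h = circleAction x X g := by
  have hpt : ∀ p, circlePoint .a (limitOf x .F p) = seqPoint p := circlePoint_limitOf
  have hact : ∀ p, circlePoint .a (canonicalAction (vinePresentation x) X g (limitOf x .F p))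
      = seqPoint (seqAction x X g p) := fun p => by rw [← limitOf_seqAction, hpt]
  constructor
  · intro H
    ext q
    obtain ⟨p, hp, rfl⟩ := exists_seqPoint_eq q
    have := H (limitOf x .F p) fun _ => by rwa [eventuallyOne_limitOf]
    rw [hpt, hact] at this
    rw [this, circleAction_seqPoint g hp]
  · rintro rfl ξ hξ
    obtain ⟨p, rfl⟩ := exists_limitOf_eq ξ
    rw [hpt, hact]
    by_cases hX : X = .V
    · exact circleAction_seqPoint g (by simpa only [eventuallyOne_limitOf] using hξ hX)
    · obtain ⟨l, t, s, rfl⟩ := exists_eq_mk g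
      obtain ⟨k, r, rfl⟩ := exists_glue_eq (x := x) s p
      rw [circleAction_glue_of_ne hX, seqAction_glue]

/-- Finitely many copies of the Cantor space, one over each leaf of `s`, map onto the circle. This
is a closed map from a compact space to a Hausdorff one, hence a quotient map, and pulling the
bijection back along it gives the corresponding continuous map for `t`. -/
theorem continuous_circleAction (hX : X ≠ .V) (g : FSGroup (vinePresentation x) X) :
    Continuous (circleAction x X g) := by
  obtain ⟨l, t, s, rfl⟩ := exists_eq_mk g
  have hc : ∀ f : FreeForest Colour X 1 l, Continuous fun u : Fin l × BinSeq =>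
      seqPoint (glue (split x) (f.tree 0) u.1 u.2) := fun f =>
    continuous_seqPoint.comp (continuous_prod_of_discrete_left.2 fun k =>
      (isBranch_glue (isSplitting_split x) (f.tree 0) k).continuous)
  have hs : Function.Surjective fun u : Fin l × BinSeq =>
      seqPoint (glue (split x) (s.tree 0) u.1 u.2) := by
    intro q
    obtain ⟨p, -, rfl⟩ := exists_seqPoint_eq q
    obtain ⟨k, r, rfl⟩ := exists_glue_eq (x := x) s p
    exact ⟨(k, r), rfl⟩
  rw [((hc s).isClosedMap.isQuotientMap (hc s) hs).continuous_iff]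
  exact (hc t).congr fun u => (circleAction_glue_of_ne hX t s u.1 u.2).symm

/-- In type F the leaf 0 is the leftmost one in both trees, and its left end is the point 0. -/
theorem circleAction_zero (g : FSGroup (vinePresentation x) .F) : circleAction x .F g 0 = 0 := by
  obtain ⟨l, t, s, rfl⟩ := exists_eq_mk g
  cases l with
  | zero => exact absurd (show _ = _ from t.admits_leaves) (CTree.leaves_ne_nil _)
  | succ m =>
    have h0 : ∀ f : FreeForest Colour .F 1 (m + 1),
        seqPoint (glue (split x) (f.tree 0) 0 zeros) = 0 := by
      intro f
      have hf : (f.tree 0).leaves = List.finRange (m + 1) := f.admits_leaves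
      rw [seqPoint, (isChain_glue (isSplitting_split x) f.nodup_leaves).2.1 0
        (by rw [hf, List.finRange_succ]; rfl), AddCircle.coe_zero]
    rw [← h0 s, circleAction_glue _ _ _ not_eventuallyOnes_zeros, h0, h0]

end Induced

/-! ### Germs and breakpoints -/

theorem RightAffineAt.congr_point {h : Circle₁ → Circle₁} {m x y : ℝ} (H : RightAffineAt h m x)
    (hxy : (x : Circle₁) = y) : RightAffineAt h m y := by
  have ht : Tendsto (fun z => x + (z - y)) (𝓝[≥] y) (𝓝[≥] x) := by
    refine tendsto_nhdsWithin_iff.2 ⟨?_, ?_⟩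
    · have : Continuous fun z => x + (z - y) := by fun_prop
      simpa using (this.tendsto y).mono_left nhdsWithin_le_nhds
    · filter_upwards [self_mem_nhdsWithin] with z hz
      exact le_add_of_nonneg_right (sub_nonneg.2 (Set.mem_Ici.1 hz))
  filter_upwards [ht.eventually H] with z hz
  rw [AddCircle.coe_add, hxy, ← AddCircle.coe_add, add_sub_cancel, add_sub_cancel_left] at hz
  exact hz

theorem LeftAffineAt.exists_forall {h : Circle₁ → Circle₁} {m x : ℝ} (H : LeftAffineAt h m x) :
    ∃ y < x, ∀ z ∈ Set.Ioo y x, HasSlopeAt h m (z : Circle₁) := by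
  obtain ⟨y, hy, hyx⟩ := mem_nhdsLE_iff_exists_Ioc_subset.1 H
  refine ⟨y, hy, fun z hz => hasSlopeAt_of_eventually ?_⟩
  filter_upwards [isOpen_Ioo.mem_nhds hz] with w hw
  have h1 : h (w : Circle₁) = _ := hyx ⟨hw.1, hw.2.le⟩
  have h2 : h (z : Circle₁) = _ := hyx ⟨hz.1, hz.2.le⟩
  rw [h1, h2, add_assoc, ← AddCircle.coe_add]
  congr 2
  ring

theorem not_accPt_breakpoints {h : Circle₁ → Circle₁} {m m' x : ℝ} (H : RightAffineAt h m x)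
    (H' : LeftAffineAt h m' x) : ¬ AccPt (x : Circle₁) (𝓟 (breakpoints h)) := by
  rw [accPt_iff_frequently, not_frequently, ← map_coe_nhds, eventually_map]
  obtain ⟨ε, hε, h1⟩ := H.exists_forall
  obtain ⟨y, hy, h2⟩ := H'.exists_forall
  filter_upwards [Ioo_mem_nhds hy (show x < x + ε by linarith)] with z hz
  rintro ⟨hne, hB⟩
  rcases lt_trichotomy z x with hlt | rfl | hlt
  · exact hB ⟨_, h2 z ⟨hz.1, hlt⟩⟩
  · exact hne rfl
  · have := h1 (z - x) (by linarith) (by linarith [hz.2])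
    rw [add_sub_cancel] at this
    exact hB ⟨_, this⟩

/-- Two branches replace a common prefix near a given point. -/
theorem BinSeq.IsBranch.replace₂ {f g : BinSeq → BinSeq} (hf : IsBranch f) (hg : IsBranch g)
    {p : BinSeq} (hp : p ≠ BinSeq.ones) : ∃ u q w w', p = prepend u q ∧
      (∀ r, f (prepend u r) = prepend w r) ∧ ∀ r, g (prepend u r) = prepend w' r := by
  obtain ⟨u, q, w, rfl, h⟩ := (hf.replace p hp).2
  obtain ⟨u', q', w', h1, h'⟩ := (hg.replace _ hp).2
  rcases prepend_eq_prepend h1 with ⟨v, rfl, rfl⟩ | ⟨v, rfl, rfl⟩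
  · refine ⟨u ++ v, q', w ++ v, w', by rw [prepend_append], fun r => ?_, h'⟩
    rw [prepend_append, h, ← prepend_append]
  · refine ⟨u' ++ v, q, w, w' ++ v, rfl, h, fun r => ?_⟩
    rw [prepend_append, h', ← prepend_append]

/-! ### The induced bijections are infinite piecewise linear -/

section InfinitePL

variable {n : ℕ} {x : PlanarTree Unit (n + 2)} {X : FTV}

/-- Around every point on top of a leaf, except the right end, the bijection is affine on a dyadic
interval. -/
theorem exists_affine_interval {l : ℕ} (t s : FreeForest Colour X 1 l) (k : Fin l) {r : BinSeq}
    (hr : r ≠ ones) : ∃ (u : List Bool) (q : BinSeq) (a δ : ℝ) (e : ℤ), r = prepend u q ∧ 0 < δ ∧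
      (a : Circle₁) ∈ dyadic ∧
      circleAction x X (Frac.mk (t.hom _) (s.hom _)) a ∈ dyadic ∧
      val (glue (split x) (s.tree 0) k r) = a + δ * val q ∧
      ∀ y ∈ Set.Ico a (a + δ), circleAction x X (Frac.mk (t.hom _) (s.hom _)) (y : Circle₁)
        = seqPoint (glue (split x) (t.tree 0) k r)
          + ((2 ^ e * (y - val (glue (split x) (s.tree 0) k r)) : ℝ) : Circle₁) := by
  obtain ⟨u, q, w, w', rfl, hw, hw'⟩ :=
    (isBranch_glue (isSplitting_split x) (s.tree 0) k).replace₂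
      (isBranch_glue (isSplitting_split x) (t.tree 0) k) hr
  have hdy : ∀ v : List Bool, seqPoint (prepend v zeros) ∈ dyadic := fun v => by
    obtain ⟨i, hi⟩ := val_prepend_zeros v
    exact coe_mem_dyadic.2 ⟨i, _, hi⟩
  have hval : ∀ (v : List Bool) (p : BinSeq),
      val (prepend v p) = val (prepend v zeros) + (2 ^ v.length)⁻¹ * val p := fun v p => by
    rw [val_prepend, div_eq_inv_mul]
  -- The interval consists of the numbers whose expansion starts with `w`; exchanging `w` for `w'`
  -- scales it by 2^(|w| - |w'|).
  refine ⟨u, q, val (prepend w zeros), (2 ^ w.length)⁻¹, w.length - w'.length, rfl,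
    by positivity, hdy w, ?_, by rw [hw, hval], fun y hy => ?_⟩
  · have h := circleAction_glue (x := x) t s k (r := prepend u zeros)
      (by rw [eventuallyOnes_prepend]; exact not_eventuallyOnes_zeros)
    rw [hw, hw'] at h
    exact h ▸ hdy w'
  · have hpos : (0 : ℝ) < 2 ^ w.length := by positivity
    -- The relative position of `y` in the interval supplies the digits after `w`, chosen not
    -- eventually 1 so that the action is known there.
    obtain ⟨p, hp, hpy⟩ := exists_val_eq (x := 2 ^ w.length * (y - val (prepend w zeros)))
      (mul_nonneg hpos.le (sub_nonneg.2 hy.1)) (by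
        rw [← lt_inv_mul_iff₀ hpos, mul_one]; linarith [hy.2])
    have hy' : y = val (prepend w p) := by
      rw [hval, hpy]
      field_simp
      ring
    have h := circleAction_glue (x := x) t s k (r := prepend u p) (by rwa [eventuallyOnes_prepend])
    rw [hw, hw'] at h
    rw [hy', hw, hw']
    refine h.trans ?_
    rw [seqPoint, seqPoint, ← AddCircle.coe_add]
    congr 1
    rw [hval w p, hval w q, hval w' p, hval w' q, zpow_sub₀ two_ne_zero, zpow_natCast, zpow_natCast]
    field_simp
    ring

/-- Only the left ends of the finitely many leaves of `s` can fail to have an affine germ on the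
left. They contain all discontinuities and all accumulation points of breakpoints. -/
theorem isInfinitePL_circleAction (g : FSGroup (vinePresentation x) X) :
    IsInfinitePL (circleAction x X g) := by
  obtain ⟨l, t, s, rfl⟩ := exists_eq_mk g
  set h := circleAction x X (Frac.mk (t.hom _) (s.hom _)) with hh
  have hones : ∀ {r : BinSeq}, ¬ EventuallyOnes r → r ≠ ones := fun hr he =>
    hr (he ▸ eventuallyOnes_ones)
  have hcov : ∀ q : Circle₁, ∃ k r, ¬ EventuallyOnes r ∧
      seqPoint (glue (split x) (s.tree 0) k r) = q := by
    intro q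
    obtain ⟨p, hp, rfl⟩ := exists_seqPoint_eq q
    obtain ⟨k, r, rfl⟩ := exists_glue_eq (x := x) s p
    exact ⟨k, r, by rwa [eventuallyOnes_glue] at hp, rfl⟩
  have hright : ∀ k r, ¬ EventuallyOnes r →
      ∃ e : ℤ, RightAffineAt h (2 ^ e) (val (glue (split x) (s.tree 0) k r)) := by
    intro k r hr
    obtain ⟨u, q, a, δ, e, rfl, hδ, -, -, hP, H⟩ := exists_affine_interval (x := x) t s k (hones hr)
    rw [eventuallyOnes_prepend] at hr
    have h1 := val_lt_one (hones hr)
    have h2 := val_nonneg q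
    have hmem : val (glue (split x) (s.tree 0) k (prepend u q)) ∈ Set.Ico a (a + δ) := by
      rw [hP]; exact ⟨by nlinarith, by nlinarith⟩
    refine ⟨e, ?_⟩
    have := H _ hmem
    rw [sub_self, mul_zero, AddCircle.coe_zero, add_zero] at this
    filter_upwards [Ico_mem_nhdsGE hmem.2] with y hy
    rw [H y ⟨hmem.1.trans hy.1, hy.2⟩, ← this]
  have hleft : ∀ k r, ¬ EventuallyOnes r → r ≠ zeros →
      ∃ e : ℤ, LeftAffineAt h (2 ^ e) (val (glue (split x) (s.tree 0) k r)) := by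
    intro k r hr hr0
    -- An expansion with infinitely many ones places the point strictly to the right of the left end
    -- of its dyadic interval, so the affine formula is available on its left.
    obtain ⟨r', hrr', hr'⟩ := exists_left_expansion hr0
    have hne : r' ≠ ones := fun he => by
      rw [he, val_ones] at hrr'
      exact (val_lt_one (hones hr)).ne hrr'.symm
    obtain ⟨u, q, a, δ, e, rfl, hδ, -, -, hP, H⟩ := exists_affine_interval (x := x) t s k hne
    have hs := (isBranch_glue (isSplitting_split x) (s.tree 0) k).val_congr hrr'
    have ht : seqPoint (glue (split x) (t.tree 0) k (prepend u q)) = h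
        (val (glue (split x) (s.tree 0) k r) : Circle₁) :=
      (seqPoint_glue_congr _ _ hrr').trans (circleAction_glue t s k hr).symm
    have h1 : 0 < val q := by
      refine (val_nonneg q).lt_of_ne' fun h0 => ?_
      obtain ⟨i, hi, hqi⟩ := hr' u.length
      obtain ⟨j, rfl⟩ := Nat.exists_eq_add_of_le' hi
      rw [prepend_apply_add, eq_zeros_of_val h0] at hqi
      exact Bool.false_ne_true hqi
    have h2 := val_le_one q
    rw [hs] at hP H
    rw [ht] at H
    refine ⟨e, ?_⟩
    have hlt : a < val (glue (split x) (s.tree 0) k r) := by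
      rw [hP]; exact lt_add_of_pos_right _ (mul_pos hδ h1)
    have hle : val (glue (split x) (s.tree 0) k r) ≤ a + δ := by
      rw [hP]; nlinarith
    filter_upwards [Ioc_mem_nhdsLE hlt] with y hy
    -- The point may be the excluded right end of the dyadic interval, but at the point itself the
    -- formula is trivial.
    rcases hy.2.eq_or_lt with rfl | hylt
    · simp
    · exact H y ⟨hy.1.le, hylt.trans_le hle⟩
  have hgood : ∀ q : Circle₁, q ∉ Set.range (fun k : Fin l =>
      seqPoint (glue (split x) (s.tree 0) k zeros)) → ∃ (y : ℝ) (m m' : ℝ), (y : Circle₁) = q ∧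
        RightAffineAt h m y ∧ LeftAffineAt h m' y := by
    intro q hq
    obtain ⟨k, r, hr, rfl⟩ := hcov q
    obtain ⟨e, he⟩ := hright k r hr
    obtain ⟨e', he'⟩ := hleft k r hr fun h0 => hq ⟨k, by rw [h0]⟩
    exact ⟨_, _, _, rfl, he, he'⟩
  refine .of_rightAffineAt (fun y => ?_) ?_ ?_ ?_ ?_
  · obtain ⟨k, r, hr, hq⟩ := hcov y
    obtain ⟨e, he⟩ := hright k r hr
    exact ⟨e, he.congr_point hq⟩
  · refine (Set.finite_range fun k : Fin l =>
      seqPoint (glue (split x) (s.tree 0) k zeros)).subset fun q hq => ?_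
    by_contra hn
    obtain ⟨y, m, m', rfl, h1, h2⟩ := hgood q hn
    exact hq (h1.continuousAt h2)
  · refine (Set.finite_range fun k : Fin l =>
      seqPoint (glue (split x) (s.tree 0) k zeros)).subset fun q hq => ?_
    by_contra hn
    obtain ⟨y, m, m', rfl, h1, h2⟩ := hgood q hn
    exact not_accPt_breakpoints h1 h2 hq
  · intro p hp
    by_contra hn
    obtain ⟨k, r, hr, rfl⟩ := hcov p
    obtain ⟨u, q, a, δ, e, rfl, hδ, ha, -, hP, H⟩ := exists_affine_interval (x := x) t s k (hones hr)
    rw [eventuallyOnes_prepend] at hr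
    have h1 := val_lt_one (hones hr)
    have h2 : 0 < val q := by
      -- A point that is not dyadic cannot be the left end `a`; it is interior to the interval of
      -- affinity and hence no breakpoint.
      refine (val_nonneg q).lt_of_ne' fun h0 => hn ?_
      rw [seqPoint, hP, h0, mul_zero, add_zero]
      exact ha
    have hmem : val (glue (split x) (s.tree 0) k (prepend u q)) ∈ Set.Ioo a (a + δ) := by
      rw [hP]; exact ⟨by nlinarith, by nlinarith⟩
    refine hp ⟨2 ^ e, hasSlopeAt_of_eventually ?_⟩
    have := H _ (Set.Ioo_subset_Ico_self hmem)
    rw [sub_self, mul_zero, AddCircle.coe_zero, add_zero] at this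
    filter_upwards [isOpen_Ioo.mem_nhds hmem] with y hy
    rw [H y (Set.Ioo_subset_Ico_self hy), ← this]
  · intro p hp
    obtain ⟨k, r, hr, rfl⟩ := hcov p
    obtain ⟨u, q, a, δ, e, rfl, hδ, ha, hha, hP, H⟩ :=
      exists_affine_interval (x := x) t s k (hones hr)
    rw [hh, circleAction_glue t s k hr]
    have h1 := H a ⟨le_rfl, by linarith⟩
    rw [h1] at hha
    -- The image of the point differs from the dyadic image of `a` by a power of 2 times a dyadic
    -- number.
    have h2 : ((2 ^ e * (a - val (glue (split x) (s.tree 0) k (prepend u q))) : ℝ) : Circle₁)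
        ∈ dyadic := by
      rw [dyadic_zpow_mul_iff, AddCircle.coe_sub]
      exact dyadic_sub ha hp
    simpa using dyadic_sub hha h2

theorem circleAction_mem_infinitePL (g : FSGroup (vinePresentation x) X) :
    circleAction x X g ∈ infinitePL X := by
  cases X with
  | F => exact ⟨isInfinitePL_circleAction g, continuous_circleAction (by simp) g,
      circleAction_zero g⟩
  | T => exact ⟨isInfinitePL_circleAction g, continuous_circleAction (by simp) g⟩
  | V => exact isInfinitePL_circleAction g

end InfinitePL

end ForestSkein

theorem theorem4p2 (n : ℕ) (x : ForestSkein.PlanarTree Unit (n + 2)) (X : ForestSkein.FTV) :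
    ∃ γ : ForestSkein.FSGroup (ForestSkein.vinePresentation x) X →*
        Equiv.Perm (AddCircle (1 : ℝ)),
      (∀ (g : ForestSkein.FSGroup (ForestSkein.vinePresentation x) X)
        (h : Equiv.Perm (AddCircle (1 : ℝ))),
        ForestSkein.IsInduced ForestSkein.Colour.a g h ↔ h = γ g) ∧
      ∃ H : Subgroup (Equiv.Perm (AddCircle (1 : ℝ))),
        (H : Set (Equiv.Perm (AddCircle (1 : ℝ)))) = ForestSkein.infinitePL X ∧ γ.range ≤ H := by
  refine ⟨ForestSkein.circleAction x X, ForestSkein.isInduced_iff,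
    ForestSkein.infinitePLSubgroup X, rfl, ?_⟩
  rintro _ ⟨g, rfl⟩
  exact ForestSkein.circleAction_mem_infinitePL g
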